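/- \textbf{Setting.} Fix $M\ge 0$, $T_1,T_2\in\mathbb N$, $T=T_1+T_2$, and $\pi_1\neq\pi_2$ in $[0,1]$. On one probability space consider, for every population size $N$, a system with units $n=1,\dots,N$. Let $Y_0\in\mathbb R^N$ be initial outcomes, $X^n\in\mathbb R^M$ covariates, $(\Delta^n,\Xi^n,\Lambda^n,\Gamma^n,\Theta^n)\in\mathbb R^4\times\mathbb R^M$ random coefficients, and for $0\le t<T$ $$Y_{t+1}=(A+B_t)\,g_t+\varepsilon_t,\qquad g_t^n=\Delta^n+\Xi^nY_t^n+\Lambda^nW^n_{t+1}+\Gamma^nY_t^nW^n_{t+1}+(\Theta^n)^{\top}X^n .$$ For each $N$ the entries of $A$ are i.i.d. $\mathcal N(\mu/N,\sigma^2/N)$, those of $B_t$ are i.i.d. $\mathcal N(\mu_0/N,\sigma_t^2/N)$, the entries of $\varepsilon_t$ are i.i.d. $\mathcal N(0,\sigma_e^2)$ (independent over $t$); the coefficient vectors of the units are i.i.d. with a law $q$ not depending on $N$; the treatments are independent over the units, with $W^n_t\sim\mathrm{Bernoulli}(\pi_1)$ for $1\le t\le T_1$ and $W^n_t\sim\mathrm{Bernoulli}(\pi_2)$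 for $T_1<t\le T$. The matrix $A$, the matrices $(B_t)_t$, the noise $(\varepsilon_t)_t$, the treatments, the coefficients, and the pair $(Y_0,X)$ are mutually independent. Nothing is assumed on the joint law of systems of different sizes. The potential outcomes $Y^{1}_t$ and $Y^{0}_t$ are obtained from the same recursion with the same $Y_0,A,B_t,\varepsilon_t$, covariates and coefficients, when all treatments are replaced by $1$, respectively by $0$. \textbf{Regularity.} Let $k\ge 4$. (i) Almost surely, as $N\to\infty$, the empirical distribution of the extended covariates $(\Delta^n,\Xi^n,\Lambda^n,\Gamma^n,\Theta^n,X^n)_{n\le N}$ converges weakly to $q\times p$ for a probability measure $p$ on $\mathbb R^M$, $q\times p$ has a finite $k$-th absolute moment, and the empirical $k$-th absolute moments converge to it. (ii) Almost surely $\frac1N\sum_n Y_0^n$ converges to a constant, and $\frac1N\sum_n (Y_0^n)^2$ and, for $w=0$ and $w=1$, $\frac1N\sum_n\big(\Delta^n+\Xi^nY_0^n+\Lambda^nw+\Gamma^nY_0^nw+(\Theta^n)^{\top}X^n\big)^2$ are bounded in $N$. (iii) The two regressions below are non-degenerate in the limit: there are two times in $\{0,\dots,T_1-1\}$, and two times in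 $\{T_1,\dots,T-1\}$, at which the sample means $\widehat\nu_t=\frac1N\sum_{n}Y_t^n$ of the observed outcomes converge almost surely to two different constants. \textbf{Estimator.} Regress, by least squares with intercept, $(\widehat\nu_1,\dots,\widehat\nu_{T_1})$ on $(\widehat\nu_0,\dots,\widehat\nu_{T_1-1})$ to get slope $b_1$ and intercept $a_1$, and $(\widehat\nu_{T_1+1},\dots,\widehat\nu_T)$ on $(\widehat\nu_{T_1},\dots,\widehat\nu_{T-1})$ to get slope $b_2$ and intercept $a_2$. Put $$\widehat\Xi=\tfrac12\Big(b_2+b_1-\tfrac{(b_2-b_1)(\pi_2+\pi_1)}{\pi_2-\pi_1}\Big),\quad \widehat\Gamma=\tfrac{b_2-b_1}{\pi_2-\pi_1},\quad \widehat\Lambda=\tfrac{a_2-a_1}{\pi_2-\pi_1}.$$ Let $\widehat\nu^1_0=\widehat\nu_0$, $\widehat{\mathrm{TTE}}_0(1,0)=0$, and for $0\le t<T$, with $\pi=\pi_1$ if $t\le T_1-1$ and $\pi=\pi_2$ otherwise, $$\widehat\nu^1_{t+1}=\widehat\nu_{t+1}+\widehat\Xi(\widehat\nu^1_t-\widehat\nu_t)+\widehat\Lambda(1-\pi)+\widehat\Gamma(\widehat\nu^1_t-\pi\widehat\nu_t),\qquad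 \widehat{\mathrm{TTE}}_{t+1}(1,0)=\widehat\Xi\,\widehat{\mathrm{TTE}}_t(1,0)+\widehat\Lambda+\widehat\Gamma\,\widehat\nu^1_t .$$ \textbf{Theorem.} For every $t\in\{0,1,\dots,T\}$ the total treatment effect $\mathrm{TTE}_t(1,0)=\lim_{N\to\infty}\frac1N\sum_{n=1}^N\big(Y_t^{1,n}-Y_t^{0,n}\big)$ exists almost surely and is a deterministic constant, and $\lim_{N\to\infty}\widehat{\mathrm{TTE}}_t(1,0)=\mathrm{TTE}_t(1,0)$ almost surely. -/

import Mathlib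

open MeasureTheory ProbabilityTheory Filter Topology
open scoped NNReal BoundedContinuousFunction

noncomputable section

/-- The average `(1/N) ∑ n, v n` over a population of `N` units. -/
def popMean {N : ℕ} (v : Fin N → ℝ) : ℝ := (∑ n, v n) / (N : ℝ)

/-- The random coefficients `(Δ, Ξ, Λ, Γ, Θ)` of one unit. -/
abbrev Coef (M : ℕ) : Type := ℝ × ℝ × ℝ × ℝ × (Fin M → ℝ)

/-- Baseline effect `Δ`. -/
def Coef.base {M : ℕ} (c : Coef M) : ℝ := c.1

/-- Effect `Ξ` of the current outcome. -/
def Coef.carry {M : ℕ} (c : Coef M) : ℝ := c.2.1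

/-- Effect `Λ` of the treatment. -/
def Coef.treat {M : ℕ} (c : Coef M) : ℝ := c.2.2.1

/-- Effect `Γ` of the outcome-treatment interaction. -/
def Coef.inter {M : ℕ} (c : Coef M) : ℝ := c.2.2.2.1

/-- Effect `Θ` of the covariates. -/
def Coef.covar {M : ℕ} (c : Coef M) : Fin M → ℝ := c.2.2.2.2

/-- The outcome function
`g(y, w, x) = Δ + Ξ y + Λ w + Γ y w + Θᵀ x` of a unit with coefficients `c = (Δ, Ξ, Λ, Γ, Θ)`,
current outcome `y`, next-period treatment `w` and covariates `x`. -/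
def outcomeFun {M : ℕ} (c : Coef M) (x : Fin M → ℝ) (w y : ℝ) : ℝ :=
  c.base + c.carry * y + c.treat * w + c.inter * y * w + c.covar ⬝ᵥ x

/-- The primitive random objects of a sequence of systems indexed by the population size `N`, all
on one sample space `Ω`. No relation between the systems of different sizes is built in. -/
structure Systems (Ω : Type*) (M : ℕ) where
  /-- fixed interference matrix, `A N ω i j` -/
  A : (N : ℕ) → Ω → Fin N → Fin N → ℝ
  /-- time-dependent interference matrices, `B N t ω i j` -/
  B : (N : ℕ) → ℕ → Ω → Fin N → Fin N → ℝ
  /-- noise, `noise N t ω i` -/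
  noise : (N : ℕ) → ℕ → Ω → Fin N → ℝ
  /-- treatments assigned in the experiment, `W N t ω n` at the times `t ≥ 1` -/
  W : (N : ℕ) → ℕ → Ω → Fin N → ℝ
  /-- unit-specific coefficients -/
  coef : (N : ℕ) → Ω → Fin N → Coef M
  /-- covariates -/
  X : (N : ℕ) → Ω → Fin N → (Fin M → ℝ)
  /-- initial outcomes -/
  Y₀ : (N : ℕ) → Ω → Fin N → ℝ

namespace Systems

variable {Ω : Type*} {M : ℕ}

/-- Outcomes when unit `n` receives the treatment `V t n` at time `t`:
`Y_{t+1} = (A + B_t) g(Y_t, V_{t+1}, X) + noise_t`, started from `Y₀`. -/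
def outcome (S : Systems Ω M) (N : ℕ) (ω : Ω) (V : ℕ → Fin N → ℝ) : ℕ → Fin N → ℝ
  | 0 => S.Y₀ N ω
  | t + 1 => fun i =>
      ∑ j, (S.A N ω i j + S.B N t ω i j) *
        outcomeFun (S.coef N ω j) (S.X N ω j) (V (t + 1) j) (outcome S N ω V t j)
      + S.noise N t ω i

/-- Observed outcomes: the treatments are those assigned in the experiment. -/
def obs (S : Systems Ω M) (N : ℕ) (ω : Ω) (t : ℕ) : Fin N → ℝ :=
  S.outcome N ω (fun s n => S.W N s ω n) t

/-- Counterfactual outcomes when every unit has the treatment `w` at all times. -/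
def constOutcome (S : Systems Ω M) (w : ℝ) (N : ℕ) (ω : Ω) (t : ℕ) : Fin N → ℝ :=
  S.outcome N ω (fun _ _ => w) t

/-- Sample mean of the observed outcomes at time `t`. -/
def obsMean (S : Systems Ω M) (N : ℕ) (ω : Ω) (t : ℕ) : ℝ := popMean (S.obs N ω t)

end Systems

section Laws

variable {Ω : Type*} {M : ℕ} [MeasurableSpace Ω]

/-- For each `N`: the entries of `A` are i.i.d. `N(μ/N, σ²/N)`; for each `t < T` the entries of
`B_t` are i.i.d. `N(μ₀/N, σ_t²/N)`; the noise variables are i.i.d. `N(0, σ_e²)`. The `B_t` are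
independent over `t`, and so are the noise vectors. -/
structure GaussianModel (S : Systems Ω M) (P : Measure Ω) (T : ℕ) (μ μ₀ : ℝ) (σ2 : ℝ≥0)
    (σ2t : ℕ → ℝ≥0) (σ2e : ℝ≥0) : Prop where
  A_law : ∀ N i j, HasLaw (fun ω => S.A N ω i j) (gaussianReal (μ / N) (σ2 / N)) P
  A_indep : ∀ N, iIndepFun (fun (e : Fin N × Fin N) ω => S.A N ω e.1 e.2) P
  B_law : ∀ N, ∀ t < T, ∀ i j,
    HasLaw (fun ω => S.B N t ω i j) (gaussianReal (μ₀ / N) (σ2t t / N)) P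
  B_indep : ∀ N, iIndepFun
    (fun (e : Fin T × Fin N × Fin N) ω => S.B N e.1 ω e.2.1 e.2.2) P
  noise_law : ∀ N, ∀ t < T, ∀ i, HasLaw (fun ω => S.noise N t ω i) (gaussianReal 0 σ2e) P
  noise_indep : ∀ N, iIndepFun (fun (e : Fin T × Fin N) ω => S.noise N e.1 ω e.2) P

/-- Two-stage Bernoulli design: at the times `1, …, T₁` every unit is treated with probability
`π₁`, at the times `T₁ + 1, …, T₁ + T₂` with probability `π₂`, independently over the units. The
treatments of one unit at different times may be drawn afresh or be kept within a stage. -/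
structure TwoStageBernoulli (S : Systems Ω M) (P : Measure Ω) (T₁ T₂ : ℕ)
    (π₁ π₂ : unitInterval) : Prop where
  law : ∀ N, ∀ t < T₁ + T₂, ∀ n, HasLaw (fun ω => S.W N (t + 1) ω n)
    (bernoulliMeasure (1 : ℝ) 0 (if t < T₁ then π₁ else π₂)) P
  indep : ∀ N, iIndepFun
    (fun (n : Fin N) ω (t : Fin (T₁ + T₂)) => S.W N ((t : ℕ) + 1) ω n) P

/-- For each `N`, the coefficients of the units are i.i.d. with law `q`. -/
structure IIDCoefs (S : Systems Ω M) (P : Measure Ω) (q : Measure (Coef M)) : Prop where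
  law : ∀ N n, HasLaw (fun ω => S.coef N ω n) q P
  indep : ∀ N, iIndepFun (fun (n : Fin N) ω => S.coef N ω n) P

/-- For each `N`, the six blocks `A`, `(B_t)_{t<T}`, `(noise_t)_{t<T}`, `(W_t)_{1≤t≤T}`, the
coefficients, and the pair of initial outcomes and covariates (which may depend on each other) are
mutually independent: each block is independent of all the later ones together. -/
structure IndepBlocks (S : Systems Ω M) (P : Measure Ω) (T : ℕ) : Prop where
  meas_Y₀ : ∀ N, Measurable (S.Y₀ N)
  meas_X : ∀ N, Measurable (S.X N)
  A_indep : ∀ N, IndepFun (S.A N)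
    (fun ω => ((fun t : Fin T => S.B N t ω), (fun t : Fin T => S.noise N t ω),
      (fun t : Fin T => S.W N ((t : ℕ) + 1) ω), S.coef N ω, S.Y₀ N ω, S.X N ω)) P
  B_indep : ∀ N, IndepFun (fun ω (t : Fin T) => S.B N t ω)
    (fun ω => ((fun t : Fin T => S.noise N t ω),
      (fun t : Fin T => S.W N ((t : ℕ) + 1) ω), S.coef N ω, S.Y₀ N ω, S.X N ω)) P
  noise_indep : ∀ N, IndepFun (fun ω (t : Fin T) => S.noise N t ω)
    (fun ω => ((fun t : Fin T => S.W N ((t : ℕ) + 1) ω), S.coef N ω, S.Y₀ N ω, S.X N ω)) P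
  W_indep : ∀ N, IndepFun (fun ω (t : Fin T) => S.W N ((t : ℕ) + 1) ω)
    (fun ω => (S.coef N ω, S.Y₀ N ω, S.X N ω)) P
  coef_indep : ∀ N, IndepFun (S.coef N) (fun ω => (S.Y₀ N ω, S.X N ω)) P

/-- Almost surely, the empirical distribution of the extended covariates `(coef, X)` converges
weakly to `q × p`, which has a finite moment of order `k`, and the empirical moments of order `k`
converge to it. -/
structure ExtendedCovariates (S : Systems Ω M) (P : Measure Ω) (q : Measure (Coef M))
    (p : Measure (Fin M → ℝ)) (k : ℝ) : Prop where
  weak : ∀ᵐ ω ∂P, ∀ f : (Coef M × (Fin M → ℝ)) →ᵇ ℝ,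
    Tendsto (fun N => popMean fun n : Fin N => f (S.coef N ω n, S.X N ω n)) atTop
      (𝓝 (∫ d, f d ∂(q.prod p)))
  moment : Integrable (fun d : Coef M × (Fin M → ℝ) => ‖d‖ ^ k) (q.prod p)
  moment_tendsto : ∀ᵐ ω ∂P,
    Tendsto (fun N => popMean fun n : Fin N => ‖(S.coef N ω n, S.X N ω n)‖ ^ k) atTop
      (𝓝 (∫ d, ‖d‖ ^ k ∂(q.prod p)))

/-- Almost surely, the initial outcomes have a limiting mean `ν₀` and bounded second moments, and
the first-period messages `g(Y₀, w, X)` of the untreated (`w = 0`) and of the treated (`w = 1`)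
population have bounded second moments. -/
structure InitialOutcomes (S : Systems Ω M) (P : Measure Ω) (ν₀ : ℝ) : Prop where
  mean : ∀ᵐ ω ∂P, Tendsto (fun N => popMean (S.Y₀ N ω)) atTop (𝓝 ν₀)
  second : ∀ᵐ ω ∂P, ∃ c : ℝ, ∀ N, popMean (fun n => S.Y₀ N ω n ^ 2) ≤ c
  message : ∀ w : ℝ, w = 0 ∨ w = 1 → ∀ᵐ ω ∂P, ∃ c : ℝ, ∀ N,
    popMean (fun n => outcomeFun (S.coef N ω n) (S.X N ω n) w (S.Y₀ N ω n) ^ 2) ≤ c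

/-- `a` is the almost sure limit, as `N → ∞`, of the sample mean of the observed outcomes at
time `t`. -/
def IsLimitMean (S : Systems Ω M) (P : Measure Ω) (t : ℕ) (a : ℝ) : Prop :=
  ∀ᵐ ω ∂P, Tendsto (fun N => S.obsMean N ω t) atTop (𝓝 a)

/-- At two of the times `s, …, s + m - 1` the limiting sample means of the observed outcomes exist
and differ, so that a linear regression on them has a unique
solution. -/
def NonconstantLimitMeans (S : Systems Ω M) (P : Measure Ω) (s m : ℕ) : Prop :=
  ∃ i < m, ∃ j < m, ∃ a b : ℝ, a ≠ b ∧ IsLimitMean S P (s + i) a ∧ IsLimitMean S P (s + j) b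

/-- `τ` is the total treatment effect `TTE_t(1,0)`: the almost sure limit of the average difference
of the outcomes at time `t` with everybody treated and with nobody treated. -/
def IsTTE (S : Systems Ω M) (P : Measure Ω) (t : ℕ) (τ : ℝ) : Prop :=
  ∀ᵐ ω ∂P, Tendsto
    (fun N => popMean fun n => S.constOutcome 1 N ω t n - S.constOutcome 0 N ω t n) atTop (𝓝 τ)

end Laws

/-! ### The estimator -/

/-- Least squares slope of the regression, with intercept, of `y 0, …, y (m-1)` on
`x 0, …, x (m-1)`. -/
def olsSlope (m : ℕ) (x y : ℕ → ℝ) : ℝ :=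
  (∑ i ∈ Finset.range m, (x i - (∑ j ∈ Finset.range m, x j) / m)
      * (y i - (∑ j ∈ Finset.range m, y j) / m))
    / ∑ i ∈ Finset.range m, (x i - (∑ j ∈ Finset.range m, x j) / m) ^ 2

/-- Intercept of the same regression. -/
def olsIntercept (m : ℕ) (x y : ℕ → ℝ) : ℝ :=
  (∑ j ∈ Finset.range m, y j) / m - olsSlope m x y * ((∑ j ∈ Finset.range m, x j) / m)

namespace TTEAlg

/-- Slope of the regression of `h 1, …, h T₁` on `h 0, …, h (T₁ - 1)`. -/
def b₁ (T₁ : ℕ) (h : ℕ → ℝ) : ℝ := olsSlope T₁ h (fun i => h (i + 1))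

/-- Intercept of the regression of `h 1, …, h T₁` on `h 0, …, h (T₁ - 1)`. -/
def a₁ (T₁ : ℕ) (h : ℕ → ℝ) : ℝ := olsIntercept T₁ h (fun i => h (i + 1))

/-- Slope of the regression of `h (T₁ + 1), …, h (T₁ + T₂)` on `h T₁, …, h (T₁ + T₂ - 1)`. -/
def b₂ (T₁ T₂ : ℕ) (h : ℕ → ℝ) : ℝ :=
  olsSlope T₂ (fun i => h (T₁ + i)) (fun i => h (T₁ + i + 1))

/-- Intercept of the regression of `h (T₁ + 1), …, h (T₁ + T₂)` on
`h T₁, …, h (T₁ + T₂ - 1)`. -/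
def a₂ (T₁ T₂ : ℕ) (h : ℕ → ℝ) : ℝ :=
  olsIntercept T₂ (fun i => h (T₁ + i)) (fun i => h (T₁ + i + 1))

/-- The estimate of `Ξ`. -/
def xiHat (T₁ T₂ : ℕ) (π₁ π₂ : ℝ) (h : ℕ → ℝ) : ℝ :=
  1 / 2 * (b₂ T₁ T₂ h + b₁ T₁ h - (b₂ T₁ T₂ h - b₁ T₁ h) * (π₂ + π₁) / (π₂ - π₁))

/-- The estimate of `Γ`. -/
def gammaHat (T₁ T₂ : ℕ) (π₁ π₂ : ℝ) (h : ℕ → ℝ) : ℝ := (b₂ T₁ T₂ h - b₁ T₁ h) / (π₂ - π₁)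

/-- The estimate of `Λ`. -/
def lambdaHat (T₁ T₂ : ℕ) (π₁ π₂ : ℝ) (h : ℕ → ℝ) : ℝ := (a₂ T₁ T₂ h - a₁ T₁ h) / (π₂ - π₁)

/-- The estimated counterfactual mean outcomes when everybody is treated. -/
def treatedMean (T₁ T₂ : ℕ) (π₁ π₂ : ℝ) (h : ℕ → ℝ) : ℕ → ℝ
  | 0 => h 0
  | t + 1 =>
      if t < T₁ then
        h (t + 1) + xiHat T₁ T₂ π₁ π₂ h * (treatedMean T₁ T₂ π₁ π₂ h t - h t)
          + lambdaHat T₁ T₂ π₁ π₂ h * (1 - π₁)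
          + gammaHat T₁ T₂ π₁ π₂ h * (treatedMean T₁ T₂ π₁ π₂ h t - π₁ * h t)
      else
        h (t + 1) + xiHat T₁ T₂ π₁ π₂ h * (treatedMean T₁ T₂ π₁ π₂ h t - h t)
          + lambdaHat T₁ T₂ π₁ π₂ h * (1 - π₂)
          + gammaHat T₁ T₂ π₁ π₂ h * (treatedMean T₁ T₂ π₁ π₂ h t - π₂ * h t)

/-- The estimated total treatment effect at time `t`, computed from the observed sample means
`h 0, …, h (T₁ + T₂)`. -/
def tteHat (T₁ T₂ : ℕ) (π₁ π₂ : ℝ) (h : ℕ → ℝ) : ℕ → ℝ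
  | 0 => 0
  | t + 1 =>
      xiHat T₁ T₂ π₁ π₂ h * tteHat T₁ T₂ π₁ π₂ h t + lambdaHat T₁ T₂ π₁ π₂ h
        + gammaHat T₁ T₂ π₁ π₂ h * treatedMean T₁ T₂ π₁ π₂ h t

end TTEAlg

end

open MeasureTheory ProbabilityTheory Filter Topology
open scoped NNReal BoundedContinuousFunction ENNReal

-- The mechanism is state evolution. Put κ = μ + μ₀, and let β, l, ξ, g be the means of Δ + Θᵀx, Λ,
-- Ξ, Γ under q × p. As N grows, the mean outcome follows the scalar recursion ν_{t+1} = κ(β + l w_t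
-- + (ξ + g w_t) ν_t) of `limitMean`, where w_t is the limiting fraction of treated units. Indeed
-- every coordinate of Y_{t+1} is κ times the mean message plus a Gaussian fluctuation, and the
-- fluctuation vector is nearly orthogonal to any vector determined by treatments, coefficients,
-- covariates and initial outcomes. The next message is affine in the outcome with coefficients of
-- exactly this kind, so the averaged product factorizes and the recursion closes on the means
-- (`Systems.tendsto_popMean_outcome`).
--
-- The difficulty is that A is used again in every period, so the messages depend on it. All
-- Gaussian inputs are stacked into one standard Gaussian matrix, and each period is one adaptive
-- query of that matrix. After orthonormalizing the queries, the matrix can be replaced off the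
-- directions already queried by an independent copy. This changes neither its law
-- (`measurePreserving_refresh`) nor the trajectory so far, so the response to each new direction
-- behaves like a fresh Gaussian vector (`measure_rowApply_queryDir_le`). A union bound over the
-- directions gives `measure_queryVec_atypical_le`.
--
-- Systems of different sizes are not coupled, so almost sure convergence comes from Borel–Cantelli
-- and needs summable probabilities. Second moments would give only O(1/N). With fourth moments,
-- Markov's inequality at level N^{3/2} has failure probability O(N^{-3/2}) and still forces the
-- averages to vanish (`fourth_moment_tail`, `tendsto_popMean_zero_of_pow_four_le`). Fourth moments
-- of fluctuations and covariates also keep the second moments of the messages bounded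
-- (`Systems.sent_sq_le`), which is where k ≥ 4 enters. The first period is separate, because the
-- law of Y₀ is only controlled through its averages: independence of coefficients and treatments
-- from Y₀ takes the place of the Gaussian argument.
--
-- For the estimator, the limiting recursion within stage i is affine with slope κ(ξ + gπ_i) and
-- intercept κ(β + lπ_i). Least squares is exact on nonconstant affine data and continuous there,
-- and the two stages determine κξ, κg and κl. The term κβ is not needed: it cancels when the
-- treated recursion is compared with the observed one (`TTEAlg.tendsto_tteHat`).

noncomputable section

-- Fourth-moment tail bounds, Borel–Cantelli, and freezing an independent variable.

section Moments

variable {Ω : Type*} [MeasurableSpace Ω]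

/-- Fourth moment of a weighted sum of independent centered random variables. -/
theorem fourth_moment_sum_le {ι : Type*} {P : Measure Ω} [IsProbabilityMeasure P]
    {ξ : ι → Ω → ℝ} (hm : ∀ i, AEMeasurable (ξ i) P) (hi : iIndepFun ξ P)
    (h4 : ∀ i, MemLp (ξ i) 4 P) (h0 : ∀ i, ∫ ω, ξ i ω ∂P = 0) {K : ℝ}
    (hK : ∀ i, ∫ ω, ξ i ω ^ 4 ∂P ≤ K) (a : ι → ℝ) (s : Finset ι) :
    ∫ ω, (∑ i ∈ s, a i * ξ i ω) ^ 4 ∂P ≤ 3 * K * (∑ i ∈ s, a i ^ 2) ^ 2 := by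
  classical
  -- `0 ≤ K` can only be read off from an existing index, so the empty index type is treated apart.
  rcases isEmpty_or_nonempty ι with hE | ⟨⟨i₀⟩⟩
  · simp [Finset.eq_empty_of_isEmpty s]
  have hK0 : 0 ≤ K := (integral_nonneg fun ω => by positivity).trans (hK i₀)
  have hmem : ∀ s : Finset ι, MemLp (fun ω => ∑ i ∈ s, a i * ξ i ω) 4 P := fun s =>
    memLp_finsetSum s fun i _ => (h4 i).const_mul (a i)
  have i4 : ∀ {f : Ω → ℝ}, MemLp f 4 P → Integrable (fun ω => f ω ^ 4) P := by
    intro f hf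
    have := hf.integrable_norm_pow (p := 4) (by norm_num)
    refine this.congr (ae_of_all _ fun ω => ?_)
    simp [← abs_pow, abs_of_nonneg (show 0 ≤ f ω ^ 4 by positivity)]
  have ik : ∀ {f : Ω → ℝ} (k : ℕ), k ≤ 4 → MemLp f 4 P → Integrable (fun ω => f ω ^ k) P := by
    intro f k hk hf
    refine ((i4 hf).norm.add (integrable_const (1 : ℝ))).mono' (hf.1.pow k) (ae_of_all _ fun ω => ?_)
    simp only [norm_pow, Pi.add_apply]
    rcases le_total ‖f ω‖ 1 with h | h
    · have := pow_le_one₀ (n := k) (norm_nonneg (f ω)) h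
      have : 0 ≤ ‖f ω‖ ^ 4 := by positivity
      linarith
    · have := pow_le_pow_right₀ h hk
      linarith
  -- Nonnegativity of the variance of ξ² bounds the square of the second moment by the fourth
  -- moment.
  have hξ2 : ∀ i, (∫ ω, ξ i ω ^ 2 ∂P) ^ 2 ≤ K := by
    intro i
    have hv := variance_nonneg (fun ω => ξ i ω ^ 2) P
    rw [variance_eq_sub] at hv
    · have : ∫ ω, ((fun ω => ξ i ω ^ 2) ^ 2) ω ∂P = ∫ ω, ξ i ω ^ 4 ∂P := by
        congr 1; ext ω; simp; ring
      rw [this] at hv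
      linarith [hK i]
    · refine (memLp_two_iff_integrable_sq (f := fun ω => ξ i ω ^ 2) ((h4 i).1.pow 2)).2 ?_
      refine (i4 (h4 i)).congr (ae_of_all _ fun ω => ?_)
      ring
  have hξ2' : ∀ i, ∫ ω, ξ i ω ^ 2 ∂P ≤ √K := fun i => Real.le_sqrt_of_sq_le (hξ2 i)
  -- The induction on the fourth moment needs the first two moments as well: the mean kills the term
  -- S·X³, the variance controls 6·S²X².
  suffices h : ∫ ω, (∑ i ∈ s, a i * ξ i ω) ∂P = 0 ∧
      ∫ ω, (∑ i ∈ s, a i * ξ i ω) ^ 2 ∂P ≤ √K * ∑ i ∈ s, a i ^ 2 ∧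
      ∫ ω, (∑ i ∈ s, a i * ξ i ω) ^ 4 ∂P ≤ 3 * K * (∑ i ∈ s, a i ^ 2) ^ 2 from h.2.2
  induction s using Finset.induction_on with
  | empty => simp
  | insert j s hj ih =>
    obtain ⟨ih1, ih2, ih4⟩ := ih
    set S : Ω → ℝ := fun ω => ∑ i ∈ s, a i * ξ i ω with hS
    set X : Ω → ℝ := fun ω => a j * ξ j ω with hX
    have hind : IndepFun S X P := by
      have h1 : iIndepFun (fun i ω => a i * ξ i ω) P :=
        hi.comp (fun i x => a i * x) fun i => measurable_const_mul (a i)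
      have := h1.indepFun_finsetSum_of_notMem₀ (fun i => (hm i).const_mul (a i)) hj
      convert this using 1
      ext ω; simp [hS]
    have hSm := hmem s
    have hXm : MemLp X 4 P := (h4 j).const_mul (a j)
    have key : ∀ k l : ℕ, k ≤ 4 → l ≤ 4 →
        Integrable (fun ω => S ω ^ k * X ω ^ l) P ∧
        ∫ ω, S ω ^ k * X ω ^ l ∂P = (∫ ω, S ω ^ k ∂P) * ∫ ω, X ω ^ l ∂P := by
      intro k l hk hl
      have hc : IndepFun (fun ω => S ω ^ k) (fun ω => X ω ^ l) P :=
        hind.comp (φ := fun x : ℝ => x ^ k) (ψ := fun x : ℝ => x ^ l)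
          (measurable_id.pow_const k) (measurable_id.pow_const l)
      exact ⟨hc.integrable_mul (ik k hk hSm) (ik l hl hXm),
        hc.integral_fun_mul_eq_mul_integral (ik k hk hSm).1 (ik l hl hXm).1⟩
    have hX0 : ∫ ω, X ω ∂P = 0 := by simp [hX, integral_const_mul, h0]
    have hX2 : ∫ ω, X ω ^ 2 ∂P = a j ^ 2 * ∫ ω, ξ j ω ^ 2 ∂P := by
      simp [hX, integral_const_mul, mul_pow]
    have hX4 : ∫ ω, X ω ^ 4 ∂P = a j ^ 4 * ∫ ω, ξ j ω ^ 4 ∂P := by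
      simp [hX, integral_const_mul, mul_pow]
    have hsum : ∀ ω, ∑ i ∈ insert j s, a i * ξ i ω = S ω + X ω := by
      intro ω; rw [Finset.sum_insert hj, add_comm]
    have hsum2 : ∑ i ∈ insert j s, a i ^ 2 = (∑ i ∈ s, a i ^ 2) + a j ^ 2 := by
      rw [Finset.sum_insert hj, add_comm]
    simp_rw [hsum, hsum2]
    set q := ∑ i ∈ s, a i ^ 2 with hq
    have hq0 : 0 ≤ q := Finset.sum_nonneg fun i _ => sq_nonneg _
    have hSX : ∫ ω, S ω * X ω ∂P = 0 := by
      have := (key 1 1 (by norm_num) (by norm_num)).2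
      simpa [hX0] using this
    have hS3X : ∫ ω, S ω ^ 3 * X ω ∂P = 0 := by
      have := (key 3 1 (by norm_num) (by norm_num)).2
      simpa [hX0] using this
    have hSX3 : ∫ ω, S ω * X ω ^ 3 ∂P = 0 := by
      have := (key 1 3 (by norm_num) (by norm_num)).2
      simpa [ih1] using this
    have hS2X2 := (key 2 2 (by norm_num) (by norm_num)).2
    have J1 := (key 1 1 (by norm_num) (by norm_num)).1
    have J31 := (key 3 1 (by norm_num) (by norm_num)).1
    have J13 := (key 1 3 (by norm_num) (by norm_num)).1
    have J22 := (key 2 2 (by norm_num) (by norm_num)).1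
    simp only [pow_one] at J1 J31 J13
    have hsK : √K * √K = K := Real.mul_self_sqrt hK0
    refine ⟨?_, ?_, ?_⟩
    · rw [integral_add (by simpa using ik 1 (by norm_num) hSm)
        (by simpa using ik 1 (by norm_num) hXm), ih1, hX0, add_zero]
    · have e : ∀ ω, (S ω + X ω) ^ 2 = S ω ^ 2 + 2 * (S ω * X ω) + X ω ^ 2 := fun ω => by ring
      simp_rw [e]
      have I2 : Integrable (fun ω => S ω ^ 2) P := ik 2 (by norm_num) hSm
      have I3 : Integrable (fun ω => S ω ^ 2 + 2 * (S ω * X ω)) P := I2.add (J1.const_mul 2)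
      rw [integral_add I3 (ik 2 (by norm_num) hXm),
        integral_add I2 (J1.const_mul 2), integral_const_mul, hSX, hX2]
      have := mul_le_mul_of_nonneg_left (hξ2' j) (sq_nonneg (a j))
      linarith
    · have e : ∀ ω, (S ω + X ω) ^ 4 = S ω ^ 4 + 4 * (S ω ^ 3 * X ω) + 6 * (S ω ^ 2 * X ω ^ 2)
          + 4 * (S ω * X ω ^ 3) + X ω ^ 4 := fun ω => by ring
      simp_rw [e]
      have I4 : Integrable (fun ω => S ω ^ 4) P := ik 4 le_rfl hSm
      have I5 : Integrable (fun ω => S ω ^ 4 + 4 * (S ω ^ 3 * X ω)) P := I4.add (J31.const_mul 4)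
      have I6 : Integrable (fun ω => S ω ^ 4 + 4 * (S ω ^ 3 * X ω)
          + 6 * (S ω ^ 2 * X ω ^ 2)) P := I5.add (J22.const_mul 6)
      have I7 : Integrable (fun ω => S ω ^ 4 + 4 * (S ω ^ 3 * X ω)
          + 6 * (S ω ^ 2 * X ω ^ 2) + 4 * (S ω * X ω ^ 3)) P := I6.add (J13.const_mul 4)
      rw [integral_add I7 (ik 4 le_rfl hXm), integral_add I6 (J13.const_mul 4),
        integral_add I5 (J22.const_mul 6),
        integral_add I4 (J31.const_mul 4), integral_const_mul, integral_const_mul,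
        integral_const_mul, hS3X, hSX3, hS2X2, hX4, hX2]
      -- The surviving terms add up to at most 3Kq² + 6Kq a_j² + K a_j⁴ ≤ 3K(q + a_j²)².
      have e1 : (∫ ω, S ω ^ 2 ∂P) * (a j ^ 2 * ∫ ω, ξ j ω ^ 2 ∂P)
          ≤ (√K * q) * (a j ^ 2 * √K) :=
        mul_le_mul ih2 (mul_le_mul_of_nonneg_left (hξ2' j) (sq_nonneg _))
          (mul_nonneg (sq_nonneg _) (integral_nonneg fun ω => sq_nonneg _)) (by positivity)
      have e2 : (√K * q) * (a j ^ 2 * √K) = K * q * a j ^ 2 := by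
        linear_combination (q * a j ^ 2) * hsK
      have e3 : a j ^ 4 * ∫ ω, ξ j ω ^ 4 ∂P ≤ a j ^ 4 * K :=
        mul_le_mul_of_nonneg_left (hK j) (by positivity)
      have e4 : 0 ≤ a j ^ 4 * K := by positivity
      nlinarith

/-- Tail bound for weighted sums of independent centered random variables, uniform in the
weights. -/
theorem fourth_moment_tail {ι : Type*} [Fintype ι] {P : Measure Ω} [IsProbabilityMeasure P]
    {ξ : ι → Ω → ℝ} (hm : ∀ i, AEMeasurable (ξ i) P) (hi : iIndepFun ξ P)
    (h4 : ∀ i, MemLp (ξ i) 4 P) (h0 : ∀ i, ∫ ω, ξ i ω ∂P = 0) {K : ℝ}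
    (hK : ∀ i, ∫ ω, ξ i ω ^ 4 ∂P ≤ K) (a : ι → ℝ) {l : ℝ} (hl : 0 < l) :
    P {ω | l * (∑ i, a i ^ 2) ^ 2 < (∑ i, a i * ξ i ω) ^ 4} ≤ ENNReal.ofReal (3 * K / l) := by
  have hq : 0 ≤ ∑ i, a i ^ 2 := Finset.sum_nonneg fun i _ => sq_nonneg _
  -- Markov's inequality divides by the squared weight sum. If that sum is zero, the strict
  -- inequality makes the event empty.
  rcases hq.eq_or_lt with hq | hq
  · have ha : ∀ i, a i = 0 := by
      intro i
      have := (Finset.sum_eq_zero_iff_of_nonneg fun i _ => sq_nonneg (a i)).1 hq.symm i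
        (Finset.mem_univ i)
      simpa using this
    simp [ha]
  · have hb := fourth_moment_sum_le hm hi h4 h0 hK a Finset.univ
    have hint : Integrable (fun ω => (∑ i, a i * ξ i ω) ^ 4) P := by
      have := (memLp_finsetSum Finset.univ
        fun i _ => (h4 i).const_mul (a i)).integrable_norm_pow (p := 4) (by norm_num)
      refine this.congr (ae_of_all _ fun ω => ?_)
      simp only [Real.norm_eq_abs, ← abs_pow]
      exact abs_of_nonneg (by positivity)
    have hmk := mul_meas_ge_le_integral_of_nonneg (μ := P)
      (ae_of_all _ fun ω => show 0 ≤ (∑ i, a i * ξ i ω) ^ 4 by positivity) hint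
      (l * (∑ i, a i ^ 2) ^ 2)
    refine (measure_mono (μ := P) (t := {ω | l * (∑ i, a i ^ 2) ^ 2 ≤ (∑ i, a i * ξ i ω) ^ 4})
      fun ω hω => le_of_lt hω).trans ?_
    rw [← ofReal_measureReal]
    apply ENNReal.ofReal_le_ofReal
    rw [le_div_iff₀ hl]
    have h2 : 0 < (∑ i, a i ^ 2) ^ 2 := by positivity
    refine le_of_mul_le_mul_right ?_ h2
    linarith [hmk.trans hb]

/-- Borel–Cantelli along events of probability `O(N^{-3/2})`. -/
theorem ae_eventually_of_le_rpow {P : Measure Ω} {s : ℕ → Set Ω} {C : ℝ} (hC : 0 ≤ C)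
    (h : ∀ N : ℕ, 0 < N → P (s N) ≤ ENNReal.ofReal (C / (N : ℝ) ^ (3 / 2 : ℝ))) :
    ∀ᵐ ω ∂P, ∀ᶠ N in atTop, ω ∉ s N := by
  have hsum : Summable fun N : ℕ => C / (N : ℝ) ^ (3 / 2 : ℝ) := by
    have := (Real.summable_one_div_nat_rpow (p := 3 / 2)).2 (by norm_num)
    simpa [div_eq_mul_inv] using this.mul_left C
  -- No bound is available at N = 0, so the sequence is shifted by one.
  have hfin : ∑' N, P (s (N + 1)) ≠ ∞ := by
    refine ne_top_of_le_ne_top ?_ (ENNReal.tsum_le_tsum fun N => h (N + 1) N.succ_pos)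
    rw [← ENNReal.ofReal_tsum_of_nonneg (fun N => by positivity)
      ((summable_nat_add_iff 1).2 hsum)]
    exact ENNReal.ofReal_ne_top
  filter_upwards [ae_eventually_notMem hfin] with ω hω
  rw [eventually_atTop] at hω ⊢
  obtain ⟨a, ha⟩ := hω
  refine ⟨a + 1, fun b hb => ?_⟩
  have := ha (b - 1) (by omega)
  rwa [Nat.sub_add_cancel (by omega)] at this

/-- A measurable event has small probability if all its slices along an independent random
variable have. -/
theorem measure_le_of_indepFun {α β : Type*} [MeasurableSpace α] [MeasurableSpace β]
    {P : Measure Ω} [IsProbabilityMeasure P] {X : Ω → α} {Y : Ω → β} (hX : AEMeasurable X P)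
    (hY : AEMeasurable Y P) (hind : IndepFun X Y P) {s : Set (α × β)} (hs : MeasurableSet s)
    {c : ℝ≥0∞} (hc : ∀ y, P {ω | (X ω, y) ∈ s} ≤ c) : P {ω | (X ω, Y ω) ∈ s} ≤ c := by
  have := Measure.isProbabilityMeasure_map hX
  have := Measure.isProbabilityMeasure_map hY
  have h1 : P {ω | (X ω, Y ω) ∈ s} = ((P.map X).prod (P.map Y)) s := by
    rw [← (indepFun_iff_map_prod_eq_prod_map_map hX hY).1 hind,
      Measure.map_apply_of_aemeasurable (hX.prodMk hY) hs]
    rfl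
  rw [h1, Measure.prod_apply_symm hs]
  calc ∫⁻ y, (P.map X) ((fun x => (x, y)) ⁻¹' s) ∂P.map Y ≤ ∫⁻ _, c ∂P.map Y := by
        refine lintegral_mono fun y => ?_
        rw [Measure.map_apply_of_aemeasurable hX (measurable_prodMk_right hs)]
        exact hc y
    _ = c := by simp

end Moments

-- Standard Gaussian matrices, rank one updates and Gram–Schmidt.

section GaussianMatrix

open InnerProductSpace

variable {ν ι : Type*} [Fintype ν] [Fintype ι]

local notation "𝔼" => EuclideanSpace ℝ

/-- The product `z e` of a `ν × ι` matrix and a vector. -/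
def rowApply : 𝔼 (ν × ι) →ₗ[ℝ] 𝔼 ι →ₗ[ℝ] 𝔼 ν :=
  LinearMap.mk₂ ℝ (fun z e => WithLp.toLp 2 fun n => ∑ i, z (n, i) * e i)
    (fun z z' e => by ext n; simp [add_mul, Finset.sum_add_distrib])
    (fun c z e => by ext n; simp [Finset.mul_sum, mul_assoc])
    (fun z e e' => by ext n; simp [mul_add, Finset.sum_add_distrib])
    (fun c z e => by ext n; simp [Finset.mul_sum, mul_left_comm])

theorem rowApply_apply (z : 𝔼 (ν × ι)) (e : 𝔼 ι) (n : ν) :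
    rowApply z e n = ∑ i, z (n, i) * e i := rfl

/-- The rank one matrix `v eᵀ`. -/
def outerProd : 𝔼 ν →ₗ[ℝ] 𝔼 ι →ₗ[ℝ] 𝔼 (ν × ι) :=
  LinearMap.mk₂ ℝ (fun v e => WithLp.toLp 2 fun p => v p.1 * e p.2)
    (fun v v' e => by ext p; simp [add_mul])
    (fun c v e => by ext p; simp [mul_assoc])
    (fun v e e' => by ext p; simp [mul_add])
    (fun c v e => by ext p; simp [mul_left_comm])

theorem outerProd_apply (v : 𝔼 ν) (e : 𝔼 ι) (p : ν × ι) :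
    outerProd v e p = v p.1 * e p.2 := rfl

/-- This adjunction turns the characteristic function of the response z e into that of the matrix z,
which is how the Gaussian laws below are computed. -/
theorem inner_rowApply (z : 𝔼 (ν × ι)) (e : 𝔼 ι) (v : 𝔼 ν) :
    inner ℝ (rowApply z e) v = inner ℝ z (outerProd v e) := by
  simp only [PiLp.inner_apply, rowApply_apply, outerProd_apply, Fintype.sum_prod_type]
  refine Finset.sum_congr rfl fun n _ => ?_
  simp only [RCLike.inner_apply, conj_trivial, Finset.mul_sum]
  exact Finset.sum_congr rfl fun i _ => by ring

theorem rowApply_outerProd (v : 𝔼 ν) (e e' : 𝔼 ι) :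
    rowApply (outerProd v e) e' = (inner ℝ e e' : ℝ) • v := by
  ext n
  simp only [PiLp.inner_apply, rowApply_apply, outerProd_apply, PiLp.smul_apply, smul_eq_mul,
    RCLike.inner_apply, conj_trivial, Finset.sum_mul]
  exact Finset.sum_congr rfl fun i _ => by ring

theorem norm_outerProd (v : 𝔼 ν) (e : 𝔼 ι) : ‖outerProd v e‖ = ‖v‖ * ‖e‖ := by
  have : ‖outerProd v e‖ ^ 2 = (‖v‖ * ‖e‖) ^ 2 := by
    rw [← real_inner_self_eq_norm_sq, ← inner_rowApply, rowApply_outerProd, inner_smul_left,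
      real_inner_self_eq_norm_sq, real_inner_self_eq_norm_sq]
    simp; ring
  exact (sq_eq_sq₀ (norm_nonneg _) (by positivity)).1 this

@[fun_prop]
theorem measurable_rowApply {α : Type*} [MeasurableSpace α] {f : α → 𝔼 (ν × ι)} {g : α → 𝔼 ι}
    (hf : Measurable f) (hg : Measurable g) : Measurable fun a => rowApply (f a) (g a) := by
  refine (MeasurableEquiv.toLp 2 (ν → ℝ)).measurable.comp
    (measurable_pi_lambda _ fun n => ?_)
  refine Finset.measurable_sum _ fun i _ => ?_
  fun_prop

@[fun_prop]
theorem measurable_outerProd {α : Type*} [MeasurableSpace α] {f : α → 𝔼 ν} {g : α → 𝔼 ι}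
    (hf : Measurable f) (hg : Measurable g) : Measurable fun a => outerProd (f a) (g a) := by
  refine (MeasurableEquiv.toLp 2 (ν × ι → ℝ)).measurable.comp
    (measurable_pi_lambda _ fun n => ?_)
  fun_prop

/-- A standard Gaussian matrix applied to a unit vector is a standard Gaussian vector. -/
theorem map_rowApply_stdGaussian {e : 𝔼 ι} (he : ‖e‖ = 1) :
    (stdGaussian (𝔼 (ν × ι))).map (fun z => rowApply z e) = stdGaussian (𝔼 ν) := by
  have hm : Measurable fun z : 𝔼 (ν × ι) => rowApply z e := by fun_prop
  have := Measure.isProbabilityMeasure_map (μ := stdGaussian (𝔼 (ν × ι))) hm.aemeasurable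
  apply Measure.ext_of_charFun
  ext t
  rw [charFun_apply, integral_map hm.aemeasurable (by fun_prop)]
  simp_rw [inner_rowApply]
  rw [← charFun_apply, charFun_stdGaussian, charFun_stdGaussian, norm_outerProd, he, mul_one]

/-- Replacing, in one direction, a standard Gaussian matrix by an independent copy. -/
theorem measurePreserving_replace_direction {e : 𝔼 ι} (he : ‖e‖ = 1 ∨ e = 0) :
    MeasurePreserving
      (fun p : 𝔼 (ν × ι) × 𝔼 (ν × ι) => p.2 + outerProd (rowApply (p.1 - p.2) e) e)
      ((stdGaussian (𝔼 (ν × ι))).prod (stdGaussian (𝔼 (ν × ι)))) (stdGaussian (𝔼 (ν × ι))) := by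
  have hm : Measurable
      (fun p : 𝔼 (ν × ι) × 𝔼 (ν × ι) => p.2 + outerProd (rowApply (p.1 - p.2) e) e) := by
    fun_prop
  refine ⟨hm, ?_⟩
  have := Measure.isProbabilityMeasure_map
    (μ := (stdGaussian (𝔼 (ν × ι))).prod (stdGaussian (𝔼 (ν × ι)))) hm.aemeasurable
  apply Measure.ext_of_charFun
  ext t
  rw [charFun_apply, integral_map hm.aemeasurable (by fun_prop), charFun_stdGaussian]
  set K := outerProd (rowApply t e) e with hK
  -- The map x ↦ (x e)eᵀ is self-adjoint; for a unit vector or zero it is the orthogonal projection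
  -- onto the matrices v eᵀ, and K is the projection of t.
  have hin : ∀ x : 𝔼 (ν × ι), inner ℝ (outerProd (rowApply x e) e) t = inner ℝ x K := by
    intro x
    rw [real_inner_comm, ← inner_rowApply, real_inner_comm, inner_rowApply]
  have h1 : ∀ p : 𝔼 (ν × ι) × 𝔼 (ν × ι),
      Complex.exp ((inner ℝ (p.2 + outerProd (rowApply (p.1 - p.2) e) e) t : ℝ) * Complex.I)
        = Complex.exp ((inner ℝ p.1 K : ℝ) * Complex.I)
          * Complex.exp ((inner ℝ p.2 (t - K) : ℝ) * Complex.I) := by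
    intro p
    rw [inner_add_left, hin, inner_sub_left, inner_sub_right, ← Complex.exp_add]
    push_cast
    ring_nf
  simp_rw [h1]
  rw [integral_prod_mul (fun x => Complex.exp ((inner ℝ x K : ℝ) * Complex.I))
    (fun y => Complex.exp ((inner ℝ y (t - K) : ℝ) * Complex.I)), ← charFun_apply,
    ← charFun_apply, charFun_stdGaussian, charFun_stdGaussian, ← Complex.exp_add]
  -- By Pythagoras, the two independent Gaussian factors multiply to the characteristic function at
  -- t.
  have h2 : ‖t - K‖ ^ 2 = ‖t‖ ^ 2 - ‖K‖ ^ 2 := by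
    rw [norm_sub_sq_real]
    have : inner ℝ t K = ‖K‖ ^ 2 := by
      rw [hK, ← inner_rowApply, norm_outerProd, real_inner_self_eq_norm_sq]
      rcases he with he | he <;> simp [he]
    rw [this]; ring
  have h3 : (‖t - K‖ : ℂ) ^ 2 = (‖t‖ : ℂ) ^ 2 - (‖K‖ : ℂ) ^ 2 := by exact_mod_cast h2
  rw [h3]
  congr 1
  ring

/-- The Gram–Schmidt process up to `n` depends on the vectors up to `n` only. -/
theorem gramSchmidt_congr {E : Type*} [NormedAddCommGroup E] [InnerProductSpace ℝ E] {f g : ℕ → E}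
    {n : ℕ} (h : ∀ r ≤ n, f r = g r) : gramSchmidt ℝ f n = gramSchmidt ℝ g n := by
  induction n using Nat.strong_induction_on with
  | _ n ih =>
    rw [gramSchmidt_def, gramSchmidt_def, h n le_rfl]
    congr 1
    refine Finset.sum_congr rfl fun i hi => ?_
    rw [Finset.mem_Iio] at hi
    rw [ih i hi fun r hr => h r (hr.trans hi.le)]

theorem gramSchmidtNormed_congr {E : Type*} [NormedAddCommGroup E] [InnerProductSpace ℝ E]
    {f g : ℕ → E} {n : ℕ} (h : ∀ r ≤ n, f r = g r) :
    gramSchmidtNormed ℝ f n = gramSchmidtNormed ℝ g n := by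
  rw [gramSchmidtNormed, gramSchmidtNormed, gramSchmidt_congr h]

theorem inner_gramSchmidtNormed_eq_zero {E : Type*} [NormedAddCommGroup E] [InnerProductSpace ℝ E]
    (f : ℕ → E) {a b : ℕ} (h : a ≠ b) :
    inner ℝ (gramSchmidtNormed ℝ f a) (gramSchmidtNormed ℝ f b) = 0 := by
  simp [gramSchmidtNormed, inner_smul_left, inner_smul_right, gramSchmidt_orthogonal ℝ f h]

/-- The zero alternative cannot be excluded: an adaptive query may lie in the span of the earlier
ones. -/
theorem norm_gramSchmidtNormed {E : Type*} [NormedAddCommGroup E] [InnerProductSpace ℝ E]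
    (f : ℕ → E) (n : ℕ) : ‖gramSchmidtNormed ℝ f n‖ = 1 ∨ gramSchmidtNormed ℝ f n = 0 := by
  by_cases h : gramSchmidtNormed ℝ f n = 0
  · exact Or.inr h
  · exact Or.inl (gramSchmidtNormed_unit_length' h)

/-- The normalized vectors have the same span as the original ones, and orthogonality identifies the
coefficients. Dependent inputs do no harm, because a direction that degenerates to zero contributes
nothing. -/
theorem eq_sum_gramSchmidtNormed {E : Type*} [NormedAddCommGroup E] [InnerProductSpace ℝ E]
    (f : ℕ → E) (n : ℕ) :
    f n = ∑ r ∈ Finset.range (n + 1),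
      (inner ℝ (gramSchmidtNormed ℝ f r) (f n) : ℝ) • gramSchmidtNormed ℝ f r := by
  have hmem : f n ∈ Submodule.span ℝ (gramSchmidtNormed ℝ f '' (Finset.range (n + 1) : Set ℕ)) := by
    rw [span_gramSchmidtNormed]
    refine Submodule.span_mono (Set.image_mono ?_) (mem_span_gramSchmidt ℝ f (le_refl n))
    intro x hx
    simpa [Nat.lt_succ_iff] using hx
  rw [Submodule.mem_span_image_finset_iff_exists_fun] at hmem
  obtain ⟨c', hc'⟩ := hmem
  obtain ⟨c, rfl⟩ : ∃ c : ℕ → ℝ, c' = fun i : ↥(Finset.range (n + 1)) => c i :=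
    ⟨fun i => if h : i ∈ Finset.range (n + 1) then c' ⟨i, h⟩ else 0, by ext i; simp [i.2]⟩
  have hc := (Finset.sum_coe_sort (Finset.range (n + 1))
    fun i => c i • gramSchmidtNormed ℝ f i).symm.trans hc'
  nth_rw 1 [← hc]
  refine Finset.sum_congr rfl fun r hr => ?_
  have : inner ℝ (gramSchmidtNormed ℝ f r) (f n)
      = c r * ‖gramSchmidtNormed ℝ f r‖ ^ 2 := by
    rw [← hc, inner_sum, Finset.sum_eq_single_of_mem r hr]
    · rw [inner_smul_right, real_inner_self_eq_norm_sq]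
    · intro b _ hb
      rw [inner_smul_right, inner_gramSchmidtNormed_eq_zero f hb.symm, mul_zero]
  rw [this]
  rcases norm_gramSchmidtNormed f r with h | h <;> simp [h]

theorem measurable_gramSchmidt {α : Type*} [MeasurableSpace α] {f : α → ℕ → 𝔼 ι}
    (hf : ∀ n, Measurable fun a => f a n) (n : ℕ) :
    Measurable fun a => gramSchmidt ℝ (f a) n := by
  induction n using Nat.strong_induction_on with
  | _ n ih =>
    have h : (fun a => gramSchmidt ℝ (f a) n) = fun a => f a n - ∑ i ∈ Finset.Iio n,
        ((inner ℝ (gramSchmidt ℝ (f a) i) (f a n) : ℝ) / ‖gramSchmidt ℝ (f a) i‖ ^ 2)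
          • gramSchmidt ℝ (f a) i := by
      ext1 a
      have := gramSchmidt_def'' ℝ (f a) n
      rw [eq_sub_iff_add_eq]
      exact this.symm
    rw [h]
    refine (hf n).sub (Finset.measurable_sum _ fun i hi => ?_)
    have hi' := ih i (Finset.mem_Iio.1 hi)
    have := hf n
    exact ((hi'.inner this).div (hi'.norm.pow_const 2)).smul hi'

theorem measurable_gramSchmidtNormed {α : Type*} [MeasurableSpace α] {f : α → ℕ → 𝔼 ι}
    (hf : ∀ n, Measurable fun a => f a n) (n : ℕ) :
    Measurable fun a => gramSchmidtNormed ℝ (f a) n := by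
  have := measurable_gramSchmidt hf n
  unfold gramSchmidtNormed
  exact (this.norm.inv).smul this

end GaussianMatrix

-- Adaptive queries of a Gaussian matrix and refreshing of its unexplored part.

section AdaptiveGaussian

open InnerProductSpace

variable {ν ι : Type*} [Fintype ν] [Fintype ι]

local notation "𝔼" => EuclideanSpace ℝ

variable {F : Type*} [MeasurableSpace F]

/-- Trajectory of a state that is updated by querying the matrix `z` at the vector `Φ s y`. -/
def queryState (Φ : ℕ → F → 𝔼 ι) (Ψ : ℕ → F → 𝔼 ν → F) (y₀ : F) (z : 𝔼 (ν × ι)) : ℕ → F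
  | 0 => y₀
  | s + 1 => Ψ s (queryState Φ Ψ y₀ z s) (rowApply z (Φ s (queryState Φ Ψ y₀ z s)))

/-- The vector queried at step `s`. -/
def queryVec (Φ : ℕ → F → 𝔼 ι) (Ψ : ℕ → F → 𝔼 ν → F) (y₀ : F) (z : 𝔼 (ν × ι)) (s : ℕ) : 𝔼 ι :=
  Φ s (queryState Φ Ψ y₀ z s)

/-- The normalized new direction queried at step `s`. -/
def queryDir (Φ : ℕ → F → 𝔼 ι) (Ψ : ℕ → F → 𝔼 ν → F) (y₀ : F) (z : 𝔼 (ν × ι)) (s : ℕ) : 𝔼 ι :=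
  gramSchmidtNormed ℝ (queryVec Φ Ψ y₀ z) s

/-- The matrix that agrees with `z` on the first `s` queried directions and with `z'` on their
orthogonal complement. -/
def refresh (Φ : ℕ → F → 𝔼 ι) (Ψ : ℕ → F → 𝔼 ν → F) (y₀ : F) (s : ℕ)
    (p : 𝔼 (ν × ι) × 𝔼 (ν × ι)) : 𝔼 (ν × ι) :=
  p.2 + ∑ r ∈ Finset.range s,
    outerProd (rowApply (p.1 - p.2) (queryDir Φ Ψ y₀ p.1 r)) (queryDir Φ Ψ y₀ p.1 r)

variable {Φ : ℕ → F → 𝔼 ι} {Ψ : ℕ → F → 𝔼 ν → F} {y₀ : F}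

/-- Distinct directions are orthogonal, so at most one summand survives. The squared norm is kept
because it may be 0 instead of 1. -/
theorem rowApply_sum_outerProd_queryDir (z : 𝔼 (ν × ι)) (w : ℕ → 𝔼 ν) (s r : ℕ) :
    rowApply (∑ k ∈ Finset.range s, outerProd (w k) (queryDir Φ Ψ y₀ z k)) (queryDir Φ Ψ y₀ z r)
      = if r < s then ‖queryDir Φ Ψ y₀ z r‖ ^ 2 • w r else 0 := by
  rw [map_sum, LinearMap.sum_apply]
  simp_rw [rowApply_outerProd]
  split_ifs with h
  · rw [Finset.sum_eq_single_of_mem r (Finset.mem_range.2 h), real_inner_self_eq_norm_sq]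
    intro b _ hb
    rw [queryDir, queryDir, inner_gramSchmidtNormed_eq_zero _ hb, zero_smul]
  · refine Finset.sum_eq_zero fun k hk => ?_
    have : k ≠ r := fun hkr => h (hkr ▸ Finset.mem_range.1 hk)
    rw [queryDir, queryDir, inner_gramSchmidtNormed_eq_zero _ this, zero_smul]

theorem rowApply_refresh_of_lt (p : 𝔼 (ν × ι) × 𝔼 (ν × ι)) {r s : ℕ} (h : r < s) :
    rowApply (refresh Φ Ψ y₀ s p) (queryDir Φ Ψ y₀ p.1 r)
      = rowApply p.1 (queryDir Φ Ψ y₀ p.1 r) := by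
  rw [refresh, map_add, LinearMap.add_apply, rowApply_sum_outerProd_queryDir p.1
    (fun r => rowApply (p.1 - p.2) (queryDir Φ Ψ y₀ p.1 r)), if_pos h]
  rcases norm_gramSchmidtNormed (queryVec Φ Ψ y₀ p.1) r with h1 | h1 <;>
  rw [← queryDir] at h1 <;> simp [h1]

theorem rowApply_refresh_self (p : 𝔼 (ν × ι) × 𝔼 (ν × ι)) (s : ℕ) :
    rowApply (refresh Φ Ψ y₀ s p) (queryDir Φ Ψ y₀ p.1 s)
      = rowApply p.2 (queryDir Φ Ψ y₀ p.1 s) := by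
  rw [refresh, map_add, LinearMap.add_apply, rowApply_sum_outerProd_queryDir p.1
    (fun r => rowApply (p.1 - p.2) (queryDir Φ Ψ y₀ p.1 r)), if_neg (lt_irrefl s), add_zero]

/-- A query is a combination of its own direction and the earlier ones, so any matrix `w` answers it
through its answers to these directions. The matrix `w` is allowed to differ from the matrix `z`
that generated the queries, so as to compare a matrix with its refreshed version. -/
theorem rowApply_queryVec (w z : 𝔼 (ν × ι)) (s : ℕ) :
    rowApply w (queryVec Φ Ψ y₀ z s) = ∑ r ∈ Finset.range (s + 1),
      (inner ℝ (queryDir Φ Ψ y₀ z r) (queryVec Φ Ψ y₀ z s) : ℝ)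
        • rowApply w (queryDir Φ Ψ y₀ z r) := by
  conv_lhs => rw [eq_sum_gramSchmidtNormed (queryVec Φ Ψ y₀ z) s]
  simp [queryDir]

/-- Causality: up to step s the trajectory sees the matrix only through its first s directions, on
which refreshing changes nothing. -/
theorem queryState_refresh (p : 𝔼 (ν × ι) × 𝔼 (ν × ι)) {r s : ℕ} (h : r ≤ s) :
    queryState Φ Ψ y₀ (refresh Φ Ψ y₀ s p) r = queryState Φ Ψ y₀ p.1 r := by
  induction r with
  | zero => rfl
  | succ r ih =>
    rw [queryState, queryState, ih (by omega)]
    congr 1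
    change rowApply _ (queryVec Φ Ψ y₀ p.1 r) = rowApply _ (queryVec Φ Ψ y₀ p.1 r)
    rw [rowApply_queryVec, rowApply_queryVec]
    refine Finset.sum_congr rfl fun k hk => ?_
    rw [rowApply_refresh_of_lt p (by have := Finset.mem_range.1 hk; omega)]

/-- The case r = s is the important one: the next direction is fixed by the first matrix alone,
before the independent copy is consulted along it. -/
theorem queryDir_refresh (p : 𝔼 (ν × ι) × 𝔼 (ν × ι)) {r s : ℕ} (h : r ≤ s) :
    queryDir Φ Ψ y₀ (refresh Φ Ψ y₀ s p) r = queryDir Φ Ψ y₀ p.1 r :=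
  gramSchmidtNormed_congr fun k hk => by
    rw [queryVec, queryVec, queryState_refresh p (hk.trans h)]

theorem measurable_queryState (hΦ : ∀ s, Measurable (Φ s))
    (hΨ : ∀ s, Measurable (Function.uncurry (Ψ s))) (s : ℕ) :
    Measurable fun z => queryState Φ Ψ y₀ z s := by
  induction s with
  | zero => exact measurable_const
  | succ s ih =>
    exact (hΨ s).comp (ih.prodMk (measurable_rowApply measurable_id ((hΦ s).comp ih)))

theorem measurable_queryDir (hΦ : ∀ s, Measurable (Φ s))
    (hΨ : ∀ s, Measurable (Function.uncurry (Ψ s))) (s : ℕ) :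
    Measurable fun z => queryDir Φ Ψ y₀ z s :=
  measurable_gramSchmidtNormed (fun n => (hΦ n).comp (measurable_queryState hΦ hΨ n)) s

theorem measurable_refresh (hΦ : ∀ s, Measurable (Φ s))
    (hΨ : ∀ s, Measurable (Function.uncurry (Ψ s))) (s : ℕ) :
    Measurable (refresh Φ Ψ y₀ s) := by
  refine measurable_snd.add (Finset.measurable_sum _ fun r _ => ?_)
  have : Measurable fun p : 𝔼 (ν × ι) × 𝔼 (ν × ι) => queryDir Φ Ψ y₀ p.1 r :=
    (measurable_queryDir hΦ hΨ r).comp measurable_fst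
  exact measurable_outerProd
    (measurable_rowApply (measurable_fst.sub measurable_snd) this) this

/-- Refreshing a standard Gaussian matrix outside the directions queried so far does not change
its law. -/
theorem measurePreserving_refresh (hΦ : ∀ s, Measurable (Φ s))
    (hΨ : ∀ s, Measurable (Function.uncurry (Ψ s))) (s : ℕ) :
    MeasurePreserving (refresh Φ Ψ y₀ s)
      ((stdGaussian (𝔼 (ν × ι))).prod (stdGaussian (𝔼 (ν × ι)))) (stdGaussian (𝔼 (ν × ι))) := by
  induction s with
  | zero =>
    have : refresh Φ Ψ y₀ 0 = Prod.snd := by ext1 p; simp [refresh]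
    rw [this]
    exact measurePreserving_snd
  | succ s ih =>
    set γ := stdGaussian (𝔼 (ν × ι))
    refine ⟨measurable_refresh hΦ hΨ _, ?_⟩
    -- Three independent matrices are used. By induction the first two combine to a standard
    -- Gaussian matrix that is independent of the third.
    have h1 : MeasurePreserving
        (fun p : 𝔼 (ν × ι) × (𝔼 (ν × ι) × 𝔼 (ν × ι)) => (refresh Φ Ψ y₀ s (p.1, p.2.1), p.2.2))
        (γ.prod (γ.prod γ)) (γ.prod γ) :=
      (ih.prod (MeasurePreserving.id γ)).comp (measurePreserving_prodAssoc γ γ γ).symm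
    have h2 : MeasurePreserving
        (fun p : 𝔼 (ν × ι) × (𝔼 (ν × ι) × 𝔼 (ν × ι)) => (p.1, p.2.2 + outerProd (rowApply
          (p.2.1 - p.2.2) (queryDir Φ Ψ y₀ p.1 s)) (queryDir Φ Ψ y₀ p.1 s)))
        (γ.prod (γ.prod γ)) (γ.prod γ) := by
      refine (MeasurePreserving.id γ).skew_product
        (g := fun a (p : 𝔼 (ν × ι) × 𝔼 (ν × ι)) => p.2 + outerProd (rowApply
          (p.1 - p.2) (queryDir Φ Ψ y₀ a s)) (queryDir Φ Ψ y₀ a s)) ?_ (ae_of_all _ fun a => ?_)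
      · have : Measurable fun p : 𝔼 (ν × ι) × (𝔼 (ν × ι) × 𝔼 (ν × ι)) =>
            queryDir Φ Ψ y₀ p.1 s := (measurable_queryDir hΦ hΨ s).comp measurable_fst
        exact measurable_snd.snd.add (measurable_outerProd
          (measurable_rowApply (measurable_snd.fst.sub measurable_snd.snd) this) this)
      · exact (measurePreserving_replace_direction
          (norm_gramSchmidtNormed (queryVec Φ Ψ y₀ a) s)).map_eq
    -- Refreshing s + 1 directions of an already refreshed matrix equals refreshing s directions
    -- with a copy that was itself altered along direction s. That direction depends on the first
    -- matrix only, so the alteration preserves the law by `measurePreserving_replace_direction`.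
    have h3 : ∀ p : 𝔼 (ν × ι) × (𝔼 (ν × ι) × 𝔼 (ν × ι)),
        refresh Φ Ψ y₀ (s + 1) (refresh Φ Ψ y₀ s (p.1, p.2.1), p.2.2)
          = refresh Φ Ψ y₀ s (p.1, p.2.2 + outerProd (rowApply
          (p.2.1 - p.2.2) (queryDir Φ Ψ y₀ p.1 s)) (queryDir Φ Ψ y₀ p.1 s)) := by
      rintro ⟨x, x', z'⟩
      simp only
      conv_lhs => rw [refresh]
      conv_rhs => rw [refresh]
      simp only
      rw [Finset.sum_range_succ, queryDir_refresh (x, x') le_rfl, map_sub, LinearMap.sub_apply,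
        rowApply_refresh_self (x, x') s, add_assoc, add_comm (outerProd _ _)]
      congr 2
      · refine Finset.sum_congr rfl fun r hr => ?_
        have hr' := Finset.mem_range.1 hr
        rw [queryDir_refresh (x, x') hr'.le, map_sub, LinearMap.sub_apply,
          rowApply_refresh_of_lt (x, x') hr']
        have : ∀ w : 𝔼 ν, rowApply (outerProd w (queryDir Φ Ψ y₀ x s)) (queryDir Φ Ψ y₀ x r)
            = 0 := fun w => by
          rw [rowApply_outerProd, queryDir, queryDir, inner_gramSchmidtNormed_eq_zero _ hr'.ne',
            zero_smul]
        simp [this]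
      · simp
    rw [← h1.map_eq, Measure.map_map (measurable_refresh hΦ hΨ _) h1.measurable]
    have h4 : refresh Φ Ψ y₀ (s + 1) ∘
        (fun p : 𝔼 (ν × ι) × (𝔼 (ν × ι) × 𝔼 (ν × ι)) => (refresh Φ Ψ y₀ s (p.1, p.2.1), p.2.2))
        = refresh Φ Ψ y₀ s ∘ (fun p : 𝔼 (ν × ι) × (𝔼 (ν × ι) × 𝔼 (ν × ι)) =>
          (p.1, p.2.2 + outerProd (rowApply
          (p.2.1 - p.2.2) (queryDir Φ Ψ y₀ p.1 s)) (queryDir Φ Ψ y₀ p.1 s))) := funext h3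
    rw [h4]
    exact (ih.comp h2).map_eq

/-- The response of a standard Gaussian matrix to an adaptively chosen new unit direction is a
standard Gaussian vector (or zero, if there is no new direction). -/
theorem measure_rowApply_queryDir_le (hΦ : ∀ s, Measurable (Φ s))
    (hΨ : ∀ s, Measurable (Function.uncurry (Ψ s))) (s : ℕ) {B : Set (𝔼 ν)}
    (hB : MeasurableSet B) (h0 : (0 : 𝔼 ν) ∉ B) :
    stdGaussian (𝔼 (ν × ι)) {z | rowApply z (queryDir Φ Ψ y₀ z s) ∈ B} ≤ stdGaussian (𝔼 ν) B := by
  set γ := stdGaussian (𝔼 (ν × ι))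
  have hd := measurable_queryDir (y₀ := y₀) hΦ hΨ s
  have hS : MeasurableSet {z : 𝔼 (ν × ι) | rowApply z (queryDir Φ Ψ y₀ z s) ∈ B} :=
    (measurable_rowApply measurable_id hd) hB
  rw [← (measurePreserving_refresh (y₀ := y₀) hΦ hΨ s).measure_preimage hS.nullMeasurableSet]
  -- After refreshing, the direction comes from `p.1` and the matrix applied to it is the
  -- independent `p.2`, so Fubini applies.
  have h1 : refresh Φ Ψ y₀ s ⁻¹' {z | rowApply z (queryDir Φ Ψ y₀ z s) ∈ B}
      = {p : 𝔼 (ν × ι) × 𝔼 (ν × ι) | rowApply p.2 (queryDir Φ Ψ y₀ p.1 s) ∈ B} := by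
    ext p
    simp only [Set.mem_preimage, Set.mem_ofPred_eq]
    rw [queryDir_refresh p le_rfl, rowApply_refresh_self]
  have hS' : MeasurableSet
      {p : 𝔼 (ν × ι) × 𝔼 (ν × ι) | rowApply p.2 (queryDir Φ Ψ y₀ p.1 s) ∈ B} :=
    (measurable_rowApply measurable_snd (hd.comp measurable_fst)) hB
  rw [h1, Measure.prod_apply hS']
  calc _ ≤ ∫⁻ _, stdGaussian (𝔼 ν) B ∂γ := by
        refine lintegral_mono fun x => ?_
        rcases norm_gramSchmidtNormed (queryVec Φ Ψ y₀ x) s with h | h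
        · rw [← map_rowApply_stdGaussian (ν := ν) h,
            Measure.map_apply (by fun_prop) hB]
          rfl
        · have : (Prod.mk x ⁻¹' {p : 𝔼 (ν × ι) × 𝔼 (ν × ι) |
              rowApply p.2 (queryDir Φ Ψ y₀ p.1 s) ∈ B}) = ∅ := by
            ext z'
            simp only [Set.mem_preimage, Set.mem_ofPred_eq, Set.mem_empty_iff_false, iff_false]
            rw [queryDir, h, map_zero]
            exact h0
          rw [this]
          simp
    _ = _ := by simp

end AdaptiveGaussian

-- Atypical responses of a Gaussian matrix.

section GaussianTails

local notation "𝔼" => EuclideanSpace ℝ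

/-- Fourth moment of the standard Gaussian law. -/
def gaussFourth : ℝ := ∫ x, x ^ 4 ∂gaussianReal 0 1

/-- Fourth central moment of the fourth power of a standard Gaussian variable. -/
def gaussFourthVar : ℝ := ∫ x, (x ^ 4 - gaussFourth) ^ 4 ∂gaussianReal 0 1

theorem gaussFourth_nonneg : 0 ≤ gaussFourth := integral_nonneg fun x => by positivity

theorem gaussFourthVar_nonneg : 0 ≤ gaussFourthVar := integral_nonneg fun x => by positivity

/-- The vectors with an atypically large product with `v` or an atypically large fourth moment. -/
def atypical {N : ℕ} (v : Fin N → ℝ) : Set (Fin N → ℝ) :=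
  {x | (N : ℝ) ^ (3 / 2 : ℝ) * (∑ n, v n ^ 2) ^ 2 < (∑ n, v n * x n) ^ 4} ∪
    {x | (gaussFourth + 1) * N < ∑ n, x n ^ 4}

theorem measurableSet_atypical {N : ℕ} (v : Fin N → ℝ) : MeasurableSet (atypical v) :=
  (measurableSet_lt (by fun_prop) (by fun_prop)).union
    (measurableSet_lt (by fun_prop) (by fun_prop))

/-- Needed for queries without a new direction, whose response along it is zero. -/
theorem zero_notMem_atypical {N : ℕ} (v : Fin N → ℝ) : (0 : Fin N → ℝ) ∉ atypical v := by
  have := gaussFourth_nonneg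
  simp only [atypical, Set.mem_union, Set.mem_ofPred_eq, Pi.zero_apply, mul_zero,
    Finset.sum_const_zero, ne_eq, OfNat.ofNat_ne_zero, not_false_eq_true, zero_pow, not_or, not_lt]
  constructor <;> positivity

theorem memLp_gaussianReal_zero_one (p : ℝ≥0) :
    MemLp (fun x : ℝ => x) p (gaussianReal 0 1) := memLp_id_gaussianReal p

theorem integrable_pow_gaussianReal (k : ℕ) : Integrable (fun x : ℝ => x ^ k) (gaussianReal 0 1) := by
  have := (memLp_gaussianReal_zero_one k).integrable_norm_pow' 
  refine this.mono' (by fun_prop) (ae_of_all _ fun x => ?_)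
  simp

theorem memLp_four_of_integrable {Ω : Type*} [MeasurableSpace Ω] {P : Measure Ω} {f : Ω → ℝ}
    (hf : AEStronglyMeasurable f P) (h : Integrable (fun ω => f ω ^ 4) P) : MemLp f 4 P := by
  refine (integrable_norm_rpow_iff hf (by norm_num) (by norm_num)).1
    (h.congr (ae_of_all _ fun ω => ?_))
  change f ω ^ 4 = ‖f ω‖ ^ (4 : ℝ≥0∞).toReal
  rw [ENNReal.toReal_ofNat, show (4 : ℝ) = ((4 : ℕ) : ℝ) by norm_num, Real.rpow_natCast,
    Real.norm_eq_abs, Even.pow_abs (by decide : Even 4)]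

/-- Both parts are instances of `fourth_moment_tail` at level N^{3/2}: for the coordinates with
weights v, and for their centered fourth powers with unit weights. -/
theorem pi_gaussianReal_atypical_le {N : ℕ} (hN : 0 < N) (v : Fin N → ℝ) :
    Measure.pi (fun _ : Fin N => gaussianReal 0 1) (atypical v)
      ≤ ENNReal.ofReal (3 * (gaussFourth + gaussFourthVar) / (N : ℝ) ^ (3 / 2 : ℝ)) := by
  set γ := Measure.pi (fun _ : Fin N => gaussianReal 0 1)
  have hN' : (0 : ℝ) < N := by exact_mod_cast hN
  have hN1 : (1 : ℝ) ≤ N := by exact_mod_cast hN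
  have hl : 0 < (N : ℝ) ^ (3 / 2 : ℝ) := by positivity
  have hev : ∀ n, MeasurePreserving (Function.eval n) γ (gaussianReal 0 1) :=
    fun n => measurePreserving_eval _ n
  have hint : ∀ (n : Fin N) (f : ℝ → ℝ), Measurable f →
      ∫ x, f (x n) ∂γ = ∫ x, f x ∂gaussianReal 0 1 := fun n f hf => by
    rw [← (hev n).map_eq, integral_map (hev n).measurable.aemeasurable hf.aestronglyMeasurable]
  have hInt : ∀ (n : Fin N) (f : ℝ → ℝ), Integrable f (gaussianReal 0 1) →
      Integrable (fun x => f (x n)) γ := fun n f hf => (hev n).integrable_comp_of_integrable hf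
  have hi4 : Integrable (fun x : ℝ => (x ^ 4 - gaussFourth) ^ 4) (gaussianReal 0 1) := by
    have : ∀ x : ℝ, (x ^ 4 - gaussFourth) ^ 4 = x ^ 16 - 4 * gaussFourth * x ^ 12
        + 6 * gaussFourth ^ 2 * x ^ 8 - 4 * gaussFourth ^ 3 * x ^ 4 + gaussFourth ^ 4 := by
      intro x; ring
    simp_rw [this]
    exact ((((integrable_pow_gaussianReal 16).sub ((integrable_pow_gaussianReal 12).const_mul _)).add
      ((integrable_pow_gaussianReal 8).const_mul _)).sub
      ((integrable_pow_gaussianReal 4).const_mul _)).add (integrable_const _)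
  have t1 := fourth_moment_tail (P := γ) (ξ := fun n (x : Fin N → ℝ) => x n) (K := gaussFourth)
    (fun n => (measurable_pi_apply n).aemeasurable) (iIndepFun_pi (X := fun _ x => x) fun n => by fun_prop)
    (fun n => memLp_four_of_integrable (measurable_pi_apply n).aestronglyMeasurable
      (hInt n (fun x => x ^ 4) (integrable_pow_gaussianReal 4)))
    (fun n => by rw [hint n (fun x => x) measurable_id]; simp)
    (fun n => by rw [hint n (fun x => x ^ 4) (by fun_prop)]; rfl) v hl
  have t2 := fourth_moment_tail (P := γ) (ξ := fun n (x : Fin N → ℝ) => x n ^ 4 - gaussFourth)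
    (K := gaussFourthVar)
    (fun n => (((measurable_pi_apply n).pow_const 4).sub_const _).aemeasurable)
    (iIndepFun_pi (X := fun _ x => x ^ 4 - gaussFourth) fun n => by fun_prop)
    (fun n => memLp_four_of_integrable
      (((measurable_pi_apply n).pow_const 4).sub_const _).aestronglyMeasurable (hInt n _ hi4))
    (fun n => by
      rw [hint n (fun x => x ^ 4 - gaussFourth) (by fun_prop), integral_sub
        (integrable_pow_gaussianReal 4) (integrable_const _)]
      simp [gaussFourth])
    (fun n => by rw [hint n (fun x => (x ^ 4 - gaussFourth) ^ 4) (by fun_prop)]; rfl)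
    (fun _ => 1) hl
  -- An excess of N in the sum of fourth powers has fourth power at least N⁴ ≥ N^{3/2}·N², far
  -- beyond the required level.
  have hsub : {x : Fin N → ℝ | (gaussFourth + 1) * N < ∑ n, x n ^ 4} ⊆
      {x | (N : ℝ) ^ (3 / 2 : ℝ) * (∑ _n : Fin N, (1 : ℝ) ^ 2) ^ 2
        < (∑ n, 1 * (x n ^ 4 - gaussFourth)) ^ 4} := by
    intro x hx
    simp only [Set.mem_ofPred_eq] at hx ⊢
    simp only [one_pow, Finset.sum_const, Finset.card_univ, Fintype.card_fin, nsmul_eq_mul,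
      mul_one, one_mul, Finset.sum_sub_distrib]
    have h1 : (N : ℝ) < ∑ n, x n ^ 4 - N * gaussFourth := by linarith
    have h2 : (N : ℝ) ^ (3 / 2 : ℝ) ≤ (N : ℝ) ^ 2 := by
      rw [← Real.rpow_natCast]
      exact Real.rpow_le_rpow_of_exponent_le hN1 (by norm_num)
    calc (N : ℝ) ^ (3 / 2 : ℝ) * (N : ℝ) ^ 2 ≤ (N : ℝ) ^ 2 * (N : ℝ) ^ 2 := by gcongr
      _ = (N : ℝ) ^ 4 := by ring
      _ < _ := by gcongr
  refine (measure_union_le _ _).trans ((add_le_add t1 ((measure_mono hsub).trans t2)).trans ?_)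
  have := gaussFourth_nonneg
  have := gaussFourthVar_nonneg
  rw [← ENNReal.ofReal_add (by positivity) (by positivity)]
  apply ENNReal.ofReal_le_ofReal
  rw [← add_div, mul_add]

theorem sum_pow_four_le (s : Finset ℕ) (f : ℕ → ℝ) :
    (∑ i ∈ s, f i) ^ 4 ≤ (s.card : ℝ) ^ 3 * ∑ i ∈ s, f i ^ 4 := by
  have h1 := sq_sum_le_card_mul_sum_sq (s := s) (f := f)
  have h2 := sq_sum_le_card_mul_sum_sq (s := s) (f := fun i => f i ^ 2)
  calc (∑ i ∈ s, f i) ^ 4 = ((∑ i ∈ s, f i) ^ 2) ^ 2 := by ring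
    _ ≤ (s.card * ∑ i ∈ s, f i ^ 2) ^ 2 := by gcongr
    _ = (s.card : ℝ) ^ 2 * (∑ i ∈ s, f i ^ 2) ^ 2 := by ring
    _ ≤ (s.card : ℝ) ^ 2 * (s.card * ∑ i ∈ s, (f i ^ 2) ^ 2) := by gcongr
    _ = _ := by
      rw [← mul_assoc]; congr 1
      exact Finset.sum_congr rfl fun i _ => by ring

variable {N : ℕ} {ι : Type*} [Fintype ι] {F : Type*} [MeasurableSpace F]
  {Φ : ℕ → F → 𝔼 ι} {Ψ : ℕ → F → 𝔼 (Fin N) → F} {y₀ : F}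

/-- With high probability, the answer to an adaptive query of a standard Gaussian matrix is nearly
orthogonal to a fixed vector and has a bounded empirical fourth moment. -/
theorem measure_queryVec_atypical_le (hN : 0 < N) (hΦ : ∀ s, Measurable (Φ s))
    (hΨ : ∀ s, Measurable (Function.uncurry (Ψ s))) (v : Fin N → ℝ) (s : ℕ) :
    stdGaussian (𝔼 (Fin N × ι)) {z | ¬ (
      (∑ n, v n * rowApply z (queryVec Φ Ψ y₀ z s) n) ^ 4
          ≤ (s + 1) ^ 4 * ‖queryVec Φ Ψ y₀ z s‖ ^ 4
            * ((N : ℝ) ^ (3 / 2 : ℝ) * (∑ n, v n ^ 2) ^ 2) ∧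
      ∑ n, rowApply z (queryVec Φ Ψ y₀ z s) n ^ 4
          ≤ (s + 1) ^ 4 * ‖queryVec Φ Ψ y₀ z s‖ ^ 4 * ((gaussFourth + 1) * N))}
      ≤ ENNReal.ofReal
        ((s + 1) * (3 * (gaussFourth + gaussFourthVar)) / (N : ℝ) ^ (3 / 2 : ℝ)) := by
  set B : Set (𝔼 (Fin N)) := WithLp.ofLp ⁻¹' atypical v with hB
  have hBm : MeasurableSet B := (MeasurableEquiv.toLp 2 (Fin N → ℝ)).symm.measurable
    (measurableSet_atypical v)
  have hBle : stdGaussian (𝔼 (Fin N)) B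
      ≤ ENNReal.ofReal (3 * (gaussFourth + gaussFourthVar) / (N : ℝ) ^ (3 / 2 : ℝ)) := by
    rw [← map_pi_eq_stdGaussian, Measure.map_apply (by fun_prop) hBm]
    exact pi_gaussianReal_atypical_le hN v
  -- If none of the s + 1 directions has an atypical response, neither has their combination. The
  -- coefficients are at most ‖x‖, and the factor (s + 1)⁴ is the (s + 1)³ of `sum_pow_four_le`
  -- times the number of terms.
  have hsub : {z : 𝔼 (Fin N × ι) | ¬ (
      (∑ n, v n * rowApply z (queryVec Φ Ψ y₀ z s) n) ^ 4
          ≤ (s + 1) ^ 4 * ‖queryVec Φ Ψ y₀ z s‖ ^ 4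
            * ((N : ℝ) ^ (3 / 2 : ℝ) * (∑ n, v n ^ 2) ^ 2) ∧
      ∑ n, rowApply z (queryVec Φ Ψ y₀ z s) n ^ 4
          ≤ (s + 1) ^ 4 * ‖queryVec Φ Ψ y₀ z s‖ ^ 4 * ((gaussFourth + 1) * N))}
      ⊆ ⋃ r ∈ Finset.range (s + 1), {z | rowApply z (queryDir Φ Ψ y₀ z r) ∈ B} := by
    intro z hz
    by_contra hcon
    simp only [Set.mem_iUnion, Set.mem_ofPred_eq, not_exists] at hcon
    refine hz ?_
    set x := queryVec Φ Ψ y₀ z s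
    set c : ℕ → ℝ := fun r => inner ℝ (queryDir Φ Ψ y₀ z r) x with hc
    set ζ : ℕ → 𝔼 (Fin N) := fun r => rowApply z (queryDir Φ Ψ y₀ z r) with hζ
    have hh : ∀ n, rowApply z x n = ∑ r ∈ Finset.range (s + 1), c r * ζ r n := by
      intro n
      rw [rowApply_queryVec z z s]
      simp [hc, hζ, x]
    have hc4 : ∀ r, c r ^ 4 ≤ ‖x‖ ^ 4 := by
      intro r
      have h1 : |c r| ≤ ‖x‖ := by
        refine (abs_real_inner_le_norm _ _).trans ?_
        rcases norm_gramSchmidtNormed (queryVec Φ Ψ y₀ z) r with h | h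
        · rw [queryDir, h, one_mul]
        · rw [queryDir, h]; simp
      rw [← Even.pow_abs (by decide : Even 4)]
      gcongr
    have hgood : ∀ r ∈ Finset.range (s + 1),
        (∑ n, v n * ζ r n) ^ 4 ≤ (N : ℝ) ^ (3 / 2 : ℝ) * (∑ n, v n ^ 2) ^ 2 ∧
        ∑ n, ζ r n ^ 4 ≤ (gaussFourth + 1) * N := by
      intro r hr
      have := hcon r hr
      simp only [hB, atypical, Set.mem_preimage, Set.mem_union, Set.mem_ofPred_eq, not_or,
        not_lt] at this
      exact this
    have hgf := gaussFourth_nonneg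
    constructor
    · have h1 : ∑ n, v n * rowApply z x n
          = ∑ r ∈ Finset.range (s + 1), c r * ∑ n, v n * ζ r n := by
        simp_rw [hh, Finset.mul_sum]
        rw [Finset.sum_comm]
        exact Finset.sum_congr rfl fun r _ => Finset.sum_congr rfl fun n _ => by ring
      rw [h1]
      refine (sum_pow_four_le _ _).trans ?_
      have h2 : ∑ r ∈ Finset.range (s + 1), (c r * ∑ n, v n * ζ r n) ^ 4
          ≤ ∑ r ∈ Finset.range (s + 1),
            ‖x‖ ^ 4 * ((N : ℝ) ^ (3 / 2 : ℝ) * (∑ n, v n ^ 2) ^ 2) := by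
        refine Finset.sum_le_sum fun r hr => ?_
        rw [mul_pow]
        exact mul_le_mul (hc4 r) (hgood r hr).1 (by positivity) (by positivity)
      rw [Finset.sum_const, Finset.card_range, nsmul_eq_mul] at h2
      rw [Finset.card_range]
      calc _ ≤ ((s + 1 : ℕ) : ℝ) ^ 3 * (((s + 1 : ℕ) : ℝ) *
            (‖x‖ ^ 4 * ((N : ℝ) ^ (3 / 2 : ℝ) * (∑ n, v n ^ 2) ^ 2))) := by gcongr
        _ = _ := by push_cast; ring
    · have h2 : ∑ n, rowApply z x n ^ 4 ≤ ∑ n, ((s + 1 : ℕ) : ℝ) ^ 3 *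
          ∑ r ∈ Finset.range (s + 1), ‖x‖ ^ 4 * ζ r n ^ 4 := by
        refine Finset.sum_le_sum fun n _ => ?_
        rw [hh]
        refine (sum_pow_four_le _ _).trans ?_
        rw [Finset.card_range]
        gcongr with r hr
        rw [mul_pow]
        exact mul_le_mul_of_nonneg_right (hc4 r) (by positivity)
      refine h2.trans ?_
      rw [← Finset.mul_sum, Finset.sum_comm]
      simp_rw [← Finset.mul_sum]
      have h3 : ∑ r ∈ Finset.range (s + 1), ∑ n, ζ r n ^ 4
          ≤ ((s + 1 : ℕ) : ℝ) * ((gaussFourth + 1) * N) := by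
        refine (Finset.sum_le_sum fun r hr => (hgood r hr).2).trans ?_
        rw [Finset.sum_const, Finset.card_range, nsmul_eq_mul]
      calc _ ≤ ((s + 1 : ℕ) : ℝ) ^ 3 * (‖x‖ ^ 4 *
            (((s + 1 : ℕ) : ℝ) * ((gaussFourth + 1) * N))) := by gcongr
        _ = _ := by push_cast; ring
  refine (measure_mono hsub).trans ((measure_biUnion_finset_le _ _).trans ?_)
  have h0 : (0 : 𝔼 (Fin N)) ∉ B := zero_notMem_atypical v
  refine (Finset.sum_le_sum fun r _ => (measure_rowApply_queryDir_le hΦ hΨ r hBm h0).trans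
    hBle).trans ?_
  rw [Finset.sum_const, Finset.card_range, nsmul_eq_mul, ← ENNReal.ofReal_natCast,
    ← ENNReal.ofReal_mul (by positivity)]
  apply ENNReal.ofReal_le_ofReal
  push_cast
  rw [← mul_div_assoc]

end GaussianTails

-- The dynamics as adaptive queries of one Gaussian matrix.

section Interference

local notation "𝔼" => EuclideanSpace ℝ

/-- The Gaussian inputs of a system of `N` units over `T` periods: fixed interference, time-dependent
interference, noise. -/
abbrev Inputs (N T : ℕ) : Type :=
  (Fin N × Fin N → ℝ) × (Fin T × Fin N × Fin N → ℝ) × (Fin T × Fin N → ℝ)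

/-- Outcomes driven by the inputs `u` through the message functions `φ t`; zero after time `T`. -/
def drivenOutcome {N T : ℕ} (φ : ℕ → (Fin N → ℝ) → Fin N → ℝ) (y₀ : Fin N → ℝ) (u : Inputs N T) :
    ℕ → Fin N → ℝ
  | 0 => y₀
  | t + 1 => fun i =>
      if h : t < T then
        ∑ j, (u.1 (i, j) + u.2.1 (⟨t, h⟩, i, j)) * φ t (drivenOutcome φ y₀ u t) j
          + u.2.2 (⟨t, h⟩, i)
      else 0

/-- Joint law of the Gaussian inputs. -/
def inputLaw (N T : ℕ) (μ μ₀ : ℝ) (σ2 : ℝ≥0) (σ2t : ℕ → ℝ≥0) (σ2e : ℝ≥0) : Measure (Inputs N T) :=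
  (Measure.pi fun _ => gaussianReal (μ / N) (σ2 / N)).prod
    ((Measure.pi fun e : Fin T × Fin N × Fin N => gaussianReal (μ₀ / N) (σ2t e.1 / N)).prod
      (Measure.pi fun _ => gaussianReal 0 σ2e))

theorem gaussianReal_map_affine (m : ℝ) (v : ℝ≥0) :
    (gaussianReal 0 1).map (fun x => m + √v * x) = gaussianReal m v := by
  have h : (fun x : ℝ => m + √v * x) = (fun x => m + x) ∘ fun x => √v * x := rfl
  rw [h, ← Measure.map_map (by fun_prop) (by fun_prop), gaussianReal_map_const_mul,
    gaussianReal_map_const_add]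
  congr 1
  · simp
  · ext; simp

theorem measurePreserving_pi_affine {κ : Type*} [Fintype κ] (m : κ → ℝ) (v : κ → ℝ≥0) :
    MeasurePreserving (fun (x : κ → ℝ) k => m k + √(v k) * x k)
      (Measure.pi fun _ => gaussianReal 0 1) (Measure.pi fun k => gaussianReal (m k) (v k)) :=
  measurePreserving_pi _ _ fun k => ⟨by fun_prop, gaussianReal_map_affine (m k) (v k)⟩

/-- Columns of the standard Gaussian matrix that generates all the inputs. -/
abbrev Cols (N T : ℕ) : Type := Fin N ⊕ (Fin T × Fin N) ⊕ Fin T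

/-- The inputs generated by a standard Gaussian matrix. -/
def inputsOf (N T : ℕ) (μ μ₀ : ℝ) (σ2 : ℝ≥0) (σ2t : ℕ → ℝ≥0) (σ2e : ℝ≥0)
    (z : 𝔼 (Fin N × Cols N T)) : Inputs N T :=
  (fun e => μ / N + √(σ2 / N : ℝ≥0) * z (e.1, Sum.inl e.2),
    fun e => μ₀ / N + √(σ2t e.1 / N : ℝ≥0) * z (e.2.1, Sum.inr (Sum.inl (e.1, e.2.2))),
    fun e => 0 + √σ2e * z (e.2, Sum.inr (Sum.inr e.1)))

/-- Reindexing of the entries of the generating matrix. -/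
def entryEquiv (N T : ℕ) :
    (Fin N × Fin N) ⊕ (Fin T × Fin N × Fin N) ⊕ (Fin T × Fin N) ≃ Fin N × Cols N T where
  toFun
    | Sum.inl e => (e.1, Sum.inl e.2)
    | Sum.inr (Sum.inl e) => (e.2.1, Sum.inr (Sum.inl (e.1, e.2.2)))
    | Sum.inr (Sum.inr e) => (e.2, Sum.inr (Sum.inr e.1))
  invFun
    | (i, Sum.inl j) => Sum.inl (i, j)
    | (i, Sum.inr (Sum.inl e)) => Sum.inr (Sum.inl (e.1, i, e.2))
    | (i, Sum.inr (Sum.inr t)) => Sum.inr (Sum.inr (t, i))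
  left_inv x := by rcases x with _ | _ | _ <;> rfl
  right_inv x := by rcases x with ⟨_, _ | _ | _⟩ <;> rfl

/-- Reindexing splits the i.i.d. entries into three independent blocks, each of which is then
shifted and scaled entrywise. Zero variances are allowed. -/
theorem measurePreserving_inputsOf (N T : ℕ) (μ μ₀ : ℝ) (σ2 : ℝ≥0) (σ2t : ℕ → ℝ≥0) (σ2e : ℝ≥0) :
    MeasurePreserving (inputsOf N T μ μ₀ σ2 σ2t σ2e) (stdGaussian (𝔼 (Fin N × Cols N T)))
      (inputLaw N T μ μ₀ σ2 σ2t σ2e) := by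
  have h0 : MeasurePreserving (WithLp.ofLp : 𝔼 (Fin N × Cols N T) → _)
      (stdGaussian (𝔼 (Fin N × Cols N T))) (Measure.pi fun _ => gaussianReal 0 1) := by
    refine ⟨by fun_prop, ?_⟩
    rw [← map_pi_eq_stdGaussian, Measure.map_map (by fun_prop) (by fun_prop)]
    exact Measure.map_id
  have h1 := (measurePreserving_piCongrLeft (fun _ : Fin N × Cols N T => gaussianReal 0 1)
    (entryEquiv N T)).symm
  have h2 := measurePreserving_sumPiEquivProdPi
    (fun _ : (Fin N × Fin N) ⊕ (Fin T × Fin N × Fin N) ⊕ (Fin T × Fin N) => gaussianReal 0 1)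
  have h3 := measurePreserving_sumPiEquivProdPi
    (fun _ : (Fin T × Fin N × Fin N) ⊕ (Fin T × Fin N) => gaussianReal 0 1)
  have h4 := (measurePreserving_pi_affine (fun _ : Fin N × Fin N => μ / N) fun _ => σ2 / N).prod
    ((measurePreserving_pi_affine (fun _ : Fin T × Fin N × Fin N => μ₀ / N)
      fun e => σ2t e.1 / N).prod (measurePreserving_pi_affine (fun _ : Fin T × Fin N => (0 : ℝ))
        fun _ => σ2e))
  exact (h4.comp (((MeasurePreserving.id _).prod h3).comp h2)).comp (h1.comp h0)

variable {N T : ℕ}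

/-- The query vector that produces the centered outcomes at time `s + 1` from the message `g`. -/
def messageQuery (T : ℕ) (σ2 : ℝ≥0) (σ2t : ℕ → ℝ≥0) (σ2e : ℝ≥0) (s : ℕ) (g : Fin N → ℝ) :
    𝔼 (Cols N T) :=
  WithLp.toLp 2 (Sum.elim (fun j => √(σ2 / N : ℝ≥0) * g j)
    (Sum.elim (fun e => if (e.1 : ℕ) = s then √(σ2t s / N : ℝ≥0) * g e.2 else 0)
      (fun t => if (t : ℕ) = s then √σ2e else 0)))

/-- This is the variance scale of the fluctuations. The factors 1/N in the entry variances turn the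
squared length of the message into a population average. -/
theorem norm_messageQuery_sq (σ2 : ℝ≥0) (σ2t : ℕ → ℝ≥0) (σ2e : ℝ≥0) {s : ℕ} (hs : s < T)
    (g : Fin N → ℝ) : ‖messageQuery T σ2 σ2t σ2e s g‖ ^ 2
      = (σ2 + σ2t s) * popMean (fun n => g n ^ 2) + σ2e := by
  rw [EuclideanSpace.real_norm_sq_eq]
  simp only [messageQuery, Fintype.sum_sum_type, Sum.elim_inl, Sum.elim_inr, Fintype.sum_prod_type]
  have e1 : ∀ t : Fin T, (∑ j, (if (t : ℕ) = s then √(σ2t s / N : ℝ≥0) * g j else 0) ^ 2)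
      = if t = ⟨s, hs⟩ then ∑ j, (√(σ2t s / N : ℝ≥0) * g j) ^ 2 else 0 := by
    intro t
    by_cases h : t = ⟨s, hs⟩
    · simp [h]
    · have : (t : ℕ) ≠ s := fun h' => h (Fin.ext h')
      simp [h, this]
  have e2 : ∀ t : Fin T, (if (t : ℕ) = s then √σ2e else 0) ^ 2
      = if t = ⟨s, hs⟩ then √σ2e ^ 2 else 0 := by
    intro t
    by_cases h : t = ⟨s, hs⟩
    · simp [h]
    · have : (t : ℕ) ≠ s := fun h' => h (Fin.ext h')
      simp [h, this]
  simp_rw [e1, e2, Finset.sum_ite_eq', Finset.mem_univ, if_true, mul_pow]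
  simp only [Real.sq_sqrt, NNReal.zero_le_coe, ← Finset.mul_sum, popMean]
  push_cast
  ring

/-- The query selects the columns of A and those of B and the noise at time s. The entry means μ/N
and μ₀/N contribute the same amount in every row, which is subtracted. -/
theorem rowApply_messageQuery (μ μ₀ : ℝ) (σ2 : ℝ≥0) (σ2t : ℕ → ℝ≥0) (σ2e : ℝ≥0) {s : ℕ}
    (hs : s < T) (g : Fin N → ℝ) (z : 𝔼 (Fin N × Cols N T)) (i : Fin N) :
    rowApply z (messageQuery T σ2 σ2t σ2e s g) i
      = ∑ j, ((inputsOf N T μ μ₀ σ2 σ2t σ2e z).1 (i, j)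
          + (inputsOf N T μ μ₀ σ2 σ2t σ2e z).2.1 (⟨s, hs⟩, i, j)) * g j
        + (inputsOf N T μ μ₀ σ2 σ2t σ2e z).2.2 (⟨s, hs⟩, i) - (μ + μ₀) * popMean g := by
  rw [rowApply_apply]
  simp only [messageQuery, Fintype.sum_sum_type, Sum.elim_inl, Sum.elim_inr, Fintype.sum_prod_type,
    inputsOf, mul_ite, mul_zero, zero_add]
  have e1 : ∀ t : Fin T, (∑ j, (if (t : ℕ) = s then z (i, Sum.inr (Sum.inl (t, j)))
        * (√(σ2t s / N : ℝ≥0) * g j) else 0))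
      = if t = ⟨s, hs⟩ then ∑ j, z (i, Sum.inr (Sum.inl (t, j)))
        * (√(σ2t s / N : ℝ≥0) * g j) else 0 := by
    intro t
    by_cases h : t = ⟨s, hs⟩
    · simp [h]
    · have : (t : ℕ) ≠ s := fun h' => h (Fin.ext h')
      simp [h, this]
  have e2 : ∀ t : Fin T, (if (t : ℕ) = s then z (i, Sum.inr (Sum.inr t)) * √σ2e else 0)
      = if t = ⟨s, hs⟩ then z (i, Sum.inr (Sum.inr t)) * √σ2e else 0 := by
    intro t
    by_cases h : t = ⟨s, hs⟩
    · simp [h]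
    · have : (t : ℕ) ≠ s := fun h' => h (Fin.ext h')
      simp [h, this]
  simp_rw [e1, e2, Finset.sum_ite_eq', Finset.mem_univ, if_true, add_mul, Finset.sum_add_distrib,
    ← Finset.mul_sum, popMean]
  have e3 : ∀ (c : ℝ) (f : Fin N → ℝ), ∑ j, c * f j * g j = ∑ j, f j * (c * g j) :=
    fun c f => Finset.sum_congr rfl fun j _ => by ring
  simp_rw [e3]
  ring

end Interference

-- Typical fluctuations for a frozen and for a random environment.

section TypicalSteps

local notation "𝔼" => EuclideanSpace ℝ

variable {N T : ℕ}

/-- The fluctuation `r` of the outcomes at time `s + 1` is nearly orthogonal to `v` and has a bounded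
empirical fourth moment, relative to its variance scale `ρ`. -/
def Typical (s : ℕ) (ρ : ℝ) (v r : Fin N → ℝ) : Prop :=
  (∑ n, v n * r n) ^ 4 ≤ (s + 1) ^ 4 * ρ ^ 2 * ((N : ℝ) ^ (3 / 2 : ℝ) * (∑ n, v n ^ 2) ^ 2) ∧
    ∑ n, r n ^ 4 ≤ (s + 1) ^ 4 * ρ ^ 2 * ((gaussFourth + 1) * N)

theorem measurableSet_typical {α : Type*} [MeasurableSpace α] (s : ℕ) {ρ : α → ℝ}
    {v r : α → Fin N → ℝ} (hρ : Measurable ρ) (hv : Measurable v) (hr : Measurable r) :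
    MeasurableSet {a | Typical s (ρ a) (v a) (r a)} := by
  have hv' : ∀ n, Measurable fun a => v a n := fun n => (measurable_pi_apply n).comp hv
  have hr' : ∀ n, Measurable fun a => r a n := fun n => (measurable_pi_apply n).comp hr
  have h1 : MeasurableSet {a | (∑ n, v a n * r a n) ^ 4
      ≤ (s + 1) ^ 4 * ρ a ^ 2 * ((N : ℝ) ^ (3 / 2 : ℝ) * (∑ n, v a n ^ 2) ^ 2)} :=
    measurableSet_le (by fun_prop) (by fun_prop)
  have h2 : MeasurableSet {a | ∑ n, r a n ^ 4
      ≤ (s + 1) ^ 4 * ρ a ^ 2 * ((gaussFourth + 1) * N)} :=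
    measurableSet_le (by fun_prop) (by fun_prop)
  exact h1.inter h2

theorem measurable_popMean {α : Type*} [MeasurableSpace α] {g : α → Fin N → ℝ}
    (hg : Measurable g) : Measurable fun a => popMean (g a) := by
  have hg' : ∀ n, Measurable fun a => g a n := fun n => (measurable_pi_apply n).comp hg
  unfold popMean
  fun_prop

theorem measurable_messageQuery (σ2 : ℝ≥0) (σ2t : ℕ → ℝ≥0) (σ2e : ℝ≥0) (s : ℕ) :
    Measurable fun g : Fin N → ℝ => messageQuery T σ2 σ2t σ2e s g := by
  refine (MeasurableEquiv.toLp 2 (Cols N T → ℝ)).measurable.comp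
    (measurable_pi_lambda _ fun k => ?_)
  rcases k with j | e | t
  · simp only [Sum.elim_inl]; fun_prop
  · simp only [Sum.elim_inl, Sum.elim_inr]
    split_ifs <;> fun_prop
  · simp only [Sum.elim_inr]; fun_prop

/-- This brings the outcome process under the query scheme: the update adds the common mean back to
the centered response. Both sides vanish after time T, where no inputs exist. -/
theorem queryState_messageQuery (μ μ₀ : ℝ) (σ2 : ℝ≥0) (σ2t : ℕ → ℝ≥0) (σ2e : ℝ≥0)
    (φ : ℕ → (Fin N → ℝ) → Fin N → ℝ) (y₀ : Fin N → ℝ) (z : 𝔼 (Fin N × Cols N T)) (s : ℕ) :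
    queryState (fun s y => messageQuery T σ2 σ2t σ2e s (φ s y))
      (fun s y (h : 𝔼 (Fin N)) i => if s < T then (μ + μ₀) * popMean (φ s y) + h i else 0) y₀ z s
      = drivenOutcome φ y₀ (inputsOf N T μ μ₀ σ2 σ2t σ2e z) s := by
  induction s with
  | zero => rfl
  | succ s ih =>
    rw [queryState, ih]
    ext i
    rw [drivenOutcome]
    by_cases hs : s < T
    · simp only [hs, if_true, dif_pos]
      rw [rowApply_messageQuery μ μ₀ σ2 σ2t σ2e hs]
      ring
    · simp [hs]

/-- The event is pulled back to the generating matrix, where it becomes the atypical query event.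
The environment is frozen here, so `v` is deterministic. -/
theorem inputLaw_not_typical_le (hN : 0 < N) (μ μ₀ : ℝ) (σ2 : ℝ≥0) (σ2t : ℕ → ℝ≥0) (σ2e : ℝ≥0)
    {φ : ℕ → (Fin N → ℝ) → Fin N → ℝ} (hφ : ∀ s, Measurable (φ s)) (y₀ v : Fin N → ℝ) {s : ℕ}
    (hs : s < T)
    (hm : MeasurableSet {u : Inputs N T | ¬ Typical s ((σ2 + σ2t s)
      * popMean (fun n => φ s (drivenOutcome φ y₀ u s) n ^ 2) + σ2e) v
      (fun n => drivenOutcome φ y₀ u (s + 1) n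
        - (μ + μ₀) * popMean (φ s (drivenOutcome φ y₀ u s)))}) :
    inputLaw N T μ μ₀ σ2 σ2t σ2e {u | ¬ Typical s ((σ2 + σ2t s)
      * popMean (fun n => φ s (drivenOutcome φ y₀ u s) n ^ 2) + σ2e) v
      (fun n => drivenOutcome φ y₀ u (s + 1) n
        - (μ + μ₀) * popMean (φ s (drivenOutcome φ y₀ u s)))}
      ≤ ENNReal.ofReal
        ((s + 1) * (3 * (gaussFourth + gaussFourthVar)) / (N : ℝ) ^ (3 / 2 : ℝ)) := by
  rw [← (measurePreserving_inputsOf N T μ μ₀ σ2 σ2t σ2e).measure_preimage hm.nullMeasurableSet]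
  have hΨ : ∀ s, Measurable (Function.uncurry (fun (y : Fin N → ℝ) (h : 𝔼 (Fin N)) (i : Fin N) =>
      if s < T then (μ + μ₀) * popMean (φ s y) + h i else 0)) := by
    intro s
    by_cases hs : s < T
    · simp only [hs, if_true]
      refine measurable_pi_lambda _ fun i => ?_
      have h1 := measurable_popMean ((hφ s).comp (measurable_fst (α := Fin N → ℝ) (β := 𝔼 (Fin N))))
      have h2 : Measurable fun p : (Fin N → ℝ) × 𝔼 (Fin N) => p.2 i := by fun_prop
      exact (h1.const_mul _).add h2
    · simp only [hs, if_false]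
      exact measurable_const
  refine le_trans (measure_mono fun z hz => ?_) (measure_queryVec_atypical_le (N := N)
    (ι := Cols N T) (F := Fin N → ℝ)
    (Φ := fun s y => messageQuery T σ2 σ2t σ2e s (φ s y))
    (Ψ := fun s y (h : 𝔼 (Fin N)) i => if s < T then (μ + μ₀) * popMean (φ s y) + h i else 0)
    (y₀ := y₀) hN (fun s => (measurable_messageQuery σ2 σ2t σ2e s).comp (hφ s)) hΨ v s)
  simp only [Set.mem_preimage, Set.mem_ofPred_eq] at hz ⊢
  contrapose! hz
  set u := inputsOf N T μ μ₀ σ2 σ2t σ2e z with hu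
  have hq : queryVec (fun s y => messageQuery T σ2 σ2t σ2e s (φ s y))
      (fun s y (h : 𝔼 (Fin N)) i => if s < T then (μ + μ₀) * popMean (φ s y) + h i else 0) y₀ z s
      = messageQuery T σ2 σ2t σ2e s (φ s (drivenOutcome φ y₀ u s)) := by
    rw [queryVec, queryState_messageQuery]
  rw [hq] at hz
  have h4 : ‖messageQuery T σ2 σ2t σ2e s (φ s (drivenOutcome φ y₀ u s))‖ ^ 4
      = ((σ2 + σ2t s) * popMean (fun n => φ s (drivenOutcome φ y₀ u s) n ^ 2) + σ2e) ^ 2 := by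
    rw [← norm_messageQuery_sq σ2 σ2t σ2e hs]; ring
  have hr : ∀ i, rowApply z (messageQuery T σ2 σ2t σ2e s (φ s (drivenOutcome φ y₀ u s))) i
      = drivenOutcome φ y₀ u (s + 1) i
        - (μ + μ₀) * popMean (φ s (drivenOutcome φ y₀ u s)) := by
    intro i
    rw [rowApply_messageQuery μ μ₀ σ2 σ2t σ2e hs, drivenOutcome]
    simp only [hs, dif_pos]
    rfl
  simp_rw [h4, hr] at hz
  exact hz

theorem measurable_drivenOutcome {α : Type*} [MeasurableSpace α]
    {φ : α → ℕ → (Fin N → ℝ) → Fin N → ℝ}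
    (hφ : ∀ s, Measurable fun p : α × (Fin N → ℝ) => φ p.1 s p.2) {y₀ : α → Fin N → ℝ}
    (hy : Measurable y₀) {u : α → Inputs N T} (hu : Measurable u) (s : ℕ) :
    Measurable fun a => drivenOutcome (φ a) (y₀ a) (u a) s := by
  induction s with
  | zero => exact hy
  | succ s ih =>
    refine measurable_pi_lambda _ fun i => ?_
    simp only [drivenOutcome]
    by_cases hs : s < T
    · simp only [hs, dif_pos]
      have h1 : Measurable fun a => φ a s (drivenOutcome (φ a) (y₀ a) (u a) s) :=
        (hφ s).comp (measurable_id.prodMk ih)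
      have h2 : ∀ j, Measurable fun a => φ a s (drivenOutcome (φ a) (y₀ a) (u a) s) j :=
        fun j => (measurable_pi_apply j).comp h1
      have h3 : ∀ e, Measurable fun a => (u a).1 e :=
        fun e => (measurable_pi_apply e).comp (measurable_fst.comp hu)
      have h4 : ∀ e, Measurable fun a => (u a).2.1 e :=
        fun e => (measurable_pi_apply e).comp (measurable_fst.comp (measurable_snd.comp hu))
      have h5 : ∀ e, Measurable fun a => (u a).2.2 e :=
        fun e => (measurable_pi_apply e).comp (measurable_snd.comp (measurable_snd.comp hu))
      fun_prop
    · simp only [hs, dif_neg, not_false_eq_true]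
      exact measurable_const

/-- Uniformly in the environment, the fluctuations of one step are typical up to an event of
probability `O(N^{-3/2})`. -/
theorem measure_not_typical_le {Ω : Type*} [MeasurableSpace Ω] {P : Measure Ω}
    [IsProbabilityMeasure P] (hN : 0 < N) {μ μ₀ : ℝ} {σ2 : ℝ≥0} {σ2t : ℕ → ℝ≥0} {σ2e : ℝ≥0}
    {u : Ω → Inputs N T} (hu : HasLaw u (inputLaw N T μ μ₀ σ2 σ2t σ2e) P)
    {𝒳 : Type*} [MeasurableSpace 𝒳] {env : Ω → 𝒳} (henv : AEMeasurable env P)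
    (hind : IndepFun u env P) {φ : 𝒳 → ℕ → (Fin N → ℝ) → Fin N → ℝ}
    (hφ : ∀ s, Measurable fun p : 𝒳 × (Fin N → ℝ) => φ p.1 s p.2)
    {y₀ v : 𝒳 → Fin N → ℝ} (hy : Measurable y₀) (hv : Measurable v) {s : ℕ} (hs : s < T) :
    P {ω | ¬ Typical s ((σ2 + σ2t s) * popMean (fun n =>
          φ (env ω) s (drivenOutcome (φ (env ω)) (y₀ (env ω)) (u ω) s) n ^ 2) + σ2e) (v (env ω))
      (fun n => drivenOutcome (φ (env ω)) (y₀ (env ω)) (u ω) (s + 1) n - (μ + μ₀)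
        * popMean (φ (env ω) s (drivenOutcome (φ (env ω)) (y₀ (env ω)) (u ω) s)))}
      ≤ ENNReal.ofReal
        ((s + 1) * (3 * (gaussFourth + gaussFourthVar)) / (N : ℝ) ^ (3 / 2 : ℝ)) := by
  have hφ' : ∀ s, Measurable fun q : (Inputs N T × 𝒳) × (Fin N → ℝ) => φ q.1.2 s q.2 :=
    fun s => (hφ s).comp ((measurable_snd.comp measurable_fst).prodMk measurable_snd)
  have hY : ∀ s, Measurable fun a : Inputs N T × 𝒳 => drivenOutcome (φ a.2) (y₀ a.2) a.1 s :=
    fun s => measurable_drivenOutcome (φ := fun a : Inputs N T × 𝒳 => φ a.2) hφ'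
      (hy.comp measurable_snd) measurable_fst s
  have hg : Measurable fun a : Inputs N T × 𝒳 =>
      φ a.2 s (drivenOutcome (φ a.2) (y₀ a.2) a.1 s) :=
    (hφ s).comp (measurable_snd.prodMk (hY s))
  have hset : MeasurableSet {a : Inputs N T × 𝒳 | ¬ Typical s ((σ2 + σ2t s) * popMean (fun n =>
          φ a.2 s (drivenOutcome (φ a.2) (y₀ a.2) a.1 s) n ^ 2) + σ2e) (v a.2)
      (fun n => drivenOutcome (φ a.2) (y₀ a.2) a.1 (s + 1) n - (μ + μ₀)
        * popMean (φ a.2 s (drivenOutcome (φ a.2) (y₀ a.2) a.1 s)))} := by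
    refine (measurableSet_typical s ?_ (hv.comp measurable_snd) ?_).compl
    · refine ((measurable_popMean (measurable_pi_lambda _ fun n => ?_)).const_mul _).add_const _
      exact ((measurable_pi_apply n).comp hg).pow_const 2
    · refine measurable_pi_lambda _ fun n => ?_
      exact ((measurable_pi_apply n).comp (hY (s + 1))).sub
        ((measurable_popMean hg).const_mul _)
  -- The bound is uniform in the environment, so it suffices to prove it for each frozen value `e`.
  refine measure_le_of_indepFun hu.aemeasurable henv hind hset fun e => ?_
  have hsl : MeasurableSet {w : Inputs N T | (w, e) ∈ {a : Inputs N T × 𝒳 | ¬ Typical s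
      ((σ2 + σ2t s) * popMean (fun n =>
          φ a.2 s (drivenOutcome (φ a.2) (y₀ a.2) a.1 s) n ^ 2) + σ2e) (v a.2)
      (fun n => drivenOutcome (φ a.2) (y₀ a.2) a.1 (s + 1) n - (μ + μ₀)
        * popMean (φ a.2 s (drivenOutcome (φ a.2) (y₀ a.2) a.1 s)))}} :=
    measurable_prodMk_right hset
  rw [hu.measure_eq hsl]
  exact inputLaw_not_typical_le hN μ μ₀ σ2 σ2t σ2e
    (fun s => (hφ s).comp (measurable_const.prodMk measurable_id)) (y₀ e) (v e) hs hsl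

end TypicalSteps

-- Separation of Gaussian inputs and environment; almost sure typicality.

namespace Systems

variable {Ω : Type*} {M : ℕ}

/-- Treatments, coefficients, initial outcomes and covariates: everything but the Gaussian inputs. -/
abbrev Env (N T M : ℕ) : Type :=
  (Fin T → Fin N → ℝ) × (Fin N → Coef M) × (Fin N → ℝ) × (Fin N → Fin M → ℝ)

/-- The environment of the system of size `N` over `T` periods. -/
def env (S : Systems Ω M) (T N : ℕ) (ω : Ω) : Env N T M :=
  (fun t => S.W N ((t : ℕ) + 1) ω, S.coef N ω, S.Y₀ N ω, S.X N ω)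

/-- The Gaussian inputs of the system of size `N` over `T` periods. -/
def inputs (S : Systems Ω M) (T N : ℕ) (ω : Ω) : Inputs N T :=
  (fun e => S.A N ω e.1 e.2, fun e => S.B N e.1 ω e.2.1 e.2.2, fun e => S.noise N e.1 ω e.2)

/-- The messages under the treatment rule `D` at the outcomes `y`. -/
def message {N T : ℕ} (D : (Fin T → Fin N → ℝ) → ℕ → Fin N → ℝ) (e : Env N T M) (t : ℕ)
    (y : Fin N → ℝ) : Fin N → ℝ :=
  fun n => outcomeFun (e.2.1 n) (e.2.2.2 n) (D e.1 t n) (y n)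

/-- The outcomes are displayed as a function of inputs and environment, so that independence of the
two can be used. Observed and counterfactual assignments are both covered. -/
theorem outcome_eq_drivenOutcome (S : Systems Ω M) {N T : ℕ} (ω : Ω) {V : ℕ → Fin N → ℝ}
    {D : (Fin T → Fin N → ℝ) → ℕ → Fin N → ℝ}
    (hV : ∀ t < T, V (t + 1) = D (fun t => S.W N ((t : ℕ) + 1) ω) t) {t : ℕ} (ht : t ≤ T) :
    S.outcome N ω V t
      = drivenOutcome (message D (S.env T N ω)) (S.Y₀ N ω) (S.inputs T N ω) t := by
  induction t with
  | zero => rfl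
  | succ t ih =>
    ext i
    rw [outcome, drivenOutcome]
    have : t < T := ht
    simp only [this, dif_pos]
    rw [ih (by omega), hV t this]
    rfl

variable [MeasurableSpace Ω] {P : Measure Ω} [IsProbabilityMeasure P]

theorem measurable_outcomeFun {α : Type*} [MeasurableSpace α] {c : α → Coef M} {x : α → Fin M → ℝ}
    {w y : α → ℝ} (hc : Measurable c) (hx : Measurable x) (hw : Measurable w) (hy : Measurable y) :
    Measurable fun a => outcomeFun (c a) (x a) (w a) (y a) := by
  unfold outcomeFun Coef.base Coef.carry Coef.treat Coef.inter Coef.covar dotProduct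
  have h1 : ∀ i, Measurable fun a => x a i := fun i => (measurable_pi_apply i).comp hx
  have h2 : ∀ i, Measurable fun a => (c a).2.2.2.2 i := fun i =>
    (measurable_pi_apply i).comp hc.snd.snd.snd.snd
  have h3 := hc.fst
  have h4 := hc.snd.fst
  have h5 := hc.snd.snd.fst
  have h6 := hc.snd.snd.snd.fst
  fun_prop

theorem measurable_message {N T : ℕ} {D : (Fin T → Fin N → ℝ) → ℕ → Fin N → ℝ}
    (hD : ∀ t, Measurable fun w => D w t) (t : ℕ) :
    Measurable fun p : Env N T M × (Fin N → ℝ) => message D p.1 t p.2 := by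
  refine measurable_pi_lambda _ fun n => measurable_outcomeFun ?_ ?_ ?_ ?_
  · exact (measurable_pi_apply n).comp measurable_fst.snd.fst
  · exact (measurable_pi_apply n).comp measurable_fst.snd.snd.snd
  · exact (measurable_pi_apply n).comp ((hD t).comp measurable_fst.fst)
  · exact (measurable_pi_apply n).comp measurable_snd

theorem aemeasurable_env {S : Systems Ω M} {T : ℕ} (hi : IndepBlocks S P T)
    (hW : ∀ N, ∀ t < T, ∀ n, AEMeasurable (fun ω => S.W N (t + 1) ω n) P)
    (hc : ∀ N n, AEMeasurable (fun ω => S.coef N ω n) P) (N : ℕ) : AEMeasurable (S.env T N) P :=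
  AEMeasurable.prodMk
    (aemeasurable_pi_lambda _ fun t => aemeasurable_pi_lambda _ fun n => hW N t t.2 n)
    ((aemeasurable_pi_lambda _ fun n => hc N n).prodMk
      ((hi.meas_Y₀ N).aemeasurable.prodMk (hi.meas_X N).aemeasurable))

/-- Joint law of the Gaussian inputs, and their independence of the environment. -/
theorem hasLaw_inputs {S : Systems Ω M} {T : ℕ} {μ μ₀ : ℝ} {σ2 : ℝ≥0} {σ2t : ℕ → ℝ≥0} {σ2e : ℝ≥0}
    (hg : GaussianModel S P T μ μ₀ σ2 σ2t σ2e) (hi : IndepBlocks S P T) {N : ℕ}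
    (henv : AEMeasurable (S.env T N) P) :
    HasLaw (S.inputs T N) (inputLaw N T μ μ₀ σ2 σ2t σ2e) P
      ∧ IndepFun (S.inputs T N) (S.env T N) P := by
  set κ := P.map (S.env T N)
  have hκp : IsProbabilityMeasure κ := Measure.isProbabilityMeasure_map henv
  have hκ : HasLaw (S.env T N) κ P := ⟨henv, rfl⟩
  have lA : HasLaw (fun ω (e : Fin N × Fin N) => S.A N ω e.1 e.2) _ P :=
    (hg.A_indep N).hasLaw_pi fun e => hg.A_law N e.1 e.2
  have lB : HasLaw (fun ω (e : Fin T × Fin N × Fin N) => S.B N e.1 ω e.2.1 e.2.2) _ P :=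
    (hg.B_indep N).hasLaw_pi fun e => hg.B_law N e.1 e.1.2 e.2.1 e.2.2
  have le : HasLaw (fun ω (e : Fin T × Fin N) => S.noise N e.1 ω e.2) _ P :=
    (hg.noise_indep N).hasLaw_pi fun e => hg.noise_law N e.1 e.1.2 e.2
  have ie : IndepFun (fun ω (e : Fin T × Fin N) => S.noise N e.1 ω e.2) (S.env T N) P :=
    (hi.noise_indep N).comp (φ := fun (f : Fin T → Fin N → ℝ) (e : Fin T × Fin N) => f e.1 e.2)
      (ψ := id) (by fun_prop) measurable_id
  -- The joint law is assembled from the innermost block outwards: noise, then B, then A. Each is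
  -- independent of everything collected so far.
  have l1 := (indepFun_iff_hasLaw_prodMk_prod le hκ).1 ie
  have iB : IndepFun (fun ω (e : Fin T × Fin N × Fin N) => S.B N e.1 ω e.2.1 e.2.2)
      (fun ω => (fun (e : Fin T × Fin N) => S.noise N e.1 ω e.2, S.env T N ω)) P :=
    (hi.B_indep N).comp
      (φ := fun (f : Fin T → Fin N → Fin N → ℝ) (e : Fin T × Fin N × Fin N) => f e.1 e.2.1 e.2.2)
      (ψ := fun p : (Fin T → Fin N → ℝ) × Env N T M => (fun e : Fin T × Fin N => p.1 e.1 e.2, p.2))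
      (by fun_prop) (by fun_prop)
  have l2 := (indepFun_iff_hasLaw_prodMk_prod lB l1).1 iB
  have iA : IndepFun (fun ω (e : Fin N × Fin N) => S.A N ω e.1 e.2)
      (fun ω => (fun (e : Fin T × Fin N × Fin N) => S.B N e.1 ω e.2.1 e.2.2,
        (fun (e : Fin T × Fin N) => S.noise N e.1 ω e.2, S.env T N ω))) P :=
    (hi.A_indep N).comp
      (φ := fun (f : Fin N → Fin N → ℝ) (e : Fin N × Fin N) => f e.1 e.2)
      (ψ := fun p : (Fin T → Fin N → Fin N → ℝ) × (Fin T → Fin N → ℝ) × Env N T M =>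
        (fun e : Fin T × Fin N × Fin N => p.1 e.1 e.2.1 e.2.2,
          (fun e : Fin T × Fin N => p.2.1 e.1 e.2, p.2.2)))
      (by fun_prop) (by fun_prop)
  have l3 := (indepFun_iff_hasLaw_prodMk_prod lA l2).1 iA
  have m1 := ((MeasurePreserving.id
    (Measure.pi fun _ : Fin N × Fin N => gaussianReal (μ / N) (σ2 / N))).prod
    (measurePreserving_prodAssoc
      (Measure.pi fun e : Fin T × Fin N × Fin N => gaussianReal (μ₀ / N) (σ2t e.1 / N))
      (Measure.pi fun _ : Fin T × Fin N => gaussianReal 0 σ2e) κ).symm)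
  have m2 := (measurePreserving_prodAssoc
    (Measure.pi fun _ : Fin N × Fin N => gaussianReal (μ / N) (σ2 / N))
    ((Measure.pi fun e : Fin T × Fin N × Fin N => gaussianReal (μ₀ / N) (σ2t e.1 / N)).prod
      (Measure.pi fun _ : Fin T × Fin N => gaussianReal 0 σ2e)) κ).symm
  have l4 : HasLaw (fun ω => (S.inputs T N ω, S.env T N ω))
      ((inputLaw N T μ μ₀ σ2 σ2t σ2e).prod κ) P :=
    (m2.comp m1).comp_hasLaw l3
  have : IsProbabilityMeasure (inputLaw N T μ μ₀ σ2 σ2t σ2e) := by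
    unfold inputLaw; infer_instance
  have l5 : HasLaw (S.inputs T N) (inputLaw N T μ μ₀ σ2 σ2t σ2e) P :=
    measurePreserving_fst.comp_hasLaw l4
  exact ⟨l5, (indepFun_iff_hasLaw_prodMk_prod l5 hκ).2 l4⟩

/-- A treatment assignment, for every population size, that is a function of the assigned
treatments. -/
def IsAssignment (S : Systems Ω M) (T : ℕ) (V : (N : ℕ) → Ω → ℕ → Fin N → ℝ) : Prop :=
  ∀ N, ∃ D : (Fin T → Fin N → ℝ) → ℕ → Fin N → ℝ, (∀ t, Measurable fun w => D w t) ∧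
    ∀ ω, ∀ t < T, V N ω (t + 1) = D (fun t => S.W N ((t : ℕ) + 1) ω) t

/-- The messages sent at time `t` under the assignment `V`. -/
def sent (S : Systems Ω M) (N : ℕ) (ω : Ω) (V : ℕ → Fin N → ℝ) (t : ℕ) : Fin N → ℝ :=
  fun n => outcomeFun (S.coef N ω n) (S.X N ω n) (V (t + 1) n) (S.outcome N ω V t n)

/-- Almost surely, the fluctuations of all outcomes are eventually typical. -/
theorem ae_eventually_typical {S : Systems Ω M} {T : ℕ} {μ μ₀ : ℝ} {σ2 : ℝ≥0} {σ2t : ℕ → ℝ≥0}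
    {σ2e : ℝ≥0} (hg : GaussianModel S P T μ μ₀ σ2 σ2t σ2e) (hi : IndepBlocks S P T)
    (hW : ∀ N, ∀ t < T, ∀ n, AEMeasurable (fun ω => S.W N (t + 1) ω n) P)
    (hc : ∀ N n, AEMeasurable (fun ω => S.coef N ω n) P)
    {V : (N : ℕ) → Ω → ℕ → Fin N → ℝ} (hV : S.IsAssignment T V)
    {v : (N : ℕ) → Ω → Fin N → ℝ}
    (hv : ∀ N, ∃ f : Env N T M → Fin N → ℝ, Measurable f ∧ ∀ ω, v N ω = f (S.env T N ω))
    {s : ℕ} (hs : s < T) :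
    ∀ᵐ ω ∂P, ∀ᶠ N in atTop, Typical s
      ((σ2 + σ2t s) * popMean (fun n => S.sent N ω (V N ω) s n ^ 2) + σ2e) (v N ω)
      (fun n => S.outcome N ω (V N ω) (s + 1) n - (μ + μ₀) * popMean (S.sent N ω (V N ω) s)) := by
  have hgf := gaussFourth_nonneg
  have hgv := gaussFourthVar_nonneg
  have hall := ae_eventually_of_le_rpow (P := P) (s := fun N => {ω | ¬ Typical s
      ((σ2 + σ2t s) * popMean (fun n => S.sent N ω (V N ω) s n ^ 2) + σ2e) (v N ω)
      (fun n => S.outcome N ω (V N ω) (s + 1) n - (μ + μ₀) * popMean (S.sent N ω (V N ω) s))})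
    (C := (s + 1) * (3 * (gaussFourth + gaussFourthVar))) (by positivity) fun N hN => by
      obtain ⟨D, hDm, hD⟩ := hV N
      obtain ⟨f, hfm, hf⟩ := hv N
      have henv := aemeasurable_env hi hW hc N
      obtain ⟨l, ind⟩ := hasLaw_inputs hg hi henv
      have key := measure_not_typical_le hN l henv ind (measurable_message hDm)
        (y₀ := fun e : Env N T M => e.2.2.1) measurable_snd.snd.fst hfm hs
      have e1 : ∀ ω, drivenOutcome (message D (S.env T N ω)) (S.env T N ω).2.2.1
          (S.inputs T N ω) s = S.outcome N ω (V N ω) s := fun ω =>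
        (outcome_eq_drivenOutcome S ω (hD ω) hs.le).symm
      have e2 : ∀ ω, drivenOutcome (message D (S.env T N ω)) (S.env T N ω).2.2.1
          (S.inputs T N ω) (s + 1) = S.outcome N ω (V N ω) (s + 1) := fun ω =>
        (outcome_eq_drivenOutcome S ω (hD ω) hs).symm
      have e3 : ∀ ω, message D (S.env T N ω) s (S.outcome N ω (V N ω) s)
          = S.sent N ω (V N ω) s := by
        intro ω
        ext n
        simp only [sent, hD ω s hs]
        rfl
      simp_rw [e1, e2, e3, ← hf] at key
      exact key
  filter_upwards [hall] with ω hω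
  filter_upwards [hω] with N hN
  exact not_not.1 hN

end Systems

-- Population averages.

section PopMean

variable {N : ℕ}

theorem popMean_add (f g : Fin N → ℝ) : popMean (fun n => f n + g n) = popMean f + popMean g := by
  simp [popMean, Finset.sum_add_distrib, add_div]

theorem popMean_sub (f g : Fin N → ℝ) : popMean (fun n => f n - g n) = popMean f - popMean g := by
  simp [popMean, Finset.sum_sub_distrib, sub_div]

theorem popMean_const_mul (c : ℝ) (f : Fin N → ℝ) : popMean (fun n => c * f n) = c * popMean f := by
  simp [popMean, ← Finset.mul_sum, mul_div_assoc]

theorem popMean_const (hN : N ≠ 0) (c : ℝ) : popMean (fun _ : Fin N => c) = c := by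
  simp [popMean, hN]

theorem popMean_mono {f g : Fin N → ℝ} (h : ∀ n, f n ≤ g n) : popMean f ≤ popMean g :=
  div_le_div_of_nonneg_right (Finset.sum_le_sum fun n _ => h n) N.cast_nonneg

theorem popMean_nonneg {f : Fin N → ℝ} (h : ∀ n, 0 ≤ f n) : 0 ≤ popMean f :=
  div_nonneg (Finset.sum_nonneg fun n _ => h n) N.cast_nonneg

theorem abs_popMean_le {f g : Fin N → ℝ} (h : ∀ n, |f n| ≤ g n) : |popMean f| ≤ popMean g := by
  rw [abs_le]
  have h1 := popMean_mono fun n => (abs_le.1 (h n)).1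
  have h2 := popMean_mono fun n => (abs_le.1 (h n)).2
  have h3 : popMean (fun n => -g n) = -popMean g := by
    simp [popMean, Finset.sum_neg_distrib, neg_div]
  exact ⟨h3 ▸ h1, h2⟩

/-- Population averages with fluctuations of order `N^{-1/8}` vanish in the limit. -/
theorem tendsto_popMean_zero_of_pow_four_le {f : (N : ℕ) → Fin N → ℝ} {K : ℝ}
    (h : ∀ᶠ N : ℕ in atTop, (∑ n, f N n) ^ 4 ≤ K * ((N : ℝ) ^ (3 / 2 : ℝ) * (N : ℝ) ^ 2)) :
    Tendsto (fun N => popMean (f N)) atTop (𝓝 0) := by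
  have h1 : Tendsto (fun N : ℕ => K * (N : ℝ) ^ (-(1 / 2) : ℝ)) atTop (𝓝 0) := by
    have := (tendsto_rpow_neg_atTop (show (0 : ℝ) < 1 / 2 by norm_num)).comp
      tendsto_natCast_atTop_atTop
    simpa using this.const_mul K
  have h2 : Tendsto (fun N => popMean (f N) ^ 4) atTop (𝓝 0) := by
    refine tendsto_of_tendsto_of_tendsto_of_le_of_le' tendsto_const_nhds h1
      (Eventually.of_forall fun N => by positivity) ?_
    filter_upwards [h, eventually_gt_atTop 0] with N hN hpos
    have hN' : (0 : ℝ) < N := by exact_mod_cast hpos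
    rw [popMean, div_pow, div_le_iff₀ (by positivity)]
    refine hN.trans (le_of_eq ?_)
    rw [mul_assoc]
    congr 1
    rw [← Real.rpow_natCast, ← Real.rpow_natCast, ← Real.rpow_add hN', ← Real.rpow_add hN']
    norm_num
  have h3 := h2.sqrt.sqrt
  simp only [Real.sqrt_zero] at h3
  rw [tendsto_zero_iff_abs_tendsto_zero]
  refine h3.congr fun N => ?_
  rw [show popMean (f N) ^ 4 = (popMean (f N) ^ 2) ^ 2 by ring, Real.sqrt_sq (sq_nonneg _),
    Real.sqrt_sq_eq_abs]
  rfl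

end PopMean

-- From weak convergence to convergence of averages of unbounded functions.

section WeakConvergence

variable {E : Type*} [NormedAddCommGroup E] [MeasurableSpace E] [BorelSpace E]

theorem pow_four_le_one_add_rpow {x k : ℝ} (hx : 0 ≤ x) (hk : 4 ≤ k) : x ^ 4 ≤ 1 + x ^ k := by
  have h0 : 0 ≤ x ^ k := Real.rpow_nonneg hx k
  rcases le_total x 1 with h | h
  · have := pow_le_one₀ (n := 4) hx h
    linarith
  · have : x ^ (4 : ℝ) ≤ x ^ k := Real.rpow_le_rpow_of_exponent_le h hk
    rw [show (4 : ℝ) = ((4 : ℕ) : ℝ) by norm_num, Real.rpow_natCast] at this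
    linarith

/-- Weak convergence of empirical distributions together with a bounded empirical moment of order
`k ≥ 4` gives convergence of the averages of continuous functions of quadratic growth. -/
theorem tendsto_popMean_of_quadratic_growth {m : Measure E} [IsProbabilityMeasure m]
    {d : (N : ℕ) → Fin N → E}
    (hw : ∀ f : E →ᵇ ℝ, Tendsto (fun N => popMean fun n => f (d N n)) atTop (𝓝 (∫ x, f x ∂m)))
    {k : ℝ} (hk : 4 ≤ k) (hint : Integrable (fun x => ‖x‖ ^ k) m)
    {c : ℝ} (hc : ∀ᶠ N in atTop, popMean (fun n => ‖d N n‖ ^ k) ≤ c)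
    {f : E → ℝ} (hf : Continuous f) {C : ℝ} (hC : ∀ x, |f x| ≤ C * (1 + ‖x‖ ^ 2)) :
    Integrable f m ∧ Tendsto (fun N => popMean fun n => f (d N n)) atTop (𝓝 (∫ x, f x ∂m)) := by
  have hC0 : 0 ≤ C := by
    have := (abs_nonneg _).trans (hC 0)
    simpa using this
  -- Quadratic growth squares to quartic growth, which the moment of order k ≥ 4 dominates.
  have hsq : ∀ x, f x ^ 2 ≤ 2 * C ^ 2 * (2 + ‖x‖ ^ k) := by
    intro x
    have h1 := pow_four_le_one_add_rpow (norm_nonneg x) hk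
    calc f x ^ 2 = |f x| ^ 2 := (sq_abs _).symm
      _ ≤ (C * (1 + ‖x‖ ^ 2)) ^ 2 := by gcongr; exact hC x
      _ = C ^ 2 * (1 + ‖x‖ ^ 2) ^ 2 := by ring
      _ ≤ C ^ 2 * (2 * (2 + ‖x‖ ^ k)) := by
        gcongr
        nlinarith [sq_nonneg (1 - ‖x‖ ^ 2)]
      _ = _ := by ring
  set G : E → ℝ := fun x => 2 * C ^ 2 * (2 + ‖x‖ ^ k) with hG
  have hGint : Integrable G m := ((integrable_const _).add hint).const_mul _
  have hfint : Integrable f m := by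
    refine ((integrable_const (1 : ℝ)).add hGint).mono' hf.aestronglyMeasurable
      (ae_of_all _ fun x => ?_)
    have := hsq x
    simp only [Real.norm_eq_abs, Pi.add_apply, hG]
    nlinarith [sq_abs (f x), sq_nonneg (|f x| - 1)]
  refine ⟨hfint, ?_⟩
  set K : ℝ := max (∫ x, G x ∂m) (2 * C ^ 2 * (2 + c)) with hK
  -- Truncation at ±R makes an error of at most f²/R. The constant `K` controls the resulting error
  -- both for the limit law and for the empirical laws.
  have htrunc : ∀ R : ℝ, 0 < R → ∃ g : E →ᵇ ℝ, ∀ x, |f x - g x| ≤ G x / R := by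
    intro R hR
    refine ⟨BoundedContinuousFunction.ofNormedAddCommGroup (fun x => max (-R) (min R (f x)))
      (by fun_prop) R fun x => ?_, fun x => ?_⟩
    · rw [Real.norm_eq_abs, abs_le]
      exact ⟨le_max_left _ _, max_le (by linarith) (min_le_left _ _)⟩
    · simp only [BoundedContinuousFunction.coe_ofNormedAddCommGroup]
      rw [le_div_iff₀ hR]
      refine le_trans ?_ (hsq x)
      rcases le_total (f x) R with h1 | h1
      · rw [min_eq_right h1]
        rcases le_total (-R) (f x) with h2 | h2
        · rw [max_eq_right h2]; simp [sq_nonneg]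
        · rw [max_eq_left h2, abs_of_nonpos (by linarith)]
          nlinarith
      · rw [min_eq_left h1, max_eq_right (by linarith), abs_of_nonneg (by linarith)]
        nlinarith
  have hK0 : 0 ≤ K := by
    refine le_max_of_le_left (integral_nonneg fun x => ?_)
    have : 0 ≤ ‖x‖ ^ k := Real.rpow_nonneg (norm_nonneg x) k
    simp only [hG, Pi.zero_apply]
    positivity
  rw [Metric.tendsto_atTop']
  intro ε hε
  obtain ⟨R, hR, hKR⟩ : ∃ R : ℝ, 0 < R ∧ K / R < ε / 3 := by
    refine ⟨3 * (K + 1) / ε, by positivity, ?_⟩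
    rw [div_lt_iff₀ (by positivity)]
    have : ε / 3 * (3 * (K + 1) / ε) = K + 1 := by field_simp
    linarith
  obtain ⟨g, hg⟩ := htrunc R hR
  have h1 := (Metric.tendsto_atTop.1 (hw g)) (ε / 3) (by positivity)
  have h2 : |∫ x, f x ∂m - ∫ x, g x ∂m| ≤ K / R := by
    rw [← integral_sub hfint (g.integrable m)]
    refine (abs_integral_le_integral_abs).trans ?_
    refine (integral_mono (hfint.sub (g.integrable m)).abs (hGint.div_const R) hg).trans ?_
    rw [integral_div]
    exact div_le_div_of_nonneg_right (le_max_left _ _) hR.le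
  have h3 : ∀ᶠ N in atTop, |popMean (fun n => f (d N n)) - popMean (fun n => g (d N n))|
      ≤ K / R := by
    filter_upwards [hc, eventually_gt_atTop 0] with N hN hpos
    rw [← popMean_sub]
    refine (abs_popMean_le (g := fun n => G (d N n) / R) fun n => hg (d N n)).trans ?_
    have : popMean (fun n => G (d N n) / R)
        = 2 * C ^ 2 * (2 + popMean fun n => ‖d N n‖ ^ k) / R := by
      have e : ∀ n, G (d N n) / R = (2 * C ^ 2 / R) * (2 + ‖d N n‖ ^ k) := fun n => by
        simp only [hG]; ring
      simp_rw [e]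
      rw [popMean_const_mul, popMean_add, popMean_const hpos.ne']
      ring
    rw [this]
    refine div_le_div_of_nonneg_right (le_max_of_le_right ?_) hR.le
    gcongr
  obtain ⟨N₁, hN₁⟩ := h1
  obtain ⟨N₂, hN₂⟩ := eventually_atTop.1 h3
  refine ⟨max N₁ N₂, fun N hN => ?_⟩
  have a1 := hN₁ N (le_of_lt (lt_of_le_of_lt (le_max_left _ _) hN))
  have a2 := hN₂ N (le_of_lt (lt_of_le_of_lt (le_max_right _ _) hN))
  rw [Real.dist_eq] at a1 ⊢
  rw [abs_lt] at a1 ⊢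
  rw [abs_le] at a2 h2
  constructor <;> linarith [a1.1, a1.2, a2.1, a2.2, h2.1, h2.2]

end WeakConvergence

-- Bounds of the coefficients by the norm of the extended covariates.

section CoefBounds

variable {M : ℕ}

theorem Coef.abs_base_le (c : Coef M) (x : Fin M → ℝ) : |c.base| ≤ ‖(c, x)‖ :=
  (norm_fst_le c).trans (norm_fst_le (c, x))

theorem Coef.abs_carry_le (c : Coef M) (x : Fin M → ℝ) : |c.carry| ≤ ‖(c, x)‖ :=
  (norm_fst_le c.2).trans ((norm_snd_le c).trans (norm_fst_le (c, x)))

theorem Coef.abs_treat_le (c : Coef M) (x : Fin M → ℝ) : |c.treat| ≤ ‖(c, x)‖ :=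
  (norm_fst_le c.2.2).trans
    ((norm_snd_le c.2).trans ((norm_snd_le c).trans (norm_fst_le (c, x))))

theorem Coef.abs_inter_le (c : Coef M) (x : Fin M → ℝ) : |c.inter| ≤ ‖(c, x)‖ :=
  (norm_fst_le c.2.2.2).trans ((norm_snd_le c.2.2).trans
    ((norm_snd_le c.2).trans ((norm_snd_le c).trans (norm_fst_le (c, x)))))

theorem Coef.norm_covar_le (c : Coef M) (x : Fin M → ℝ) : ‖c.covar‖ ≤ ‖(c, x)‖ :=
  (norm_snd_le c.2.2.2).trans ((norm_snd_le c.2.2).trans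
    ((norm_snd_le c.2).trans ((norm_snd_le c).trans (norm_fst_le (c, x)))))

theorem Coef.abs_covar_dotProduct_le (c : Coef M) (x : Fin M → ℝ) :
    |c.covar ⬝ᵥ x| ≤ M * ‖(c, x)‖ ^ 2 := by
  unfold dotProduct
  refine (Finset.abs_sum_le_sum_abs _ _).trans ?_
  have : ∀ i ∈ Finset.univ, |c.covar i * x i| ≤ ‖(c, x)‖ ^ 2 := by
    intro i _
    rw [abs_mul, sq]
    exact mul_le_mul ((norm_le_pi_norm c.covar i).trans (c.norm_covar_le x))
      ((norm_le_pi_norm x i).trans (norm_snd_le (c, x))) (abs_nonneg _) (norm_nonneg _)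
  refine (Finset.sum_le_sum this).trans ?_
  simp

end CoefBounds

-- Consequences of typicality for averages.

section Fluctuations

/-- Fluctuations that are eventually typical, at a bounded variance scale, average out. -/
theorem tendsto_popMean_mul_of_typical {s : ℕ} {ρ : ℕ → ℝ} {v r : (N : ℕ) → Fin N → ℝ}
    (ht : ∀ᶠ N in atTop, Typical s (ρ N) (v N) (r N)) (hρ0 : ∀ N, 0 ≤ ρ N) {R c : ℝ}
    (hρ : ∀ᶠ N in atTop, ρ N ≤ R) (hv : ∀ᶠ N in atTop, popMean (fun n => v N n ^ 2) ≤ c) :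
    Tendsto (fun N => popMean fun n => v N n * r N n) atTop (𝓝 0) := by
  refine tendsto_popMean_zero_of_pow_four_le (K := (s + 1) ^ 4 * R ^ 2 * c ^ 2) ?_
  filter_upwards [ht, hρ, hv, eventually_gt_atTop 0] with N hN hR hc hpos
  have hN' : (0 : ℝ) < N := by exact_mod_cast hpos
  have h1 : ∑ n, v N n ^ 2 ≤ c * N := by rwa [popMean, div_le_iff₀ hN'] at hc
  have h2 : 0 ≤ ∑ n, v N n ^ 2 := Finset.sum_nonneg fun n _ => sq_nonneg _
  have h3 := hρ0 N
  calc _ ≤ _ := hN.1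
    _ ≤ (s + 1) ^ 4 * R ^ 2 * ((N : ℝ) ^ (3 / 2 : ℝ) * (c * N) ^ 2) := by gcongr
    _ = _ := by ring

theorem popMean_pow_four_le_of_typical {s : ℕ} {ρ : ℕ → ℝ} {v r : (N : ℕ) → Fin N → ℝ}
    (ht : ∀ᶠ N in atTop, Typical s (ρ N) (v N) (r N)) (hρ0 : ∀ N, 0 ≤ ρ N) {R : ℝ}
    (hρ : ∀ᶠ N in atTop, ρ N ≤ R) :
    ∀ᶠ N in atTop, popMean (fun n => r N n ^ 4) ≤ (s + 1) ^ 4 * R ^ 2 * (gaussFourth + 1) := by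
  filter_upwards [ht, hρ, eventually_gt_atTop 0] with N hN hR hpos
  have hN' : (0 : ℝ) < N := by exact_mod_cast hpos
  have h3 := hρ0 N
  have hgf := gaussFourth_nonneg
  rw [popMean, div_le_iff₀ hN']
  calc _ ≤ _ := hN.2
    _ ≤ (s + 1) ^ 4 * R ^ 2 * ((gaussFourth + 1) * N) := by gcongr
    _ = _ := by ring

end Fluctuations

-- State evolution on a fixed sample point.

/-- The deterministic recursion satisfied by the limits of the mean outcomes, when the fraction of
units treated at time `t + 1` is `w t`. -/
def limitMean (κ β ξ l g : ℝ) (w : ℕ → ℝ) (ν₀ : ℝ) : ℕ → ℝ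
  | 0 => ν₀
  | t + 1 => κ * (β + l * w t + (ξ + g * w t) * limitMean κ β ξ l g w ν₀ t)

namespace Systems

variable {Ω : Type*} {M : ℕ}

theorem sent_apply (S : Systems Ω M) (N : ℕ) (ω : Ω) (V : ℕ → Fin N → ℝ) (t : ℕ) (n : Fin N) :
    S.sent N ω V t n = ((S.coef N ω n).base + (S.coef N ω n).covar ⬝ᵥ S.X N ω n)
      + (S.coef N ω n).treat * V (t + 1) n
      + ((S.coef N ω n).carry + (S.coef N ω n).inter * V (t + 1) n) * S.outcome N ω V t n := by
  rw [sent, outcomeFun]; ring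

/-- Weight of the current outcome in the message of a unit. -/
def gain (S : Systems Ω M) (N : ℕ) (ω : Ω) (V : ℕ → Fin N → ℝ) (t : ℕ) (n : Fin N) : ℝ :=
  (S.coef N ω n).carry + (S.coef N ω n).inter * V (t + 1) n

theorem abs_gain_le (S : Systems Ω M) {N : ℕ} {ω : Ω} {V : ℕ → Fin N → ℝ} {t : ℕ} {n : Fin N}
    (hV : |V (t + 1) n| ≤ 1) :
    |S.gain N ω V t n| ≤ 2 * ‖(S.coef N ω n, S.X N ω n)‖ := by
  have h1 := (S.coef N ω n).abs_carry_le (S.X N ω n)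
  have h2 := (S.coef N ω n).abs_inter_le (S.X N ω n)
  refine (abs_add_le _ _).trans ?_
  rw [abs_mul]
  nlinarith [abs_nonneg ((S.coef N ω n).inter)]

theorem gain_sq_le (S : Systems Ω M) {N : ℕ} {ω : Ω} {V : ℕ → Fin N → ℝ} {t : ℕ} {n : Fin N}
    (hV : |V (t + 1) n| ≤ 1) :
    S.gain N ω V t n ^ 2 ≤ 4 * ‖(S.coef N ω n, S.X N ω n)‖ ^ 2 := by
  rw [← sq_abs]
  calc |S.gain N ω V t n| ^ 2 ≤ (2 * ‖(S.coef N ω n, S.X N ω n)‖) ^ 2 := by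
        gcongr; exact S.abs_gain_le hV
    _ = _ := by ring

/-- The products gain · outcome and Θᵀx are split by the inequality of arithmetic and geometric
means into fourth powers. The center `m` is free, to be chosen as the common mean of the outcomes,
so that only the fourth moment of the fluctuation remains. -/
theorem sent_sq_le (S : Systems Ω M) {N : ℕ} {ω : Ω} {V : ℕ → Fin N → ℝ} {t : ℕ} {n : Fin N}
    (hV : |V (t + 1) n| ≤ 1) (m : ℝ) :
    S.sent N ω V t n ^ 2 ≤ 9 + (15 + 6 * M ^ 2) * ‖(S.coef N ω n, S.X N ω n)‖ ^ 4
      + 48 * ((S.outcome N ω V t n - m) ^ 4 + m ^ 4) := by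
  set d := ‖(S.coef N ω n, S.X N ω n)‖ with hd
  set y := S.outcome N ω V t n
  set b := (S.coef N ω n).base
  set q := (S.coef N ω n).covar ⬝ᵥ S.X N ω n
  set l := (S.coef N ω n).treat * V (t + 1) n
  have e : S.sent N ω V t n = (b + q) + l + S.gain N ω V t n * y := S.sent_apply N ω V t n
  have h1 : b ^ 2 ≤ d ^ 2 := by
    rw [← sq_abs]; gcongr; exact (S.coef N ω n).abs_base_le (S.X N ω n)
  have h2 : q ^ 2 ≤ M ^ 2 * d ^ 4 := by
    rw [← sq_abs]
    calc |q| ^ 2 ≤ (M * d ^ 2) ^ 2 := by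
          gcongr; exact (S.coef N ω n).abs_covar_dotProduct_le (S.X N ω n)
      _ = _ := by ring
  have h3 : l ^ 2 ≤ d ^ 2 := by
    rw [← sq_abs]
    gcongr
    rw [abs_mul]
    exact (mul_le_of_le_one_right (abs_nonneg _) hV).trans
      ((S.coef N ω n).abs_treat_le (S.X N ω n))
  have h4 := S.gain_sq_le (ω := ω) hV
  rw [← hd] at h4
  have h5 : (S.gain N ω V t n * y) ^ 2 ≤ 2 * d ^ 4 + 2 * y ^ 4 := by
    rw [mul_pow]
    nlinarith [mul_le_mul_of_nonneg_right h4 (sq_nonneg y), sq_nonneg (d ^ 2 - y ^ 2)]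
  have h6 : y ^ 4 ≤ 8 * ((y - m) ^ 4 + m ^ 4) := by
    have a1 : y ^ 2 ≤ 2 * ((y - m) ^ 2 + m ^ 2) := by nlinarith [sq_nonneg (y - 2 * m)]
    have a2 : y ^ 4 ≤ (2 * ((y - m) ^ 2 + m ^ 2)) ^ 2 := by
      calc y ^ 4 = (y ^ 2) ^ 2 := by ring
        _ ≤ _ := by gcongr
    nlinarith [sq_nonneg ((y - m) ^ 2 - m ^ 2)]
  have h7 : d ^ 2 ≤ 1 + d ^ 4 := by nlinarith [sq_nonneg (d ^ 2 - 1), sq_nonneg (d ^ 2)]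
  rw [e]
  have h8 : ((b + q) + l + S.gain N ω V t n * y) ^ 2
      ≤ 3 * (2 * b ^ 2 + 2 * q ^ 2 + l ^ 2 + (S.gain N ω V t n * y) ^ 2) := by
    set z := S.gain N ω V t n * y
    nlinarith [sq_nonneg (b - q), sq_nonneg (b + q - l), sq_nonneg (b + q - z), sq_nonneg (l - z)]
  linarith

theorem exists_popMean_sq_norm_le {S : Systems Ω M} {ω : Ω} {c : ℝ}
    (h4 : ∀ᶠ N in atTop, popMean (fun n => ‖(S.coef N ω n, S.X N ω n)‖ ^ 4) ≤ c) :
    ∀ᶠ N in atTop, popMean (fun n => ‖(S.coef N ω n, S.X N ω n)‖ ^ 2) ≤ 1 + c := by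
  filter_upwards [h4, eventually_gt_atTop 0] with N hN hpos
  calc _ ≤ popMean (fun n => 1 + ‖(S.coef N ω n, S.X N ω n)‖ ^ 4) := popMean_mono fun n => by
        set d := ‖(S.coef N ω n, S.X N ω n)‖
        nlinarith [sq_nonneg (d ^ 2 - 1), sq_nonneg (d ^ 2)]
    _ = 1 + popMean (fun n => ‖(S.coef N ω n, S.X N ω n)‖ ^ 4) := by
        rw [popMean_add, popMean_const hpos.ne']
    _ ≤ _ := by gcongr

/-- State evolution: on a sample point with convergent averages of the environment and typical
fluctuations, the mean outcomes converge to the solution of the limiting recursion. -/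
theorem tendsto_popMean_outcome {S : Systems Ω M} {ω : Ω} {V : (N : ℕ) → ℕ → Fin N → ℝ} {T : ℕ}
    {κ σ β ξ l g ν₀ c : ℝ} {σt w : ℕ → ℝ} {σe : ℝ} (hσ : 0 ≤ σ) (hσt : ∀ t, 0 ≤ σt t) (hσe : 0 ≤ σe)
    (hV : ∀ N, ∀ t < T, ∀ n, |V N (t + 1) n| ≤ 1)
    (h4 : ∀ᶠ N in atTop, popMean (fun n => ‖(S.coef N ω n, S.X N ω n)‖ ^ 4) ≤ c)
    (hb : Tendsto (fun N => popMean fun n =>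
      (S.coef N ω n).base + (S.coef N ω n).covar ⬝ᵥ S.X N ω n) atTop (𝓝 β))
    (hc : Tendsto (fun N => popMean fun n => (S.coef N ω n).carry) atTop (𝓝 ξ))
    (hl : ∀ t < T, Tendsto (fun N => popMean fun n =>
      (S.coef N ω n).treat * V N (t + 1) n) atTop (𝓝 (l * w t)))
    (hg : ∀ t < T, Tendsto (fun N => popMean fun n =>
      (S.coef N ω n).inter * V N (t + 1) n) atTop (𝓝 (g * w t)))
    (h0 : Tendsto (fun N => popMean (S.Y₀ N ω)) atTop (𝓝 ν₀))
    (h0g : 0 < T → Tendsto (fun N => popMean fun n => S.gain N ω (V N) 0 n * S.Y₀ N ω n) atTop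
      (𝓝 ((ξ + g * w 0) * ν₀)))
    (h0s : 0 < T → ∃ c, ∀ᶠ N in atTop, popMean (fun n => S.sent N ω (V N) 0 n ^ 2) ≤ c)
    (ht : ∀ s < T, ∀ᶠ N in atTop, Typical s
      ((σ + σt s) * popMean (fun n => S.sent N ω (V N) s n ^ 2) + σe) (fun _ => 1)
      (fun n => S.outcome N ω (V N) (s + 1) n - κ * popMean (S.sent N ω (V N) s)))
    (htg : ∀ s, s + 1 < T → ∀ᶠ N in atTop, Typical s
      ((σ + σt s) * popMean (fun n => S.sent N ω (V N) s n ^ 2) + σe) (S.gain N ω (V N) (s + 1))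
      (fun n => S.outcome N ω (V N) (s + 1) n - κ * popMean (S.sent N ω (V N) s)))
    {t : ℕ} (htT : t ≤ T) :
    Tendsto (fun N => popMean (S.outcome N ω (V N) t)) atTop
      (𝓝 (limitMean κ β ξ l g w ν₀ t)) := by
  set ν := limitMean κ β ξ l g w ν₀ with hν
  have hsq := exists_popMean_sq_norm_le h4
  have hgain : ∀ t < T, Tendsto (fun N => popMean (S.gain N ω (V N) t)) atTop
      (𝓝 (ξ + g * w t)) := fun t htT => by
    refine (hc.add (hg t htT)).congr fun N => ?_
    rw [← popMean_add]; rfl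
  have hgain2 : ∀ t < T, ∀ᶠ N in atTop, popMean (fun n => S.gain N ω (V N) t n ^ 2)
      ≤ 4 * (1 + c) := fun t htT => by
    filter_upwards [hsq] with N hN
    refine (popMean_mono fun n => S.gain_sq_le (hV N t htT n)).trans ?_
    rw [popMean_const_mul]
    gcongr
  have hsent : ∀ t < T, Tendsto (fun N => popMean fun n =>
        S.gain N ω (V N) t n * S.outcome N ω (V N) t n) atTop (𝓝 ((ξ + g * w t) * ν t)) →
      Tendsto (fun N => popMean (S.sent N ω (V N) t)) atTop
        (𝓝 (β + l * w t + (ξ + g * w t) * ν t)) := by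
    intro t htT h
    refine ((hb.add (hl t htT)).add h).congr fun N => ?_
    rw [← popMean_add, ← popMean_add]
    congr 1
    ext n
    rw [sent_apply]; rfl
  have hstep : ∀ t < T, (∃ c', ∀ᶠ N in atTop, popMean (fun n => S.sent N ω (V N) t n ^ 2) ≤ c') →
      Tendsto (fun N => popMean (S.sent N ω (V N) t)) atTop
        (𝓝 (β + l * w t + (ξ + g * w t) * ν t)) →
      ∃ R, (∀ᶠ N in atTop,
        (σ + σt t) * popMean (fun n => S.sent N ω (V N) t n ^ 2) + σe ≤ R) := by
    rintro t htT ⟨c', hc'⟩ _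
    refine ⟨(σ + σt t) * c' + σe, ?_⟩
    filter_upwards [hc'] with N hN
    have := hσt t
    gcongr
  have hρ0 : ∀ t N, 0 ≤ (σ + σt t) * popMean (fun n => S.sent N ω (V N) t n ^ 2) + σe := by
    intro t N
    have h1 := hσt t
    have h2 : 0 ≤ popMean (fun n => S.sent N ω (V N) t n ^ 2) := popMean_nonneg fun n => sq_nonneg _
    positivity
  -- The factorization step: outcome = κ · mean message + fluctuation, and the fluctuation averages
  -- to zero against `v`. It is used with `v` the next gain, to propagate the recursion, and with `v
  -- = 1`, to read off the mean.
  have hmul : ∀ t < T, ∀ (v : (N : ℕ) → Fin N → ℝ) (a c' : ℝ),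
      (∃ c', ∀ᶠ N in atTop, popMean (fun n => S.sent N ω (V N) t n ^ 2) ≤ c') →
      Tendsto (fun N => popMean (S.sent N ω (V N) t)) atTop
        (𝓝 (β + l * w t + (ξ + g * w t) * ν t)) →
      (∀ᶠ N in atTop, Typical t
        ((σ + σt t) * popMean (fun n => S.sent N ω (V N) t n ^ 2) + σe) (v N)
        (fun n => S.outcome N ω (V N) (t + 1) n - κ * popMean (S.sent N ω (V N) t))) →
      Tendsto (fun N => popMean (v N)) atTop (𝓝 a) →
      (∀ᶠ N in atTop, popMean (fun n => v N n ^ 2) ≤ c') →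
      Tendsto (fun N => popMean fun n => v N n * S.outcome N ω (V N) (t + 1) n) atTop
        (𝓝 (a * ν (t + 1))) := by
    intro t htT v a c' hs2 hs hty hva hv2
    obtain ⟨R, hR⟩ := hstep t htT hs2 hs
    have h1 := tendsto_popMean_mul_of_typical hty (hρ0 t) hR hv2
    have h2 := h1.add ((hs.const_mul κ).mul hva)
    have h3 : 0 + κ * (β + l * w t + (ξ + g * w t) * ν t) * a = a * ν (t + 1) := by
      rw [zero_add, mul_comm, hν, limitMean]
    rw [h3] at h2
    refine h2.congr fun N => ?_
    rw [← popMean_const_mul (κ * popMean (S.sent N ω (V N) t)) (v N), ← popMean_add]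
    congr 1
    ext n
    ring
  -- The invariant concerns messages rather than outcomes: their mean converges, and their second
  -- moment, which sets the next variance scale, stays bounded.
  have hmain : ∀ t < T, (∃ c', ∀ᶠ N in atTop, popMean (fun n => S.sent N ω (V N) t n ^ 2) ≤ c') ∧
      Tendsto (fun N => popMean (S.sent N ω (V N) t)) atTop
        (𝓝 (β + l * w t + (ξ + g * w t) * ν t)) := by
    intro t
    induction t with
    | zero => exact fun hT => ⟨h0s hT, hsent 0 hT (h0g hT)⟩
    | succ t ih =>
      intro hT
      have htT : t < T := by omega
      obtain ⟨ih2, ih1⟩ := ih htT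
      refine ⟨?_, hsent _ hT (hmul t htT _ _ _ ih2 ih1 (htg t hT) (hgain _ hT) (hgain2 _ hT))⟩
      obtain ⟨R, hR⟩ := hstep t htT ih2 ih1
      have hr := popMean_pow_four_le_of_typical (ht t htT) (hρ0 t) hR
      have hm := ((ih1.const_mul κ).pow 4).eventually_le_const (lt_add_one _)
      refine ⟨9 + (15 + 6 * (M : ℝ) ^ 2) * c + 48 * ((t + 1) ^ 4 * R ^ 2 * (gaussFourth + 1)
        + ((κ * (β + l * w t + (ξ + g * w t) * ν t)) ^ 4 + 1)), ?_⟩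
      filter_upwards [hr, hm, h4, eventually_gt_atTop 0] with N hN hmN h4N hpos
      refine (popMean_mono fun n => S.sent_sq_le (hV N (t + 1) hT n)
        (κ * popMean (S.sent N ω (V N) t))).trans ?_
      rw [popMean_add, popMean_add, popMean_const hpos.ne', popMean_const_mul, popMean_const_mul,
        popMean_add, popMean_const hpos.ne']
      gcongr
  rcases t with _ | t
  · exact h0
  · obtain ⟨h2, h1⟩ := hmain t htT
    have := hmul t htT (fun _ _ => 1) 1 1 h2 h1 (ht t htT) ?_ ?_
    · simpa using this
    · refine tendsto_const_nhds.congr' ?_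
      filter_upwards [eventually_gt_atTop 0] with N hpos
      rw [popMean_const hpos.ne']
    · filter_upwards [eventually_gt_atTop 0] with N hpos
      simp [popMean_const hpos.ne']

end Systems

-- Exactness and continuity of least squares.

section LeastSquares

theorem sum_sq_sub_mean_ne_zero {m : ℕ} {x : ℕ → ℝ} {i j : ℕ} (hi : i < m) (hj : j < m)
    (hij : x i ≠ x j) :
    ∑ k ∈ Finset.range m, (x k - (∑ r ∈ Finset.range m, x r) / m) ^ 2 ≠ 0 := by
  intro h
  rw [Finset.sum_eq_zero_iff_of_nonneg fun k _ => sq_nonneg _] at h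
  have h1 := h i (Finset.mem_range.2 hi)
  have h2 := h j (Finset.mem_range.2 hj)
  rw [sq_eq_zero_iff, sub_eq_zero] at h1 h2
  exact hij (h1.trans h2.symm)

/-- Centering removes the intercept, so the numerator of the slope is exactly b times the
denominator. -/
theorem olsSlope_of_affine {m : ℕ} {x y : ℕ → ℝ} {a b : ℝ} (h : ∀ i < m, y i = b * x i + a)
    (hx : ∑ k ∈ Finset.range m, (x k - (∑ r ∈ Finset.range m, x r) / m) ^ 2 ≠ 0) :
    olsSlope m x y = b ∧ olsIntercept m x y = a := by
  have hm : (m : ℝ) ≠ 0 := by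
    rintro h0
    rw [Nat.cast_eq_zero] at h0
    subst h0
    simp at hx
  have hy : (∑ j ∈ Finset.range m, y j) / m = b * ((∑ j ∈ Finset.range m, x j) / m) + a := by
    rw [Finset.sum_congr rfl fun j hj => h j (Finset.mem_range.1 hj), Finset.sum_add_distrib,
      ← Finset.mul_sum]
    simp
    field_simp
  have hs : olsSlope m x y = b := by
    rw [olsSlope, div_eq_iff hx, Finset.mul_sum, hy]
    refine Finset.sum_congr rfl fun i hi => ?_
    rw [h i (Finset.mem_range.1 hi)]
    ring
  refine ⟨hs, ?_⟩
  rw [olsIntercept, hs, hy]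
  ring

theorem tendsto_olsSlope {m : ℕ} {x y : ℕ → ℕ → ℝ} {x' y' : ℕ → ℝ}
    (hx : ∀ i < m, Tendsto (fun N => x N i) atTop (𝓝 (x' i)))
    (hy : ∀ i < m, Tendsto (fun N => y N i) atTop (𝓝 (y' i)))
    (h0 : ∑ k ∈ Finset.range m, (x' k - (∑ r ∈ Finset.range m, x' r) / m) ^ 2 ≠ 0) :
    Tendsto (fun N => olsSlope m (x N) (y N)) atTop (𝓝 (olsSlope m x' y')) ∧
      Tendsto (fun N => olsIntercept m (x N) (y N)) atTop (𝓝 (olsIntercept m x' y')) := by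
  have hxm : Tendsto (fun N => (∑ j ∈ Finset.range m, x N j) / (m : ℝ)) atTop
      (𝓝 ((∑ j ∈ Finset.range m, x' j) / m)) :=
    (tendsto_finsetSum _ fun i hi => hx i (Finset.mem_range.1 hi)).div_const _
  have hym : Tendsto (fun N => (∑ j ∈ Finset.range m, y N j) / (m : ℝ)) atTop
      (𝓝 ((∑ j ∈ Finset.range m, y' j) / m)) :=
    (tendsto_finsetSum _ fun i hi => hy i (Finset.mem_range.1 hi)).div_const _
  have hs : Tendsto (fun N => olsSlope m (x N) (y N)) atTop (𝓝 (olsSlope m x' y')) := by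
    unfold olsSlope
    refine Tendsto.div (tendsto_finsetSum _ fun i hi => ?_) (tendsto_finsetSum _ fun i hi => ?_) h0
    · exact ((hx i (Finset.mem_range.1 hi)).sub hxm).mul ((hy i (Finset.mem_range.1 hi)).sub hym)
    · exact ((hx i (Finset.mem_range.1 hi)).sub hxm).pow 2
  exact ⟨hs, hym.sub (hs.mul hxm)⟩

end LeastSquares

-- Consistency of the estimator, given convergence of the observed means.

namespace TTEAlg

/-- The estimator is consistent as soon as the observed means converge to a solution of the limiting
recursion that is not constant over either of the two stages. -/
theorem tendsto_tteHat {T₁ T₂ : ℕ} {π₁ π₂ : ℝ} (hπ : π₁ ≠ π₂) {κ β ξ l g ν₀ : ℝ} {h : ℕ → ℕ → ℝ}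
    {ν : ℕ → ℝ} (hν : ν = limitMean κ β ξ l g (fun t => if t < T₁ then π₁ else π₂) ν₀)
    (hlim : ∀ t ≤ T₁ + T₂, Tendsto (fun N => h N t) atTop (𝓝 (ν t)))
    {i₁ j₁ i₂ j₂ : ℕ} (hi₁ : i₁ < T₁) (hj₁ : j₁ < T₁) (h₁ : ν i₁ ≠ ν j₁) (hi₂ : i₂ < T₂)
    (hj₂ : j₂ < T₂) (h₂ : ν (T₁ + i₂) ≠ ν (T₁ + j₂)) {t : ℕ} (ht : t ≤ T₁ + T₂) :
    Tendsto (fun N => tteHat T₁ T₂ π₁ π₂ (h N) t) atTop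
      (𝓝 (limitMean κ β ξ l g (fun _ => 1) ν₀ t - limitMean κ β ξ l g (fun _ => 0) ν₀ t)) := by
  have hrec₁ : ∀ i < T₁, ν (i + 1) = κ * (ξ + g * π₁) * ν i + κ * (β + l * π₁) := by
    intro i hi
    rw [hν, limitMean, if_pos hi]; ring
  have hrec₂ : ∀ i < T₂, ν (T₁ + i + 1) = κ * (ξ + g * π₂) * ν (T₁ + i) + κ * (β + l * π₂) := by
    intro i _
    rw [hν, limitMean, if_neg (by omega)]; ring
  have d₁ := sum_sq_sub_mean_ne_zero hi₁ hj₁ h₁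
  have d₂ := sum_sq_sub_mean_ne_zero (x := fun i => ν (T₁ + i)) hi₂ hj₂ h₂
  obtain ⟨s₁, c₁⟩ := olsSlope_of_affine hrec₁ d₁
  obtain ⟨s₂, c₂⟩ := olsSlope_of_affine hrec₂ d₂
  obtain ⟨lb₁, la₁⟩ := tendsto_olsSlope (x := h) (y := fun N i => h N (i + 1)) (x' := ν)
    (y' := fun i => ν (i + 1)) (fun i hi => hlim i (by omega)) (fun i hi => hlim _ (by omega)) d₁
  obtain ⟨lb₂, la₂⟩ := tendsto_olsSlope (x := fun N i => h N (T₁ + i))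
    (y := fun N i => h N (T₁ + i + 1)) (x' := fun i => ν (T₁ + i))
    (y' := fun i => ν (T₁ + i + 1)) (fun i hi => hlim _ (by omega))
    (fun i hi => hlim _ (by omega)) d₂
  rw [s₁] at lb₁
  rw [s₂] at lb₂
  rw [c₁] at la₁
  rw [c₂] at la₂
  have hd : π₂ - π₁ ≠ 0 := sub_ne_zero.2 hπ.symm
  -- The coefficient means are identified only up to the common factor κ, which is all that the
  -- recursions use.
  have lg : Tendsto (fun N => gammaHat T₁ T₂ π₁ π₂ (h N)) atTop (𝓝 (κ * g)) := by
    have := (lb₂.sub lb₁).div_const (π₂ - π₁)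
    rwa [show (κ * (ξ + g * π₂) - κ * (ξ + g * π₁)) / (π₂ - π₁) = κ * g by
      field_simp; ring] at this
  have ll : Tendsto (fun N => lambdaHat T₁ T₂ π₁ π₂ (h N)) atTop (𝓝 (κ * l)) := by
    have := (la₂.sub la₁).div_const (π₂ - π₁)
    rwa [show (κ * (β + l * π₂) - κ * (β + l * π₁)) / (π₂ - π₁) = κ * l by
      field_simp; ring] at this
  have lx : Tendsto (fun N => xiHat T₁ T₂ π₁ π₂ (h N)) atTop (𝓝 (κ * ξ)) := by
    have := ((lb₂.add lb₁).sub
      (((lb₂.sub lb₁).mul_const (π₂ + π₁)).div_const (π₂ - π₁))).const_mul (1 / 2)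
    rwa [show 1 / 2 * (κ * (ξ + g * π₂) + κ * (ξ + g * π₁)
      - (κ * (ξ + g * π₂) - κ * (ξ + g * π₁)) * (π₂ + π₁) / (π₂ - π₁)) = κ * ξ by
      field_simp; ring] at this
  -- Subtracting the observed recursion from the treated one eliminates κβ. What is left is the
  -- correction that `treatedMean` adds to the observed mean.
  have lt : ∀ t ≤ T₁ + T₂, Tendsto (fun N => treatedMean T₁ T₂ π₁ π₂ (h N) t) atTop
      (𝓝 (limitMean κ β ξ l g (fun _ => 1) ν₀ t)) := by
    intro t
    induction t with
    | zero =>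
      intro _
      have := hlim 0 (Nat.zero_le _)
      rw [hν] at this
      exact this
    | succ t ih =>
      intro ht
      have ih := ih (by omega)
      have k1 := hlim t (by omega)
      have k2 := hlim (t + 1) ht
      by_cases htT : t < T₁
      · simp only [treatedMean, htT, if_true]
        have := ((k2.add (lx.mul (ih.sub k1))).add (ll.mul_const (1 - π₁))).add
          (lg.mul (ih.sub (k1.const_mul π₁)))
        convert this using 2
        rw [hrec₁ t htT, limitMean]
        ring
      · simp only [treatedMean, htT, if_false]
        have := ((k2.add (lx.mul (ih.sub k1))).add (ll.mul_const (1 - π₂))).add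
          (lg.mul (ih.sub (k1.const_mul π₂)))
        convert this using 2
        obtain ⟨i, rfl⟩ := Nat.exists_eq_add_of_le (not_lt.1 htT)
        rw [hrec₂ i (by omega), limitMean]
        ring
  induction t with
  | zero => simp [tteHat, limitMean]
  | succ t ih =>
    have := ((lx.mul (ih (by omega))).add ll).add (lg.mul (lt t (by omega)))
    simp only [tteHat]
    convert this using 2
    rw [limitMean, limitMean]
    ring

end TTEAlg

-- Averages over coefficients, treatments and initial outcomes.

theorem tendsto_popMean_mul_of_pow_four_le {a ξ : (N : ℕ) → Fin N → ℝ} {c : ℝ}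
    (h : ∀ᶠ N : ℕ in atTop,
      (∑ n, a N n * ξ N n) ^ 4 ≤ (N : ℝ) ^ (3 / 2 : ℝ) * (∑ n, a N n ^ 2) ^ 2)
    (hc : ∀ᶠ N in atTop, popMean (fun n => a N n ^ 2) ≤ c) :
    Tendsto (fun N => popMean fun n => a N n * ξ N n) atTop (𝓝 0) := by
  refine tendsto_popMean_zero_of_pow_four_le (K := c ^ 2) ?_
  filter_upwards [h, hc, eventually_gt_atTop 0] with N hN hc hpos
  have hN' : (0 : ℝ) < N := by exact_mod_cast hpos
  have h1 : ∑ n, a N n ^ 2 ≤ c * N := by rwa [popMean, div_le_iff₀ hN'] at hc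
  have h2 : 0 ≤ ∑ n, a N n ^ 2 := Finset.sum_nonneg fun n _ => sq_nonneg _
  calc _ ≤ _ := hN
    _ ≤ (N : ℝ) ^ (3 / 2 : ℝ) * (c * N) ^ 2 := by gcongr
    _ = _ := by ring

namespace Coef

variable {M : ℕ}

theorem continuous_base : Continuous (base : Coef M → ℝ) := by unfold base; fun_prop

theorem continuous_carry : Continuous (carry : Coef M → ℝ) := by unfold carry; fun_prop

theorem continuous_treat : Continuous (treat : Coef M → ℝ) := by unfold treat; fun_prop

theorem continuous_inter : Continuous (inter : Coef M → ℝ) := by unfold inter; fun_prop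

theorem continuous_covar : Continuous (covar : Coef M → Fin M → ℝ) := by unfold covar; fun_prop

end Coef

namespace Systems

variable {Ω : Type*} {M : ℕ} [MeasurableSpace Ω] {P : Measure Ω} [IsProbabilityMeasure P]
  {S : Systems Ω M}

theorem ae_eventually_popMean_norm_pow_le {q : Measure (Coef M)} {p : Measure (Fin M → ℝ)} {k : ℝ}
    (hk : 4 ≤ k) (hcov : ExtendedCovariates S P q p k) :
    ∀ᵐ ω ∂P, ∃ c, (∀ᶠ N in atTop, popMean (fun n => ‖(S.coef N ω n, S.X N ω n)‖ ^ k) ≤ c) ∧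
      ∀ᶠ N in atTop, popMean (fun n => ‖(S.coef N ω n, S.X N ω n)‖ ^ 4) ≤ c := by
  filter_upwards [hcov.moment_tendsto] with ω hω
  have h := hω.eventually_le_const (lt_add_one _)
  refine ⟨1 + (∫ d, ‖d‖ ^ k ∂(q.prod p) + 1), ?_, ?_⟩
  · filter_upwards [h] with N hN
    linarith
  · filter_upwards [h, eventually_gt_atTop 0] with N hN hpos
    refine (popMean_mono fun n => pow_four_le_one_add_rpow (norm_nonneg _) hk).trans ?_
    rw [popMean_add, popMean_const hpos.ne']
    gcongr

/-- Averages of continuous functions of quadratic growth of the extended covariates converge. -/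
theorem ae_tendsto_popMean {q : Measure (Coef M)} [IsProbabilityMeasure q]
    {p : Measure (Fin M → ℝ)} [IsProbabilityMeasure p] {k : ℝ} (hk : 4 ≤ k)
    (hcov : ExtendedCovariates S P q p k) {f : Coef M × (Fin M → ℝ) → ℝ} (hf : Continuous f) {C : ℝ}
    (hC : ∀ d, |f d| ≤ C * (1 + ‖d‖ ^ 2)) :
    ∀ᵐ ω ∂P, Tendsto (fun N => popMean fun n => f (S.coef N ω n, S.X N ω n)) atTop
      (𝓝 (∫ d, f d ∂(q.prod p))) := by
  filter_upwards [hcov.weak, ae_eventually_popMean_norm_pow_le hk hcov] with ω h1 ⟨c, h2, _⟩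
  exact (tendsto_popMean_of_quadratic_growth h1 hk hcov.moment h2 hf hC).2

theorem ae_tendsto_popMean_coef {q : Measure (Coef M)} [IsProbabilityMeasure q]
    {p : Measure (Fin M → ℝ)} [IsProbabilityMeasure p] {k : ℝ} (hk : 4 ≤ k)
    (hcov : ExtendedCovariates S P q p k) {f : Coef M → ℝ} (hf : Continuous f)
    (hfd : ∀ c (x : Fin M → ℝ), |f c| ≤ ‖(c, x)‖) :
    ∀ᵐ ω ∂P, Tendsto (fun N => popMean fun n => f (S.coef N ω n)) atTop (𝓝 (∫ c, f c ∂q)) := by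
  have h := ae_tendsto_popMean hk hcov (f := fun d => f d.1) (hf.comp continuous_fst) (C := 1)
    fun d => by
      have := hfd d.1 d.2
      nlinarith [sq_nonneg (‖d‖ - 1)]
  have h2 : ∫ d, f d.1 ∂(q.prod p) = ∫ c, f c ∂q :=
    (measurePreserving_fst (μ := q) (ν := p)).hasLaw.integral_comp hf.aestronglyMeasurable
  rwa [h2] at h

/-- Fluctuations of the treatments, with weights that depend on the rest of the environment. -/
theorem ae_eventually_treatment_fluctuation {T₁ T₂ : ℕ} {π₁ π₂ : unitInterval}
    (hd : TwoStageBernoulli S P T₁ T₂ π₁ π₂) (hi : IndepBlocks S P (T₁ + T₂))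
    (hc : ∀ N n, AEMeasurable (fun ω => S.coef N ω n) P)
    {a : (N : ℕ) → (Fin N → Coef M) × (Fin N → ℝ) × (Fin N → Fin M → ℝ) → Fin N → ℝ}
    (ha : ∀ N, Measurable (a N)) {s : ℕ} (hs : s < T₁ + T₂) :
    ∀ᵐ ω ∂P, ∀ᶠ N : ℕ in atTop,
      (∑ n, a N (S.coef N ω, S.Y₀ N ω, S.X N ω) n
          * (S.W N (s + 1) ω n - ((if s < T₁ then π₁ else π₂ : unitInterval) : ℝ))) ^ 4
        ≤ (N : ℝ) ^ (3 / 2 : ℝ) * (∑ n, a N (S.coef N ω, S.Y₀ N ω, S.X N ω) n ^ 2) ^ 2 := by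
  set π : unitInterval := if s < T₁ then π₁ else π₂ with hπ
  have hπ0 := π.2.1
  have hπ1 := π.2.2
  have key := ae_eventually_of_le_rpow (P := P) (s := fun N => {ω |
      (N : ℝ) ^ (3 / 2 : ℝ) * (∑ n, a N (S.coef N ω, S.Y₀ N ω, S.X N ω) n ^ 2) ^ 2
        < (∑ n, a N (S.coef N ω, S.Y₀ N ω, S.X N ω) n * (S.W N (s + 1) ω n - (π : ℝ))) ^ 4})
    -- The centered Bernoulli variable lies in [-1, 1], so its fourth moment is at most 1.
    (C := 3 * 1) (by norm_num) fun N hN => by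
      have hN' : (0 : ℝ) < N := by exact_mod_cast hN
      have hWm : ∀ t : Fin (T₁ + T₂), ∀ n, AEMeasurable (fun ω => S.W N ((t : ℕ) + 1) ω n) P :=
        fun t n => (hd.law N t t.2 n).aemeasurable
      have hset : MeasurableSet {p : (Fin (T₁ + T₂) → Fin N → ℝ) ×
          ((Fin N → Coef M) × (Fin N → ℝ) × (Fin N → Fin M → ℝ)) |
          (N : ℝ) ^ (3 / 2 : ℝ) * (∑ n, a N p.2 n ^ 2) ^ 2
            < (∑ n, a N p.2 n * (p.1 ⟨s, hs⟩ n - (π : ℝ))) ^ 4} := by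
        have h1 : ∀ n, Measurable fun p : (Fin (T₁ + T₂) → Fin N → ℝ) ×
            ((Fin N → Coef M) × (Fin N → ℝ) × (Fin N → Fin M → ℝ)) => a N p.2 n :=
          fun n => (measurable_pi_apply n).comp ((ha N).comp measurable_snd)
        have h2 : ∀ n, Measurable fun p : (Fin (T₁ + T₂) → Fin N → ℝ) ×
            ((Fin N → Coef M) × (Fin N → ℝ) × (Fin N → Fin M → ℝ)) => p.1 ⟨s, hs⟩ n :=
          fun n => (measurable_pi_apply n).comp ((measurable_pi_apply _).comp measurable_fst)
        exact measurableSet_lt (by fun_prop) (by fun_prop)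
      refine measure_le_of_indepFun (P := P) (X := fun ω (t : Fin (T₁ + T₂)) => S.W N ((t : ℕ) + 1) ω)
        (Y := fun ω => (S.coef N ω, S.Y₀ N ω, S.X N ω))
        (aemeasurable_pi_lambda _ fun t => aemeasurable_pi_lambda _ fun n => hWm t n)
        ((aemeasurable_pi_lambda _ fun n => hc N n).prodMk
          ((hi.meas_Y₀ N).aemeasurable.prodMk (hi.meas_X N).aemeasurable))
        (hi.W_indep N) hset fun y => ?_
      have hlaw : ∀ n, HasLaw (fun ω => S.W N (s + 1) ω n) (bernoulliMeasure (1 : ℝ) 0 π) P :=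
        fun n => hd.law N s hs n
      have hm : ∀ n, AEMeasurable (fun ω => S.W N (s + 1) ω n - (π : ℝ)) P :=
        fun n => (hlaw n).aemeasurable.sub_const _
      have hint : ∀ n, ∀ f : ℝ → ℝ, Measurable f → ∫ ω, f (S.W N (s + 1) ω n) ∂P
          = (π : ℝ) * f 1 + (1 - (π : ℝ)) * f 0 := fun n f hf => by
        have := (hlaw n).integral_comp (f := f) hf.aestronglyMeasurable
        rw [integral_bernoulliMeasure] at this
        exact this
      refine fourth_moment_tail (P := P) hm ?_ (fun n => ?_) (fun n => ?_) (fun n => ?_) (a N y)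
        (by positivity)
      · exact (hd.indep N).comp (fun n (w : Fin (T₁ + T₂) → ℝ) => w ⟨s, hs⟩ - (π : ℝ))
          fun n => (measurable_pi_apply _).sub_const _
      · refine memLp_four_of_integrable (hm n).aestronglyMeasurable ?_
        have h1 : Integrable (fun x : ℝ => (x - (π : ℝ)) ^ 4) (bernoulliMeasure (1 : ℝ) 0 π) :=
          integrable_bernoulliMeasure _ _ _ _
        rw [← (hlaw n).map_eq] at h1
        exact h1.comp_aemeasurable (hlaw n).aemeasurable
      · rw [hint n (fun x => x - (π : ℝ)) (by fun_prop)]; ring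
      · rw [hint n (fun x => (x - (π : ℝ)) ^ 4) (by fun_prop)]
        have h1 : (1 - (π : ℝ)) ^ 4 ≤ 1 := pow_le_one₀ (by linarith) (by linarith)
        have h2 : (0 - (π : ℝ)) ^ 4 ≤ 1 := by
          rw [zero_sub, Even.neg_pow (by decide)]
          exact pow_le_one₀ hπ0 hπ1
        nlinarith
  filter_upwards [key] with ω hω
  filter_upwards [hω] with N hN
  exact not_lt.1 hN

/-- Fluctuations of a coordinate of the coefficients, weighted by the initial outcomes. -/
theorem ae_eventually_coef_fluctuation {q : Measure (Coef M)} [IsProbabilityMeasure q]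
    {p : Measure (Fin M → ℝ)} [IsProbabilityMeasure p] {k : ℝ} (hk : 4 ≤ k) {T : ℕ}
    (hcov : ExtendedCovariates S P q p k) (hco : IIDCoefs S P q) (hi : IndepBlocks S P T)
    {f : Coef M → ℝ} (hf : Continuous f) (hfd : ∀ c (x : Fin M → ℝ), |f c| ≤ ‖(c, x)‖) :
    ∀ᵐ ω ∂P, ∀ᶠ N : ℕ in atTop,
      (∑ n, S.Y₀ N ω n * (f (S.coef N ω n) - ∫ c, f c ∂q)) ^ 4
        ≤ (N : ℝ) ^ (3 / 2 : ℝ) * (∑ n, S.Y₀ N ω n ^ 2) ^ 2 := by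
  -- The moment of order k is given for q × p, so integrability is checked there and passed to the
  -- marginal q.
  have hf4 : Integrable (fun c => f c ^ 4) q := by
    rw [← (measurePreserving_fst (μ := q) (ν := p)).integrable_comp
      (by exact (hf.pow 4).aestronglyMeasurable)]
    refine ((integrable_const (1 : ℝ)).add hcov.moment).mono'
      (by exact ((hf.comp continuous_fst).pow 4).aestronglyMeasurable) (ae_of_all _ fun d => ?_)
    simp only [Function.comp_apply, norm_pow, Pi.add_apply, Real.norm_eq_abs]
    calc |f d.1| ^ 4 ≤ ‖d‖ ^ 4 := by gcongr; exact hfd d.1 d.2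
      _ ≤ _ := pow_four_le_one_add_rpow (norm_nonneg _) hk
  have hmem : MemLp f 4 q := memLp_four_of_integrable hf.aestronglyMeasurable hf4
  set m := ∫ c, f c ∂q
  have hmem' : MemLp (fun c => f c - m) 4 q := hmem.sub (memLp_const m)
  set K := ∫ c, (f c - m) ^ 4 ∂q
  have hK : 0 ≤ K := integral_nonneg fun c => by positivity
  have key := ae_eventually_of_le_rpow (P := P) (s := fun N => {ω |
      (N : ℝ) ^ (3 / 2 : ℝ) * (∑ n, S.Y₀ N ω n ^ 2) ^ 2
        < (∑ n, S.Y₀ N ω n * (f (S.coef N ω n) - m)) ^ 4})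
    (C := 3 * K) (by positivity) fun N hN => by
      have hN' : (0 : ℝ) < N := by exact_mod_cast hN
      have hset : MeasurableSet {p : (Fin N → Coef M) × ((Fin N → ℝ) × (Fin N → Fin M → ℝ)) |
          (N : ℝ) ^ (3 / 2 : ℝ) * (∑ n, p.2.1 n ^ 2) ^ 2
            < (∑ n, p.2.1 n * (f (p.1 n) - m)) ^ 4} := by
        have h1 : ∀ n, Measurable fun p : (Fin N → Coef M) × ((Fin N → ℝ) × (Fin N → Fin M → ℝ)) =>
            f (p.1 n) := fun n => hf.measurable.comp ((measurable_pi_apply n).comp measurable_fst)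
        exact measurableSet_lt (by fun_prop) (by fun_prop)
      refine measure_le_of_indepFun (P := P) (X := S.coef N) (Y := fun ω => (S.Y₀ N ω, S.X N ω))
        (aemeasurable_pi_lambda _ fun n => (hco.law N n).aemeasurable)
        ((hi.meas_Y₀ N).aemeasurable.prodMk (hi.meas_X N).aemeasurable)
        (hi.coef_indep N) hset fun y => ?_
      refine fourth_moment_tail (P := P) (ξ := fun n ω => f (S.coef N ω n) - m)
        (fun n => (hf.measurable.comp_aemeasurable (hco.law N n).aemeasurable).sub_const m) ?_
        (fun n => ?_) (fun n => ?_) (fun n => ?_) y.1 (by positivity)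
      · exact (hco.indep N).comp (fun n c => f c - m) fun n => hf.measurable.sub_const m
      · have := hmem'
        rw [← (hco.law N n).map_eq] at this
        exact this.comp_of_map (hco.law N n).aemeasurable
      · have := (hco.law N n).integral_comp (f := fun c => f c - m)
          (hf.measurable.sub_const m).aestronglyMeasurable
        refine this.trans ?_
        rw [integral_sub (hmem.integrable (by norm_num)) (integrable_const _)]
        simp [m]
      · exact ((hco.law N n).integral_comp (f := fun c => (f c - m) ^ 4)
          ((hf.measurable.sub_const m).pow_const 4).aestronglyMeasurable).le
  filter_upwards [key] with ω hω
  filter_upwards [hω] with N hN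
  exact not_lt.1 hN

/-- The weighted averages of the initial outcomes factorize in the limit. -/
theorem ae_tendsto_popMean_coef_mul_initial {q : Measure (Coef M)} [IsProbabilityMeasure q]
    {p : Measure (Fin M → ℝ)} [IsProbabilityMeasure p] {k : ℝ} (hk : 4 ≤ k) {T : ℕ}
    (hcov : ExtendedCovariates S P q p k) (hco : IIDCoefs S P q) (hi : IndepBlocks S P T) {ν₀ : ℝ}
    (hin : InitialOutcomes S P ν₀)
    {f : Coef M → ℝ} (hf : Continuous f) (hfd : ∀ c (x : Fin M → ℝ), |f c| ≤ ‖(c, x)‖) :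
    ∀ᵐ ω ∂P, Tendsto (fun N => popMean fun n => f (S.coef N ω n) * S.Y₀ N ω n) atTop
      (𝓝 ((∫ c, f c ∂q) * ν₀)) := by
  filter_upwards [ae_eventually_coef_fluctuation hk hcov hco hi hf hfd, hin.mean, hin.second]
    with ω h1 h2 ⟨c, h3⟩
  -- Only the mean and second moment of Y₀ are needed: the coefficient is split into its mean and a
  -- centered part that is independent of Y₀.
  have h4 := (tendsto_popMean_mul_of_pow_four_le h1 (Eventually.of_forall h3)).add
    (h2.const_mul (∫ c, f c ∂q))
  rw [zero_add] at h4
  refine h4.congr fun N => ?_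
  rw [← popMean_const_mul, ← popMean_add]
  congr 1
  ext n
  ring

end Systems

-- Almost sure state evolution for counterfactual and observed outcomes.

namespace Systems

variable {Ω : Type*} {M : ℕ} [MeasurableSpace Ω] {P : Measure Ω} [IsProbabilityMeasure P]
  {S : Systems Ω M} {T : ℕ} {μ μ₀ : ℝ} {σ2 : ℝ≥0} {σ2t : ℕ → ℝ≥0} {σ2e : ℝ≥0}
  {q : Measure (Coef M)} [IsProbabilityMeasure q] {p : Measure (Fin M → ℝ)} [IsProbabilityMeasure p]
  {k ν₀ : ℝ}

theorem ae_tendsto_popMean_intercept (hk : 4 ≤ k) (hcov : ExtendedCovariates S P q p k) :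
    ∀ᵐ ω ∂P, Tendsto (fun N => popMean fun n =>
      (S.coef N ω n).base + (S.coef N ω n).covar ⬝ᵥ S.X N ω n) atTop
      (𝓝 (∫ d, (d.1.base + d.1.covar ⬝ᵥ d.2) ∂(q.prod p))) := by
  refine ae_tendsto_popMean hk hcov (f := fun d => d.1.base + d.1.covar ⬝ᵥ d.2) (C := 1 + M)
    ?_ fun d => ?_
  · exact (Coef.continuous_base.comp continuous_fst).add
      ((Coef.continuous_covar.comp continuous_fst).dotProduct continuous_snd)
  · have h1 := d.1.abs_base_le d.2
    have h2 := d.1.abs_covar_dotProduct_le d.2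
    have h3 : (0 : ℝ) ≤ M := M.cast_nonneg
    refine (abs_add_le _ _).trans ?_
    nlinarith [sq_nonneg (‖d‖ - 1)]

/-- State evolution, almost surely, for an assignment whose averages converge. -/
theorem ae_tendsto_popMean_outcome (hk : 4 ≤ k) (hg : GaussianModel S P T μ μ₀ σ2 σ2t σ2e)
    (hi : IndepBlocks S P T)
    (hW : ∀ N, ∀ t < T, ∀ n, AEMeasurable (fun ω => S.W N (t + 1) ω n) P)
    (hco : IIDCoefs S P q) (hcov : ExtendedCovariates S P q p k) (hin : InitialOutcomes S P ν₀)
    {V : (N : ℕ) → Ω → ℕ → Fin N → ℝ} (hV : S.IsAssignment T V) {w : ℕ → ℝ}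
    (hV1 : ∀ᵐ ω ∂P, ∀ N, ∀ t < T, ∀ n, |V N ω (t + 1) n| ≤ 1)
    (hl : ∀ t < T, ∀ᵐ ω ∂P, Tendsto (fun N => popMean fun n =>
      (S.coef N ω n).treat * V N ω (t + 1) n) atTop (𝓝 ((∫ c, c.treat ∂q) * w t)))
    (hgm : ∀ t < T, ∀ᵐ ω ∂P, Tendsto (fun N => popMean fun n =>
      (S.coef N ω n).inter * V N ω (t + 1) n) atTop (𝓝 ((∫ c, c.inter ∂q) * w t)))
    (h0g : 0 < T → ∀ᵐ ω ∂P, Tendsto (fun N => popMean fun n =>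
      S.gain N ω (V N ω) 0 n * S.Y₀ N ω n) atTop
        (𝓝 ((∫ c, c.carry ∂q + (∫ c, c.inter ∂q) * w 0) * ν₀)))
    (h0s : 0 < T → ∀ᵐ ω ∂P, ∃ c, ∀ᶠ N in atTop,
      popMean (fun n => S.sent N ω (V N ω) 0 n ^ 2) ≤ c)
    {t : ℕ} (ht : t ≤ T) :
    ∀ᵐ ω ∂P, Tendsto (fun N => popMean (S.outcome N ω (V N ω) t)) atTop
      (𝓝 (limitMean (μ + μ₀) (∫ d, (d.1.base + d.1.covar ⬝ᵥ d.2) ∂(q.prod p)) (∫ c, c.carry ∂q)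
        (∫ c, c.treat ∂q) (∫ c, c.inter ∂q) w ν₀ t)) := by
  have hc : ∀ N n, AEMeasurable (fun ω => S.coef N ω n) P := fun N n => (hco.law N n).aemeasurable
  have ty1 : ∀ᵐ ω ∂P, ∀ s < T, ∀ᶠ N in atTop, Typical s
      ((σ2 + σ2t s) * popMean (fun n => S.sent N ω (V N ω) s n ^ 2) + σ2e) (fun _ => 1)
      (fun n => S.outcome N ω (V N ω) (s + 1) n
        - (μ + μ₀) * popMean (S.sent N ω (V N ω) s)) :=
    ae_all_iff.2 fun s => eventually_imp_distrib_left.2 fun hs =>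
      ae_eventually_typical hg hi hW hc hV (v := fun _ _ _ => 1)
        (fun N => ⟨fun _ _ => 1, measurable_const, fun _ => rfl⟩) hs
  -- The gain at s + 1 involves the treatment at time s + 2, hence the bound s + 1 < T. It is a
  -- function of the environment alone, so it is admissible as a test vector.
  have ty2 : ∀ᵐ ω ∂P, ∀ s, s + 1 < T → ∀ᶠ N in atTop, Typical s
      ((σ2 + σ2t s) * popMean (fun n => S.sent N ω (V N ω) s n ^ 2) + σ2e)
      (S.gain N ω (V N ω) (s + 1))
      (fun n => S.outcome N ω (V N ω) (s + 1) n
        - (μ + μ₀) * popMean (S.sent N ω (V N ω) s)) :=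
    ae_all_iff.2 fun s => eventually_imp_distrib_left.2 fun hs =>
      ae_eventually_typical hg hi hW hc hV (v := fun N ω => S.gain N ω (V N ω) (s + 1))
        (fun N => by
          obtain ⟨D, hDm, hD⟩ := hV N
          refine ⟨fun e n => (e.2.1 n).carry + (e.2.1 n).inter * D e.1 (s + 1) n,
            measurable_pi_lambda _ fun n => ?_, fun ω => ?_⟩
          · have h1 : Measurable fun e : Env N T M => e.2.1 n :=
              (measurable_pi_apply n).comp measurable_snd.fst
            have h2 : Measurable fun e : Env N T M => D e.1 (s + 1) n :=
              (measurable_pi_apply n).comp ((hDm _).comp measurable_fst)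
            exact (Coef.continuous_carry.measurable.comp h1).add
              ((Coef.continuous_inter.measurable.comp h1).mul h2)
          · ext n
            rw [gain, hD ω _ hs]
            rfl) (by omega)
  filter_upwards [hV1, ae_eventually_popMean_norm_pow_le hk hcov,
    ae_tendsto_popMean_intercept hk hcov,
    ae_tendsto_popMean_coef hk hcov Coef.continuous_carry Coef.abs_carry_le,
    ae_all_iff.2 fun t => eventually_imp_distrib_left.2 (hl t),
    ae_all_iff.2 fun t => eventually_imp_distrib_left.2 (hgm t), hin.mean,
    eventually_imp_distrib_left.2 h0g, eventually_imp_distrib_left.2 h0s, ty1, ty2]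
    with ω a1 ⟨c, _, a2⟩ a3 a4 a5 a6 a7 a8 a9 a10 a11
  exact tendsto_popMean_outcome (V := fun N => V N ω) σ2.2 (fun t => (σ2t t).2) σ2e.2
    a1 a2 a3 a4 a5 a6 a7 a8 a9 a10 a11 ht

/-- Mean outcomes when nobody or everybody is treated. -/
theorem ae_tendsto_popMean_constOutcome (hk : 4 ≤ k) (hg : GaussianModel S P T μ μ₀ σ2 σ2t σ2e)
    (hi : IndepBlocks S P T)
    (hW : ∀ N, ∀ t < T, ∀ n, AEMeasurable (fun ω => S.W N (t + 1) ω n) P)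
    (hco : IIDCoefs S P q) (hcov : ExtendedCovariates S P q p k) (hin : InitialOutcomes S P ν₀)
    {w : ℝ} (hw : w = 0 ∨ w = 1) {t : ℕ} (ht : t ≤ T) :
    ∀ᵐ ω ∂P, Tendsto (fun N => popMean (S.constOutcome w N ω t)) atTop
      (𝓝 (limitMean (μ + μ₀) (∫ d, (d.1.base + d.1.covar ⬝ᵥ d.2) ∂(q.prod p)) (∫ c, c.carry ∂q)
        (∫ c, c.treat ∂q) (∫ c, c.inter ∂q) (fun _ => w) ν₀ t)) := by
  have hmul : ∀ f : Coef M → ℝ, Continuous f → (∀ c (x : Fin M → ℝ), |f c| ≤ ‖(c, x)‖) →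
      ∀ᵐ ω ∂P, Tendsto (fun N => popMean fun n => f (S.coef N ω n) * w) atTop
        (𝓝 ((∫ c, f c ∂q) * w)) := fun f hf hfd => by
    filter_upwards [ae_tendsto_popMean_coef hk hcov hf hfd] with ω h
    simp_rw [mul_comm _ w, popMean_const_mul]
    exact h.const_mul w
  refine ae_tendsto_popMean_outcome hk hg hi hW hco hcov hin (V := fun _ _ _ _ => w)
    (fun N => ⟨fun _ _ _ => w, fun _ => measurable_const, fun _ _ _ => rfl⟩)
    (ae_of_all _ fun ω N t _ n => ?_)
    (fun _ _ => hmul _ Coef.continuous_treat Coef.abs_treat_le)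
    (fun _ _ => hmul _ Coef.continuous_inter Coef.abs_inter_le) (fun _ => ?_) (fun _ => ?_) ht
  · rcases hw with rfl | rfl <;> simp
  · filter_upwards [ae_tendsto_popMean_coef_mul_initial hk hcov hco hi hin Coef.continuous_carry
        Coef.abs_carry_le,
      ae_tendsto_popMean_coef_mul_initial hk hcov hco hi hin Coef.continuous_inter
        Coef.abs_inter_le] with ω h1 h2
    have h3 := h1.add (h2.const_mul w)
    rw [show (∫ c, c.carry ∂q) * ν₀ + w * ((∫ c, c.inter ∂q) * ν₀)
      = (∫ c, c.carry ∂q + (∫ c, c.inter ∂q) * w) * ν₀ by ring] at h3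
    refine h3.congr fun N => ?_
    rw [← popMean_const_mul, ← popMean_add]
    congr 1
    ext n
    rw [gain]
    ring
  · filter_upwards [hin.message w hw] with ω ⟨c, hc⟩
    exact ⟨c, Eventually.of_forall hc⟩

theorem ae_treatment_eq_zero_or_one {T₁ T₂ : ℕ} {π₁ π₂ : unitInterval}
    (hd : TwoStageBernoulli S P T₁ T₂ π₁ π₂) :
    ∀ᵐ ω ∂P, ∀ N, ∀ t < T₁ + T₂, ∀ n, S.W N (t + 1) ω n = 0 ∨ S.W N (t + 1) ω n = 1 := by
  refine ae_all_iff.2 fun N => ae_all_iff.2 fun t => eventually_imp_distrib_left.2 fun ht =>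
    ae_all_iff.2 fun n => ?_
  have hm : MeasurableSet {x : ℝ | x = 0 ∨ x = 1} :=
    ((measurableSet_singleton (1 : ℝ)).insert 0)
  have h := hd.law N t ht n
  refine ae_of_ae_map (p := fun x : ℝ => x = 0 ∨ x = 1) h.aemeasurable ?_
  rw [h.map_eq, bernoulliMeasure_def, ae_add_measure_iff]
  exact ⟨Measure.ae_smul_measure ((ae_dirac_iff hm).2 (Or.inr rfl)) _,
    Measure.ae_smul_measure ((ae_dirac_iff hm).2 (Or.inl rfl)) _⟩

/-- Mean outcomes in the two-stage experiment. -/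
theorem ae_tendsto_obsMean (hk : 4 ≤ k) {T₁ T₂ : ℕ} {π₁ π₂ : unitInterval}
    (hg : GaussianModel S P (T₁ + T₂) μ μ₀ σ2 σ2t σ2e) (hd : TwoStageBernoulli S P T₁ T₂ π₁ π₂)
    (hi : IndepBlocks S P (T₁ + T₂))
    (hco : IIDCoefs S P q) (hcov : ExtendedCovariates S P q p k) (hin : InitialOutcomes S P ν₀)
    {t : ℕ} (ht : t ≤ T₁ + T₂) :
    ∀ᵐ ω ∂P, Tendsto (fun N => S.obsMean N ω t) atTop
      (𝓝 (limitMean (μ + μ₀) (∫ d, (d.1.base + d.1.covar ⬝ᵥ d.2) ∂(q.prod p)) (∫ c, c.carry ∂q)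
        (∫ c, c.treat ∂q) (∫ c, c.inter ∂q) (fun t => if t < T₁ then (π₁ : ℝ) else π₂) ν₀ t)) := by
  have hc : ∀ N n, AEMeasurable (fun ω => S.coef N ω n) P := fun N n => (hco.law N n).aemeasurable
  have hπ : ∀ t, (if t < T₁ then (π₁ : ℝ) else π₂)
      = ((if t < T₁ then π₁ else π₂ : unitInterval) : ℝ) := fun t => by split_ifs <;> rfl
  simp_rw [hπ]
  have h01 := ae_treatment_eq_zero_or_one hd
  have hfl : ∀ f : Coef M → ℝ, Continuous f → (∀ c (x : Fin M → ℝ), |f c| ≤ ‖(c, x)‖) →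
      ∀ s < T₁ + T₂, ∀ᵐ ω ∂P, Tendsto (fun N => popMean fun n =>
        f (S.coef N ω n) * (S.W N (s + 1) ω n
          - ((if s < T₁ then π₁ else π₂ : unitInterval) : ℝ))) atTop (𝓝 0) := by
    intro f hf hfd s hs
    filter_upwards [ae_eventually_treatment_fluctuation hd hi hc (a := fun N e n => f (e.1 n))
      (fun N => measurable_pi_lambda _ fun n => hf.measurable.comp
        ((measurable_pi_apply n).comp measurable_fst)) hs,
      ae_eventually_popMean_norm_pow_le hk hcov] with ω h1 ⟨c, _, h2⟩
    refine tendsto_popMean_mul_of_pow_four_le h1 (c := 1 + c) ?_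
    filter_upwards [exists_popMean_sq_norm_le h2] with N hN
    refine (popMean_mono fun n => ?_).trans hN
    rw [← sq_abs]
    gcongr
    exact hfd _ _
  have hmul : ∀ f : Coef M → ℝ, Continuous f → (∀ c (x : Fin M → ℝ), |f c| ≤ ‖(c, x)‖) →
      ∀ s < T₁ + T₂, ∀ᵐ ω ∂P, Tendsto (fun N => popMean fun n =>
        f (S.coef N ω n) * S.W N (s + 1) ω n) atTop
          (𝓝 ((∫ c, f c ∂q) * ((if s < T₁ then π₁ else π₂ : unitInterval) : ℝ))) := by
    intro f hf hfd s hs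
    filter_upwards [hfl f hf hfd s hs, ae_tendsto_popMean_coef hk hcov hf hfd] with ω h1 h2
    have h3 := h1.add (h2.const_mul ((if s < T₁ then π₁ else π₂ : unitInterval) : ℝ))
    rw [zero_add, mul_comm] at h3
    refine h3.congr fun N => ?_
    rw [← popMean_const_mul, ← popMean_add]
    congr 1
    ext n
    ring
  refine ae_tendsto_popMean_outcome hk hg hi (fun N t ht n => (hd.law N t ht n).aemeasurable)
    hco hcov hin (V := fun N ω s n => S.W N s ω n)
    (fun N => ⟨fun W t => if h : t < T₁ + T₂ then W ⟨t, h⟩ else 0, fun t => ?_, fun ω t ht => ?_⟩)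
    ?_ (hmul _ Coef.continuous_treat Coef.abs_treat_le)
    (hmul _ Coef.continuous_inter Coef.abs_inter_le) (fun hT => ?_) (fun hT => ?_) ht
  · dsimp only
    split_ifs with h
    · exact measurable_pi_apply _
    · exact measurable_const
  · simp only [ht, dif_pos]
  · filter_upwards [h01] with ω h N t ht n
    rcases h N t ht n with h | h <;> simp [h]
  -- The weight Λ + ΓY₀ is the difference of the treated and the untreated first message, so its
  -- second moment is bounded by assumption. The part due to Λ is subtracted again through `hfl`.
  · have hm : ∀ N, Measurable fun (e : (Fin N → Coef M) × (Fin N → ℝ) × (Fin N → Fin M → ℝ)) n =>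
        (e.1 n).treat + (e.1 n).inter * e.2.1 n := fun N => measurable_pi_lambda _ fun n => by
      have h1 : Measurable fun (e : (Fin N → Coef M) × (Fin N → ℝ) × (Fin N → Fin M → ℝ)) =>
        e.1 n := (measurable_pi_apply n).comp measurable_fst
      exact (Coef.continuous_treat.measurable.comp h1).add
        ((Coef.continuous_inter.measurable.comp h1).mul
          ((measurable_pi_apply n).comp measurable_snd.fst))
    filter_upwards [ae_tendsto_popMean_coef_mul_initial hk hcov hco hi hin Coef.continuous_carry
        Coef.abs_carry_le,
      ae_tendsto_popMean_coef_mul_initial hk hcov hco hi hin Coef.continuous_inter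
        Coef.abs_inter_le,
      ae_eventually_treatment_fluctuation hd hi hc hm hT,
      hfl _ Coef.continuous_treat Coef.abs_treat_le 0 hT, hin.message 0 (Or.inl rfl),
      hin.message 1 (Or.inr rfl)] with ω h1 h2 h3 h4 ⟨c0, h5⟩ ⟨c1, h6⟩
    have h7 := tendsto_popMean_mul_of_pow_four_le h3 (c := 2 * c0 + 2 * c1)
      (Eventually.of_forall fun N => by
        calc popMean (fun n => ((S.coef N ω n).treat + (S.coef N ω n).inter * S.Y₀ N ω n) ^ 2)
            ≤ popMean (fun n =>
                2 * outcomeFun (S.coef N ω n) (S.X N ω n) 0 (S.Y₀ N ω n) ^ 2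
                + 2 * outcomeFun (S.coef N ω n) (S.X N ω n) 1 (S.Y₀ N ω n) ^ 2) :=
              popMean_mono fun n => by
                rw [show (S.coef N ω n).treat + (S.coef N ω n).inter * S.Y₀ N ω n
                  = outcomeFun (S.coef N ω n) (S.X N ω n) 1 (S.Y₀ N ω n)
                    - outcomeFun (S.coef N ω n) (S.X N ω n) 0 (S.Y₀ N ω n) by
                  rw [outcomeFun, outcomeFun]; ring]
                nlinarith [sq_nonneg (outcomeFun (S.coef N ω n) (S.X N ω n) 1 (S.Y₀ N ω n)
                    + outcomeFun (S.coef N ω n) (S.X N ω n) 0 (S.Y₀ N ω n))]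
          _ ≤ _ := by
            rw [popMean_add, popMean_const_mul, popMean_const_mul]
            linarith [h5 N, h6 N])
    set π : ℝ := ((if 0 < T₁ then π₁ else π₂ : unitInterval) : ℝ)
    have h8 := (h1.add (h2.const_mul π)).add (h7.sub h4)
    rw [show (∫ c, c.carry ∂q) * ν₀ + π * ((∫ c, c.inter ∂q) * ν₀) + (0 - 0)
      = (∫ c, c.carry ∂q + (∫ c, c.inter ∂q) * π) * ν₀ by ring] at h8
    refine h8.congr fun N => ?_
    rw [← popMean_const_mul, ← popMean_add, ← popMean_sub, ← popMean_add]
    congr 1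
    ext n
    rw [gain]
    ring
  · filter_upwards [h01, hin.message 0 (Or.inl rfl), hin.message 1 (Or.inr rfl)]
      with ω h ⟨c0, h5⟩ ⟨c1, h6⟩
    -- Each unit sends either its treated or its untreated first message, so the two bounds add up
    -- to one for the observed messages.
    refine ⟨c0 + c1, Eventually.of_forall fun N => ?_⟩
    refine le_trans ?_ (add_le_add (h5 N) (h6 N))
    rw [← popMean_add]
    refine popMean_mono fun n => ?_
    have hs : S.sent N ω (fun s n => S.W N s ω n) 0 n
      = outcomeFun (S.coef N ω n) (S.X N ω n) (S.W N (0 + 1) ω n) (S.Y₀ N ω n) := rfl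
    rw [hs]
    rcases h N 0 hT n with h | h <;> rw [h]
    · exact le_add_of_nonneg_right (sq_nonneg _)
    · exact le_add_of_nonneg_left (sq_nonneg _)

end Systems

-- The consistency theorem.

theorem theorem2 {Ω : Type*} [MeasurableSpace Ω] (P : Measure Ω) [IsProbabilityMeasure P]
    {M : ℕ} (S : Systems Ω M) (T₁ T₂ : ℕ) (π₁ π₂ : unitInterval) (hπ : π₁ ≠ π₂)
    (μ μ₀ : ℝ) (σ2 : ℝ≥0) (σ2t : ℕ → ℝ≥0) (σ2e : ℝ≥0)
    (q : Measure (Coef M)) [IsProbabilityMeasure q]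
    (p : Measure (Fin M → ℝ)) [IsProbabilityMeasure p]
    (k : ℝ) (hk : 4 ≤ k) (ν₀ : ℝ)
    (hgauss : GaussianModel S P (T₁ + T₂) μ μ₀ σ2 σ2t σ2e)
    (hdesign : TwoStageBernoulli S P T₁ T₂ π₁ π₂)
    (hcoef : IIDCoefs S P q)
    (hindep : IndepBlocks S P (T₁ + T₂))
    (hcov : ExtendedCovariates S P q p k)
    (hinit : InitialOutcomes S P ν₀)
    (hreg₁ : NonconstantLimitMeans S P 0 T₁)
    (hreg₂ : NonconstantLimitMeans S P T₁ T₂) :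
    ∀ t ≤ T₁ + T₂, ∃ τ : ℝ, IsTTE S P t τ ∧
      ∀ᵐ ω ∂P, Tendsto
        (fun N => TTEAlg.tteHat T₁ T₂ (π₁ : ℝ) (π₂ : ℝ) (S.obsMean N ω) t) atTop (𝓝 τ) := by
  intro t ht
  have hW : ∀ N, ∀ t < T₁ + T₂, ∀ n, AEMeasurable (fun ω => S.W N (t + 1) ω n) P :=
    fun N t ht n => (hdesign.law N t ht n).aemeasurable
  have hobs := fun t ht =>
    Systems.ae_tendsto_obsMean (t := t) hk hgauss hdesign hindep hcoef hcov hinit ht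
  set β := ∫ d, (d.1.base + d.1.covar ⬝ᵥ d.2) ∂(q.prod p)
  set ν := limitMean (μ + μ₀) β (∫ c, c.carry ∂q) (∫ c, c.treat ∂q) (∫ c, c.inter ∂q)
    (fun t => if t < T₁ then (π₁ : ℝ) else π₂) ν₀ with hν
  -- Two almost sure limits agree on a common sample point, so the assumed distinct limits are
  -- values of the deterministic recursion and make both regressions nondegenerate.
  have huniq : ∀ t ≤ T₁ + T₂, ∀ a, IsLimitMean S P t a → ν t = a := fun t ht a ha => by
    obtain ⟨ω, h1, h2⟩ := ((hobs t ht).and ha).exists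
    exact tendsto_nhds_unique h1 h2
  obtain ⟨i₁, hi₁, j₁, hj₁, a₁, b₁, hab₁, ha₁, hb₁⟩ := hreg₁
  obtain ⟨i₂, hi₂, j₂, hj₂, a₂, b₂, hab₂, ha₂, hb₂⟩ := hreg₂
  rw [zero_add] at ha₁ hb₁
  refine ⟨limitMean (μ + μ₀) β (∫ c, c.carry ∂q) (∫ c, c.treat ∂q) (∫ c, c.inter ∂q)
      (fun _ => 1) ν₀ t
    - limitMean (μ + μ₀) β (∫ c, c.carry ∂q) (∫ c, c.treat ∂q) (∫ c, c.inter ∂q)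
      (fun _ => 0) ν₀ t, ?_, ?_⟩
  · filter_upwards [Systems.ae_tendsto_popMean_constOutcome hk hgauss hindep hW hcoef hcov hinit
        (Or.inr rfl) ht,
      Systems.ae_tendsto_popMean_constOutcome hk hgauss hindep hW hcoef hcov hinit
        (Or.inl rfl) ht] with ω h1 h0
    exact (h1.sub h0).congr fun N => (popMean_sub _ _).symm
  · filter_upwards [ae_all_iff.2 fun t => eventually_imp_distrib_left.2 (hobs t)] with ω h
    refine TTEAlg.tendsto_tteHat (Subtype.coe_injective.ne hπ) hν h hi₁ hj₁ ?_ hi₂ hj₂ ?_ ht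
    · rw [huniq i₁ (by omega) _ ha₁, huniq j₁ (by omega) _ hb₁]
      exact hab₁
    · rw [huniq _ (by omega) _ ha₂, huniq _ (by omega) _ hb₂]
      exact hab₂

end
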